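/- Fix a finite alphabet $\Sigma$. The machine model is the deterministic random access machine with unit-cost instructions (constants, addition, truncated subtraction, halving, indirect load and store, reading an input letter, jump on zero, writing an output letter, completing an output word) that is polynomially restricted: there is a polynomial $q$ such that on every input $x$ each register content has at all times at most $q(|x|)$ bits. A parametrised enumeration problem over $\Sigma$ is a triple $E=(Q,\kappa,\mathrm{Sol})$ where $Q\subseteq\Sigma^*$ is decidable in polynomial time, $\kappa\colon\Sigma^*\to\mathbb N$ is computable in polynomial time, and $\mathrm{Sol}$ is a computable map that assigns to each $x\in\Sigma^*$ a finite set $\mathrm{Sol}(x)\subseteq\Sigma^*$, such that $\mathrm{Sol}(x)\neq\emptyset$ if and only if $x\in Q$, the relation $\{(x,y)\mid y\in\mathrm{Sol}(x)\}$ is in $\mathrm P$, and for some polynomial $p$ we have $|y|\le p(|x|)$ for all $x\in Q$ and $y\in\mathrm{Sol}(x)$. An enumeration algorithm for $E$ is a machine that on every input $x\in\Sigma^*$ halts and outputs exactly the elements of $\mathrm{Sol}(x)$, without duplicates. For $0\le i\le n=|\mathrm{Sol}(x)|$, its $i$-th delay on $x$ is the time between the $i$-th and the $(i+1)$-st output,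 where the start of the computation counts as the $0$-th output and the halting of the algorithm as the $(n+1)$-st. Consider enumeration algorithms $\mathcal A$, computable functions $t\colon\mathbb N\to\mathbb N$ and polynomials $p$ (with coefficients in $\mathbb N$, in one variable or, for $\mathrm{IncFPT}$, in two), and let - $\mathrm{DelayFPT}$ be the class of all $E$ for which there are $\mathcal A,t,p$ such that for all $x\in\Sigma^*$ and $0\le i\le|\mathrm{Sol}(x)|$ the $i$-th delay of $\mathcal A$ on $x$ is at most $t(\kappa(x))\cdot p(|x|)$; - $\mathrm{IncFPT}$ be the class of all $E$ for which there are $\mathcal A,t,p$ such that for all $x\in\Sigma^*$ and $0\le i\le|\mathrm{Sol}(x)|$ the $i$-th delay of $\mathcal A$ on $x$ is at most $t(\kappa(x))\cdot p(|x|,i)$; - $\mathrm{CapIncFPT}_a$, for $a\in\mathbb N$, be the class of all $E$ for which there are $\mathcal A,t,p$ such that for all $x\in\Sigma^*$ and $0\le i\le|\mathrm{Sol}(x)|$ the algorithm $\mathcal A$ on $x$ outputs $i$ elements of $\mathrm{Sol}(x)$ in time $t(\kappa(x))\cdot i^a\cdot p(|x|)$; - $\mathrm{CapIncFPT}=\bigcup_{a\in\mathbb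 N}\mathrm{CapIncFPT}_a$. Then $\mathrm{CapIncFPT}_1=\mathrm{DelayFPT}$ and $\mathrm{CapIncFPT}=\mathrm{IncFPT}$. -/

import Mathlib

namespace EnumFPT

/-- Words over the alphabet with `s` letters. -/
abbrev Word (s : ℕ) : Type := List (Fin s)

/-- Instructions of a deterministic random access machine with a read-only input array and a
write-only output. The work registers are indexed by the natural numbers and hold natural numbers.
The arithmetic operations are addition, truncated subtraction and halving (rounded down). -/
inductive Instr (s : ℕ) : Type
  /-- `R[d] := c` -/
  | const (d c : ℕ)
  /-- `R[d] := R[a] + R[b]` -/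
  | add (d a b : ℕ)
  /-- `R[d] := R[a] - R[b]`, cut off at `0` -/
  | sub (d a b : ℕ)
  /-- `R[d] := ⌊R[a] / 2⌋` -/
  | half (d a : ℕ)
  /-- `R[d] := R[R[a]]` -/
  | load (d a : ℕ)
  /-- `R[R[a]] := R[b]` -/
  | store (a b : ℕ)
  /-- `R[d] := 1 +` (the input letter at position `R[a]`), and `0` beyond the end of the input -/
  | read (d a : ℕ)
  /-- jump to instruction `l` if `R[a] = 0` -/
  | jz (a l : ℕ)
  /-- append a letter to the word being written -/
  | write (σ : Fin s)
  /-- output the word written since the previous output -/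
  | emit

/-- A program; it halts when the program counter leaves it. -/
abbrev Program (s : ℕ) : Type := List (Instr s)

/-- A configuration: program counter, work registers, word being written, words output so far
(in order). -/
structure Cfg (s : ℕ) : Type where
  pc : ℕ
  reg : ℕ → ℕ
  buf : Word s
  out : List (Word s)

/-- All work registers are initially `0`. -/
def initCfg (s : ℕ) : Cfg s := ⟨0, fun _ => 0, [], []⟩

/-- The number the machine sees at position `j` of the input array. -/
def inputAt {s : ℕ} (x : Word s) (j : ℕ) : ℕ :=
  match x[j]? with
  | some a => a.val + 1
  | none => 0

/-- The effect of one instruction. -/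
def exec {s : ℕ} (x : Word s) (c : Cfg s) : Instr s → Cfg s
  | .const d k => ⟨c.pc + 1, Function.update c.reg d k, c.buf, c.out⟩
  | .add d a b => ⟨c.pc + 1, Function.update c.reg d (c.reg a + c.reg b), c.buf, c.out⟩
  | .sub d a b => ⟨c.pc + 1, Function.update c.reg d (c.reg a - c.reg b), c.buf, c.out⟩
  | .half d a => ⟨c.pc + 1, Function.update c.reg d (c.reg a / 2), c.buf, c.out⟩
  | .load d a => ⟨c.pc + 1, Function.update c.reg d (c.reg (c.reg a)), c.buf, c.out⟩
  | .store a b => ⟨c.pc + 1, Function.update c.reg (c.reg a) (c.reg b), c.buf, c.out⟩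
  | .read d a => ⟨c.pc + 1, Function.update c.reg d (inputAt x (c.reg a)), c.buf, c.out⟩
  | .jz a l => ⟨if c.reg a = 0 then l else c.pc + 1, c.reg, c.buf, c.out⟩
  | .write σ => ⟨c.pc + 1, c.reg, c.buf ++ [σ], c.out⟩
  | .emit => ⟨c.pc + 1, c.reg, [], c.out ++ [c.buf]⟩

/-- One step of the program `P` on input `x`; halted configurations do not change. -/
def step {s : ℕ} (P : Program s) (x : Word s) (c : Cfg s) : Cfg s :=
  match P[c.pc]? with
  | some I => exec x c I
  | none => c

/-- The configuration after `m` steps (every instruction takes one unit of time). -/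
def run {s : ℕ} (P : Program s) (x : Word s) (m : ℕ) : Cfg s :=
  (step P x)^[m] (initCfg s)

/-- `P` on input `x` has halted after at most `m` steps. -/
def HaltedAt {s : ℕ} (P : Program s) (x : Word s) (m : ℕ) : Prop :=
  P.length ≤ (run P x m).pc

/-- The machine is polynomially restricted: the (binary) size of each register content is at all
times bounded by a polynomial in the input length. -/
def PolyRestricted {s : ℕ} (P : Program s) : Prop :=
  ∃ q : Polynomial ℕ, ∀ (x : Word s) (m r : ℕ), ((run P x m).reg r).size ≤ q.eval x.length

/-- `f` is computable in polynomial time; the result is returned in register `0`. -/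
def PolyTimeComputable {s : ℕ} (f : Word s → ℕ) : Prop :=
  ∃ (P : Program s) (p : Polynomial ℕ), ∀ x : Word s,
    ∃ m ≤ p.eval x.length, HaltedAt P x m ∧ (run P x m).reg 0 = f x

/-- Membership in the class P. -/
def PolyTimeDecidable {s : ℕ} (L : Set (Word s)) : Prop :=
  ∃ f : Word s → ℕ, PolyTimeComputable f ∧ ∀ x, x ∈ L ↔ f x ≠ 0

/-- The pair `(x, y)` as the word `x#y`, where `#` is a new letter. -/
def pairWord {s : ℕ} (x y : Word s) : Word (s + 1) :=
  x.map Fin.castSucc ++ Fin.last s :: y.map Fin.castSucc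

/-- Parametrised enumeration problems over the alphabet with `s` letters. -/
structure PEP (s : ℕ) : Type where
  /-- the instances that have solutions -/
  Q : Set (Word s)
  /-- the parametrisation -/
  κ : Word s → ℕ
  /-- the (finite) set of solutions -/
  Sol : Word s → Finset (Word s)
  Q_mem_P : PolyTimeDecidable Q
  κ_polyTime : PolyTimeComputable κ
  Sol_computable : ∃ f : Word s → List (Word s), Computable f ∧ ∀ x, (f x).toFinset = Sol x
  Sol_nonempty_iff : ∀ x, (Sol x).Nonempty ↔ x ∈ Q
  Sol_mem_P : PolyTimeDecidable {w : Word (s + 1) | ∃ x y, y ∈ Sol x ∧ w = pairWord x y}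
  Sol_length : ∃ p : Polynomial ℕ, ∀ x ∈ Q, ∀ y ∈ Sol x, y.length ≤ p.eval x.length

/-- `P` is an enumeration algorithm for `E`: a (polynomially restricted) machine that halts on
every input `x`, having output exactly the elements of `Sol(x)`, without duplicates. -/
def IsEnumAlg {s : ℕ} (E : PEP s) (P : Program s) : Prop :=
  PolyRestricted P ∧
    ∀ x, ∃ m, HaltedAt P x m ∧ (run P x m).out.Nodup ∧ (run P x m).out.toFinset = E.Sol x

/-- The time at which the `i`-th output (counted from `1`) is made; `outTime P x 0 = 0`. -/
noncomputable def outTime {s : ℕ} (P : Program s) (x : Word s) (i : ℕ) : ℕ :=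
  sInf {m | i ≤ (run P x m).out.length}

/-- The time at which `P` halts on input `x`. -/
noncomputable def haltTime {s : ℕ} (P : Program s) (x : Word s) : ℕ :=
  sInf {m | HaltedAt P x m}

/-- The `i`-th delay, for `0 ≤ i ≤ |Sol(x)|`: the time between the `i`-th and the `(i+1)`-st output,
where the start of the computation counts as the `0`-th output and halting as the last one. -/
noncomputable def delay {s : ℕ} (E : PEP s) (P : Program s) (x : Word s) (i : ℕ) : ℕ :=
  (if i < (E.Sol x).card then outTime P x (i + 1) else haltTime P x) - outTime P x i

/-- Problems with an algorithm whose delays are all at most `t(κ(x)) · p(|x|)`. -/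
def DelayFPT (s : ℕ) : Set (PEP s) :=
  {E | ∃ P : Program s, IsEnumAlg E P ∧
    ∃ (t : ℕ → ℕ) (p : Polynomial ℕ), Computable t ∧
      ∀ x, ∀ i ≤ (E.Sol x).card, delay E P x i ≤ t (E.κ x) * p.eval x.length}

/-- Problems with an algorithm whose `i`-th delay is at most `t(κ(x)) · p(|x|, i)`. -/
def IncFPT (s : ℕ) : Set (PEP s) :=
  {E | ∃ P : Program s, IsEnumAlg E P ∧
    ∃ (t : ℕ → ℕ) (p : MvPolynomial (Fin 2) ℕ), Computable t ∧
      ∀ x, ∀ i ≤ (E.Sol x).card,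
        delay E P x i ≤ t (E.κ x) * MvPolynomial.eval ![x.length, i] p}

/-- Problems with an algorithm that outputs `i` solutions in time `t(κ(x)) · i ^ a · p(|x|)`, for
every `0 ≤ i ≤ |Sol(x)|`. -/
def CapIncFPTSlice (s a : ℕ) : Set (PEP s) :=
  {E | ∃ P : Program s, IsEnumAlg E P ∧
    ∃ (t : ℕ → ℕ) (p : Polynomial ℕ), Computable t ∧
      ∀ x, ∀ i ≤ (E.Sol x).card, outTime P x i ≤ t (E.κ x) * i ^ a * p.eval x.length}

/-- The union of all exponent slices. -/
def CapIncFPT (s : ℕ) : Set (PEP s) := ⋃ a : ℕ, CapIncFPTSlice s a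

end EnumFPT

/-! Two of the four inclusions come from adding up delays: before the `i`-th output there are only
`i` delays, and a polynomial in `|x|` and `i` is at most `q(|x|) * (i + 1) ^ a` (`outTime_le_mul`,
`exists_eval_le_mul_pow`).

For the other two, let `P` make `i` outputs in time `t(κ(x)) * i ^ (b + 1) * p(|x|)`. The lemma
`exists_enumAlg_of_outTime_le` turns `P` into a machine whose `i`-th delay is at most `t'(κ(x)) *
p'(|x|) * (i + 1) ^ b`; the case `b = 0` gives `DelayFPT`, general `b` gives `IncFPT`. The new
machine works in phases. Phase `j` simulates `S * j ^ b` steps of `P`, collects the output of `P` in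
a queue, and releases one word. For `S = t(κ(x)) * (b + 1) * C * (|x| + 1) ^ d`, where `C * (|x| +
1) ^ d` bounds `p(|x|)`, the steps of the first `j` phases add up to at least the time of the `j`-th
output of `P` (`pow_succ_le_phaseSum`). Hence a word is waiting in every phase until all are
released, and an empty queue proves that the enumeration is complete.

The obstacle is the computation of `S`: the function `t` is merely computable, whereas the registers
must keep polynomial size. So a machine `M` for `t` is run on `κ(x)` for only `|x|` steps, in which
values essentially grow by a factor of at most `2 ^ |x|`. If `M` halts, `S` is known. If not, `|x|`
is bounded by a computable function `T` of `κ(x)`, hence the running time of `P` on `x` is bounded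
by a computable function `H(T(κ(x)))` of the parameter alone; then `P` is simulated directly and the
whole run is charged to `t'`.

The rest realises this on the machine model. The judgement `Tri` bounds time and register contents
together, and the second bound makes the new machine polynomially restricted. Virtual machines live
in interleaved memories (`simStep_spec`). The machine `M` exists by `exists_cmd_of_partrec`; the
bounds `T` and `H` exist because a single machine step is primitive recursive. -/

namespace EnumFPT

/-! ### Structured programs and a Hoare calculus with time and value bounds -/

/-- The state of a machine without its program counter. -/
structure St (s : ℕ) : Type where
  reg : ℕ → ℕ
  buf : Word s
  out : List (Word s)

/-- The configuration with state `σ` and program counter `l`. -/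
def St.at {s : ℕ} (σ : St s) (l : ℕ) : Cfg s := ⟨l, σ.reg, σ.buf, σ.out⟩

/-- Assign `v` to register `d`. -/
def St.set {s : ℕ} (σ : St s) (d v : ℕ) : St s := ⟨Function.update σ.reg d v, σ.buf, σ.out⟩

@[simp] theorem St.set_buf {s : ℕ} (σ : St s) (d v : ℕ) : (σ.set d v).buf = σ.buf := rfl
@[simp] theorem St.set_out {s : ℕ} (σ : St s) (d v : ℕ) : (σ.set d v).out = σ.out := rfl
theorem St.set_reg {s : ℕ} (σ : St s) (d v a : ℕ) :
    (σ.set d v).reg a = if a = d then v else σ.reg a := by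
  simp [St.set, Function.update_apply]

/-- The effect of an instruction other than a jump on the state. -/
def eff {s : ℕ} (x : Word s) (σ : St s) : Instr s → St s
  | .const d k => σ.set d k
  | .add d a b => σ.set d (σ.reg a + σ.reg b)
  | .sub d a b => σ.set d (σ.reg a - σ.reg b)
  | .half d a => σ.set d (σ.reg a / 2)
  | .load d a => σ.set d (σ.reg (σ.reg a))
  | .store a b => σ.set (σ.reg a) (σ.reg b)
  | .read d a => σ.set d (inputAt x (σ.reg a))
  | .jz _ _ => σ
  | .write a => ⟨σ.reg, σ.buf ++ [a], σ.out⟩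
  | .emit => ⟨σ.reg, [], σ.out ++ [σ.buf]⟩

/-- The instruction is not a jump, and a value it writes satisfies `G`. -/
def Safe {s : ℕ} (G : ℕ → Prop) (x : Word s) (σ : St s) : Instr s → Prop
  | .const _ k => G k
  | .add _ a b => G (σ.reg a + σ.reg b)
  | .sub _ a b => G (σ.reg a - σ.reg b)
  | .half _ a => G (σ.reg a / 2)
  | .load _ a => G (σ.reg (σ.reg a))
  | .store _ b => G (σ.reg b)
  | .read _ a => G (inputAt x (σ.reg a))
  | .jz _ _ => False
  | .write _ => True
  | .emit => True

/-- The block of instructions executes safely from `σ` and ends in a state satisfying `Q`. -/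
def BlkOk {s : ℕ} (G : ℕ → Prop) (x : Word s) : List (Instr s) → St s → (St s → Prop) → Prop
  | [], σ, Q => Q σ
  | I :: is, σ, Q => Safe G x σ I ∧ BlkOk G x is (eff x σ I) Q

/-- Structured programs. Register `0` is reserved for unconditional jumps. -/
inductive Cmd (s : ℕ) : Type
  /-- a block of instructions without jumps -/
  | blk (is : List (Instr s))
  | seq (c d : Cmd s)
  /-- if `R[a] = 0` then `c` else `d` -/
  | ite (a : ℕ) (c d : Cmd s)
  /-- while `R[a] ≠ 0` do `c` -/
  | loop (a : ℕ) (c : Cmd s)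

/-- The number of instructions. -/
def Cmd.size {s : ℕ} : Cmd s → ℕ
  | .blk is => is.length
  | .seq c d => c.size + d.size
  | .ite _ c d => 3 + d.size + c.size
  | .loop _ c => 3 + c.size

/-- The machine code of a structured program, placed at address `l`. -/
def Cmd.code {s : ℕ} : Cmd s → ℕ → List (Instr s)
  | .blk is, _ => is
  | .seq c d, l => c.code l ++ d.code (l + c.size)
  | .ite a c d, l => .jz a (l + 3 + d.size) :: (d.code (l + 1) ++
      (.const 0 0 :: .jz 0 (l + 3 + d.size + c.size) :: c.code (l + 3 + d.size)))
  | .loop a c, l => .jz a (l + 3 + c.size) :: (c.code (l + 1) ++ [.const 0 0, .jz 0 l])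

theorem Cmd.code_length {s : ℕ} (c : Cmd s) (l : ℕ) : (c.code l).length = c.size := by
  induction c generalizing l with
  | blk is => rfl
  | seq c d hc hd => simp [Cmd.code, Cmd.size, hc, hd]
  | ite a c d hc hd => simp [Cmd.code, Cmd.size, hc, hd]; omega
  | loop a c hc => simp [Cmd.code, Cmd.size, hc]; omega

/-- `P` contains `cs` from address `l` on. -/
def CodeAt {s : ℕ} (P : Program s) (l : ℕ) (cs : List (Instr s)) : Prop :=
  ∀ i I, cs[i]? = some I → P[l + i]? = some I

theorem CodeAt.left {s : ℕ} {P : Program s} {l : ℕ} {as bs : List (Instr s)}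
    (h : CodeAt P l (as ++ bs)) : CodeAt P l as := by
  intro i I hi
  apply h i I
  have := (List.getElem?_eq_some_iff.1 hi).1
  rw [List.getElem?_append_left this, hi]

theorem CodeAt.right {s : ℕ} {P : Program s} {l : ℕ} {as bs : List (Instr s)}
    (h : CodeAt P l (as ++ bs)) : CodeAt P (l + as.length) bs := by
  intro i I hi
  have := h (as.length + i) I (by rw [List.getElem?_append_right (by omega)]; simpa using hi)
  rwa [← add_assoc] at this

theorem CodeAt.head {s : ℕ} {P : Program s} {l : ℕ} {I : Instr s} {bs : List (Instr s)}
    (h : CodeAt P l (I :: bs)) : P[l]? = some I := h 0 I rfl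

theorem CodeAt.tail {s : ℕ} {P : Program s} {l : ℕ} {I : Instr s} {bs : List (Instr s)}
    (h : CodeAt P l (I :: bs)) : CodeAt P (l + 1) bs := CodeAt.right (as := [I]) h

/-- `c'` is reached from `c` in `t` steps, and all registers satisfy `G` in the meantime. -/
def Reach {s : ℕ} (G : ℕ → Prop) (P : Program s) (x : Word s) (c c' : Cfg s) (t : ℕ) : Prop :=
  (step P x)^[t] c = c' ∧ ∀ u ≤ t, ∀ r, G (((step P x)^[u] c).reg r)

theorem Reach.refl {s : ℕ} {G : ℕ → Prop} {P : Program s} {x : Word s} {c : Cfg s}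
    (h : ∀ r, G (c.reg r)) : Reach G P x c c 0 := by
  refine ⟨rfl, fun u hu r => ?_⟩
  obtain rfl : u = 0 := by omega
  exact h r

theorem Reach.trans {s : ℕ} {G : ℕ → Prop} {P : Program s} {x : Word s} {c₁ c₂ c₃ : Cfg s}
    {t₁ t₂ : ℕ} (h₁ : Reach G P x c₁ c₂ t₁) (h₂ : Reach G P x c₂ c₃ t₂) :
    Reach G P x c₁ c₃ (t₁ + t₂) := by
  refine ⟨by rw [add_comm, Function.iterate_add_apply, h₁.1, h₂.1], fun u hu r => ?_⟩
  rcases le_total u t₁ with h | h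
  · exact h₁.2 u h r
  · obtain ⟨v, rfl⟩ := Nat.exists_eq_add_of_le h
    rw [add_comm, Function.iterate_add_apply, h₁.1]
    exact h₂.2 v (by omega) r

theorem Reach.last {s : ℕ} {G : ℕ → Prop} {P : Program s} {x : Word s} {c c' : Cfg s}
    {t : ℕ} (h : Reach G P x c c' t) (r : ℕ) : G (c'.reg r) := by
  rw [← h.1]; exact h.2 t le_rfl r

theorem Reach.one {s : ℕ} {G : ℕ → Prop} {P : Program s} {x : Word s} {c : Cfg s}
    {I : Instr s} (hI : P[c.pc]? = some I) (h : ∀ r, G (c.reg r))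
    (h' : ∀ r, G ((exec x c I).reg r)) : Reach G P x c (exec x c I) 1 := by
  have e : step P x c = exec x c I := by simp [step, hI]
  refine ⟨by simp [e], fun u hu r => ?_⟩
  interval_cases u
  · exact h r
  · simpa [e] using h' r

theorem exec_at {s : ℕ} {G : ℕ → Prop} (x : Word s) (σ : St s) (l : ℕ) (I : Instr s)
    (h : Safe G x σ I) : exec x (σ.at l) I = (eff x σ I).at (l + 1) := by
  cases I <;> first | rfl | exact h.elim

theorem eff_reg {s : ℕ} {G : ℕ → Prop} (x : Word s) (σ : St s) (I : Instr s)
    (h : Safe G x σ I) (hσ : ∀ r, G (σ.reg r)) (r : ℕ) : G ((eff x σ I).reg r) := by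
  cases I <;> simp only [eff, St.set_reg] <;> first | exact hσ r | (split <;> [exact h; exact hσ r])

/-- From `σ` the command `c` terminates within `T` steps in a state satisfying `Q`, and all values
that occur satisfy `G`. -/
def Tri {s : ℕ} (G : ℕ → Prop) (x : Word s) (c : Cmd s) (σ : St s) (T : ℕ) (Q : St s → Prop) :
    Prop :=
  (∀ r, G (σ.reg r)) → ∀ (P : Program s) (l : ℕ), CodeAt P l (c.code l) →
    ∃ t ≤ T, ∃ σ', Reach G P x (σ.at l) (σ'.at (l + c.size)) t ∧ Q σ'

section Rules

variable {s : ℕ} {G : ℕ → Prop} {x : Word s} {c d : Cmd s} {σ : St s} {T T₁ T₂ a : ℕ}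
  {Q R : St s → Prop}

theorem Tri.mono (h : Tri G x c σ T₁ Q) (hT : T₁ ≤ T) (hQ : ∀ σ', Q σ' → R σ') :
    Tri G x c σ T R := by
  intro hσ P l hP
  obtain ⟨t, ht, σ', h1, h2⟩ := h hσ P l hP
  exact ⟨t, ht.trans hT, σ', h1, hQ _ h2⟩

/-- A triple already presupposes that the initial registers satisfy the guard, so bounds on initial
values can be drawn from it instead of being assumed. -/
theorem Tri.of_guard (h : (∀ r, G (σ.reg r)) → Tri G x c σ T Q) : Tri G x c σ T Q :=
  fun hσ => h hσ hσ

theorem Tri.blk {is : List (Instr s)} (h : BlkOk G x is σ Q) (hT : is.length ≤ T) :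
    Tri G x (.blk is) σ T Q := by
  intro hσ P l hP
  refine ⟨is.length, hT, ?_⟩
  clear hT
  change CodeAt P l is at hP
  change ∃ σ', Reach G P x (σ.at l) (σ'.at (l + is.length)) is.length ∧ Q σ'
  induction is generalizing σ l with
  | nil => exact ⟨σ, Reach.refl hσ, h⟩
  | cons I is ih =>
    obtain ⟨h1, h2⟩ := h
    have hσ' := eff_reg x σ I h1 hσ
    obtain ⟨σ', h3, h4⟩ := ih h2 hσ' (l + 1) hP.tail
    refine ⟨σ', ?_, h4⟩
    have e := Reach.one (G := G) (x := x) (c := σ.at l) hP.head hσ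
      (by rw [exec_at x σ l I h1]; exact hσ')
    rw [exec_at x σ l I h1] at e
    have := e.trans h3
    simpa [add_comm, add_left_comm] using this

theorem Tri.seq (h₁ : Tri G x c σ T₁ Q) (h₂ : ∀ σ', Q σ' → Tri G x d σ' T₂ R)
    (hT : T₁ + T₂ ≤ T) : Tri G x (.seq c d) σ T R := by
  intro hσ P l hP
  obtain ⟨t, ht, σ', h3, h4⟩ := h₁ hσ P l hP.left
  have hd := hP.right
  rw [c.code_length] at hd
  obtain ⟨u, hu, σ'', h5, h6⟩ := h₂ σ' h4 h3.last P _ hd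
  exact ⟨t + u, by omega, σ'', by simpa [Cmd.size, add_assoc] using h3.trans h5, h6⟩

theorem reach_jz {P : Program s} {l m : ℕ} (hI : P[l]? = some (.jz a m))
    (hσ : ∀ r, G (σ.reg r)) :
    Reach G P x (σ.at l) (σ.at (if σ.reg a = 0 then m else l + 1)) 1 :=
  Reach.one (c := σ.at l) hI hσ hσ

theorem reach_goto {P : Program s} {l m : ℕ} (hG : G 0) (hI : CodeAt P l [.const 0 0, .jz 0 m])
    (hσ : ∀ r, G (σ.reg r)) : Reach G P x (σ.at l) ((σ.set 0 0).at m) 2 := by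
  have hσ' : ∀ r, G ((σ.set 0 0).reg r) := by
    intro r; rw [St.set_reg]; split <;> [exact hG; exact hσ r]
  have h1 : Reach G P x (σ.at l) ((σ.set 0 0).at (l + 1)) 1 :=
    Reach.one (c := σ.at l) hI.head hσ hσ'
  have h2 := reach_jz (x := x) hI.tail.head hσ'
  rw [if_pos (by simp [St.set_reg])] at h2
  exact h1.trans h2

theorem Tri.ite_zero (ha : σ.reg a = 0) (h : Tri G x c σ T₁ Q) (hT : T₁ + 1 ≤ T) :
    Tri G x (.ite a c d) σ T Q := by
  intro hσ P l hP
  have h1 := reach_jz (x := x) hP.head hσ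
  rw [if_pos ha] at h1
  have h2 := hP.tail.right.tail.tail
  rw [d.code_length] at h2
  obtain ⟨t, ht, σ', h3, h4⟩ := h hσ P (l + 3 + d.size) (by convert h2 using 1; omega)
  exact ⟨1 + t, by omega, σ', by convert h1.trans h3 using 2; simp only [Cmd.size]; omega, h4⟩

/-- The nonzero branch is placed first in the code and must jump over the other one. An
unconditional jump clears register `0` and tests it, whence `σ'.set 0 0` and three extra steps. -/
theorem Tri.ite_pos (hG : G 0) (ha : σ.reg a ≠ 0)
    (h : Tri G x d σ T₁ (fun σ' => Q (σ'.set 0 0))) (hT : T₁ + 3 ≤ T) :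
    Tri G x (.ite a c d) σ T Q := by
  intro hσ P l hP
  have h1 := reach_jz (x := x) hP.head hσ
  rw [if_neg ha] at h1
  obtain ⟨t, ht, σ', h3, h4⟩ := h hσ P (l + 1) hP.tail.left
  have h5 := hP.tail.right
  rw [d.code_length] at h5
  have h6 := reach_goto (x := x) (σ := σ') hG (CodeAt.left (as := [_, _]) h5) h3.last
  exact ⟨1 + t + 2, by omega, _, by convert (h1.trans h3).trans h6 using 2; simp only [Cmd.size]; omega, h4⟩

theorem Tri.loop_zero (ha : σ.reg a = 0) (h : Q σ) (hT : 1 ≤ T) :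
    Tri G x (.loop a c) σ T Q := by
  intro hσ P l hP
  have h1 := reach_jz (x := x) hP.head hσ
  rw [if_pos ha] at h1
  exact ⟨1, hT, σ, by convert h1 using 2; simp only [Cmd.size]; omega, h⟩

/-- One round of a loop. -/
theorem reach_round (hG : G 0) (ha : σ.reg a ≠ 0) (h : Tri G x c σ T Q)
    (hσ : ∀ r, G (σ.reg r)) {P : Program s} {l : ℕ} (hP : CodeAt P l (Cmd.code (.loop a c) l)) :
    ∃ t ≤ T + 3, ∃ σ', Reach G P x (σ.at l) ((σ'.set 0 0).at l) t ∧ Q σ' := by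
  have h1 := reach_jz (x := x) hP.head hσ
  rw [if_neg ha] at h1
  obtain ⟨t, ht, σ', h3, h4⟩ := h hσ P (l + 1) hP.tail.left
  have h5 := hP.tail.right
  rw [c.code_length] at h5
  exact ⟨1 + t + 2, by omega, σ', (h1.trans h3).trans (reach_goto hG h5 h3.last), h4⟩

theorem Tri.loop_pos (hG : G 0) (ha : σ.reg a ≠ 0)
    (h : Tri G x c σ T₁ (fun σ' => Tri G x (.loop a c) (σ'.set 0 0) T₂ Q)) (hT : T₁ + 3 + T₂ ≤ T) :
    Tri G x (.loop a c) σ T Q := by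
  intro hσ P l hP
  obtain ⟨t, ht, σ', h1, h2⟩ := reach_round hG ha h hσ hP
  obtain ⟨u, hu, σ'', h3, h4⟩ := h2 h1.last P l hP
  exact ⟨t + u, by omega, σ'', h1.trans h3, h4⟩

/-- A loop with an invariant indexed by the number of remaining rounds. -/
theorem Tri.loop_count (hG : G 0) (Inv : ℕ → St s → Prop)
    (h0 : ∀ σ, Inv 0 σ → σ.reg a = 0) (h1 : ∀ j σ, Inv (j + 1) σ → σ.reg a ≠ 0)
    {m : ℕ} (h2 : ∀ j < m, ∀ σ, Inv (j + 1) σ → Tri G x c σ T₁ (fun σ' => Inv j (σ'.set 0 0)))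
    (hσ : Inv m σ) (hT : m * (T₁ + 3) + 1 ≤ T) (hQ : ∀ σ, Inv 0 σ → Q σ) :
    Tri G x (.loop a c) σ T Q := by
  induction m generalizing σ T with
  | zero => exact Tri.loop_zero (h0 σ hσ) (hQ _ hσ) (by omega)
  | succ m ih =>
    refine Tri.loop_pos hG (h1 m σ hσ) (T₂ := m * (T₁ + 3) + 1)
      ((h2 m (by omega) σ hσ).mono le_rfl fun σ' h => ih (fun j hj => h2 j (by omega)) h le_rfl) ?_
    rw [Nat.succ_mul] at hT
    omega

end Rules

end EnumFPT

/-! ### Step-by-step simulation of virtual machines -/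

namespace EnumFPT

/-- The address of register `r` of the virtual machine `v`. -/
def vaddr (v r : ℕ) : ℕ := 4 * r + v + 64

/-- Increment the program counter of the virtual machine `v`. -/
def incPc {s : ℕ} (v : ℕ) : List (Instr s) := [.const 1 1, .add (8 + v) (8 + v) 1]

/-- Simulation of an instruction on the virtual machine `v`, with `wr` and `em` for the output
instructions. -/
def simInstr {s : ℕ} (v : ℕ) (wr : Fin s → Cmd s) (em : Cmd s) : Instr s → Cmd s
  | .const d k => .blk (.const (vaddr v d) k :: incPc v)
  | .add d a b => .blk (.add (vaddr v d) (vaddr v a) (vaddr v b) :: incPc v)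
  | .sub d a b => .blk (.sub (vaddr v d) (vaddr v a) (vaddr v b) :: incPc v)
  | .half d a => .blk (.half (vaddr v d) (vaddr v a) :: incPc v)
  | .load d a => .blk ([.const 2 (v + 64), .add 3 (vaddr v a) (vaddr v a), .add 3 3 3, .add 3 3 2,
      .load (vaddr v d) 3] ++ incPc v)
  | .store a b => .blk ([.const 2 (v + 64), .add 3 (vaddr v a) (vaddr v a), .add 3 3 3, .add 3 3 2,
      .store 3 (vaddr v b)] ++ incPc v)
  | .read d a => .blk (.read (vaddr v d) (vaddr v a) :: incPc v)
  | .jz a l => .ite (vaddr v a) (.blk [.const (8 + v) l]) (.blk (incPc v))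
  | .write a => .seq (wr a) (.blk (incPc v))
  | .emit => .seq em (.blk (incPc v))

/-- The virtual machine `v` in the state `σ` is in the configuration `c`, up to the output. -/
def SimRel {s : ℕ} (v : ℕ) (c : Cfg s) (σ : St s) : Prop :=
  σ.reg (8 + v) = c.pc ∧ ∀ r, σ.reg (vaddr v r) = c.reg r

/-- `σ` and `σ'` differ at most in scratch registers and on the virtual machine `v`. -/
def Keeps {s : ℕ} (v : ℕ) (σ σ' : St s) : Prop :=
  σ'.buf = σ.buf ∧ σ'.out = σ.out ∧
    ∀ a, 8 ≤ a → a ≠ 8 + v → (∀ r, a ≠ vaddr v r) → σ'.reg a = σ.reg a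

theorem vaddr_inj {v r r' : ℕ} : vaddr v r = vaddr v r' ↔ r = r' := by
  simp only [vaddr]; omega

theorem Keeps.refl {s : ℕ} {v : ℕ} (σ : St s) : Keeps v σ σ := ⟨rfl, rfl, fun _ _ _ _ => rfl⟩

theorem Keeps.trans {s : ℕ} {v : ℕ} {σ₁ σ₂ σ₃ : St s} (h : Keeps v σ₁ σ₂) (h' : Keeps v σ₂ σ₃) :
    Keeps v σ₁ σ₃ :=
  ⟨h'.1.trans h.1, h'.2.1.trans h.2.1, fun a h1 h2 h3 =>
    (h'.2.2 a h1 h2 h3).trans (h.2.2 a h1 h2 h3)⟩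

theorem Keeps.set {s : ℕ} {v : ℕ} {σ σ' : St s} (h : Keeps v σ σ') {d k : ℕ}
    (hd : d < 8 ∨ d = 8 + v ∨ ∃ r, d = vaddr v r) : Keeps v σ (σ'.set d k) := by
  refine h.trans ⟨rfl, rfl, fun a h1 h2 h3 => ?_⟩
  rw [St.set_reg, if_neg]
  rintro rfl
  rcases hd with h | h | ⟨r, h⟩
  · omega
  · exact h2 h
  · exact h3 r h

theorem SimRel.set {s : ℕ} {v : ℕ} {c : Cfg s} {σ : St s} (h : SimRel v c σ) {d k : ℕ}
    (hd : d < 64) (hd' : d ≠ 8 + v) : SimRel v c (σ.set d k) := by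
  refine ⟨?_, fun r => ?_⟩
  · rw [St.set_reg, if_neg (by omega), h.1]
  · rw [St.set_reg, if_neg (by simp only [vaddr]; omega), h.2]

theorem SimRel.set_vaddr {s : ℕ} {v : ℕ} {c : Cfg s} {σ : St s} (h : SimRel v c σ)
    {d k : ℕ} : SimRel v ⟨c.pc, Function.update c.reg d k, c.buf, c.out⟩ (σ.set (vaddr v d) k) := by
  refine ⟨?_, fun r => ?_⟩
  · rw [St.set_reg, if_neg (by simp only [vaddr]; omega), h.1]
  · simp [St.set_reg, vaddr_inj, Function.update_apply, h.2]

theorem SimRel.set_pc {s : ℕ} {v : ℕ} {c : Cfg s} {σ : St s} (h : SimRel v c σ)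
    {k : ℕ} : SimRel v ⟨k, c.reg, c.buf, c.out⟩ (σ.set (8 + v) k) := by
  refine ⟨by simp [St.set_reg], fun r => ?_⟩
  rw [St.set_reg, if_neg (by simp only [vaddr]; omega), h.2]

section Sim

variable {s : ℕ} {x : Word s} {v W B : ℕ} {wr : Fin s → Cmd s} {em : Cmd s}
  {R : Word s → List (Word s) → St s → Prop} {c : Cfg s} {σ : St s}

theorem BlkOk.incPc {Q : St s → Prop} (hv : v < 4) (hB : σ.reg (8 + v) + 1 ≤ B)
    (h : Q ((σ.set 1 1).set (8 + v) (σ.reg (8 + v) + 1))) :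
    BlkOk (· ≤ B) x (incPc v) σ Q := by
  have h8 : 8 + v ≠ 1 := by omega
  simp only [EnumFPT.incPc, BlkOk, Safe, eff, St.set_reg, h8, if_false, if_true]
  exact ⟨by omega, hB, h⟩

/-- The relation `R` leaves open what becomes of the simulated output: it may be dropped, queued or
passed on. It only has to survive changes to the scratch registers and to the virtual machine
itself. -/
theorem simInstr_spec (hv : v < 4) (I : Instr s)
    (hR : ∀ b o σ σ', Keeps v σ σ' → R b o σ → R b o σ')
    (hwr : ∀ a, I = .write a → ∀ σ, SimRel v c σ → R c.buf c.out σ →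
      Tri (· ≤ B) x (wr a) σ W (fun σ' => SimRel v c σ' ∧ R (c.buf ++ [a]) c.out σ'))
    (hem : I = .emit → ∀ σ, SimRel v c σ → R c.buf c.out σ →
      Tri (· ≤ B) x em σ W (fun σ' => SimRel v c σ' ∧ R [] (c.out ++ [c.buf]) σ'))
    (hpc : c.pc + 1 ≤ B) (hreg : ∀ r, vaddr v (c.reg r) ≤ B)
    (hpc' : (exec x c I).pc ≤ B) (hreg' : ∀ r, (exec x c I).reg r ≤ B)
    (hσ : SimRel v c σ) (hRσ : R c.buf c.out σ) :
    Tri (· ≤ B) x (simInstr v wr em I) σ (W + 7)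
      (fun σ' => SimRel v (exec x c I) σ' ∧ R (exec x c I).buf (exec x c I).out σ') := by
  have key : ∀ (c' : Cfg s) (σ' : St s), c'.pc = c.pc → SimRel v c' σ' →
      R c'.buf c'.out σ' →
      BlkOk (· ≤ B) x (incPc v) σ' (fun σ'' => SimRel v ⟨c.pc + 1, c'.reg, c'.buf, c'.out⟩ σ'' ∧
        R c'.buf c'.out σ'') := by
    intro c' σ' h1 h2 h3
    apply BlkOk.incPc hv
    · rw [h2.1, h1]; exact hpc
    · rw [h2.1, h1]
      exact ⟨(h2.set (by omega) (by omega)).set_pc,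
        hR _ _ _ _ (((Keeps.refl σ').set (by omega)).set (by omega)) h3⟩
  have hset : ∀ d k, k ≤ B →
      BlkOk (· ≤ B) x (incPc v) (σ.set (vaddr v d) k) (fun σ'' =>
        SimRel v ⟨c.pc + 1, Function.update c.reg d k, c.buf, c.out⟩ σ'' ∧ R c.buf c.out σ'') := by
    intro d k _
    exact key ⟨c.pc, Function.update c.reg d k, c.buf, c.out⟩ _ rfl (hσ.set_vaddr)
      (hR _ _ _ _ ((Keeps.refl σ).set (Or.inr (Or.inr ⟨d, rfl⟩))) hRσ)
  have hB0 : 0 ≤ B := Nat.zero_le _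
  cases I with
  | const d k =>
    have h : k ≤ B := by simpa [exec] using hreg' d
    exact Tri.blk ⟨h, hset d k h⟩ (by simp [incPc])
  | add d a b =>
    have h : c.reg a + c.reg b ≤ B := by simpa [exec] using hreg' d
    rw [← hσ.2, ← hσ.2] at h
    refine Tri.blk ⟨h, ?_⟩ (by simp [incPc])
    have := hset d _ h
    simpa only [eff, exec, hσ.2] using this
  | sub d a b =>
    have h : c.reg a - c.reg b ≤ B := by simpa [exec] using hreg' d
    rw [← hσ.2, ← hσ.2] at h
    refine Tri.blk ⟨h, ?_⟩ (by simp [incPc])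
    have := hset d _ h
    simpa only [eff, exec, hσ.2] using this
  | half d a =>
    have h : c.reg a / 2 ≤ B := by simpa [exec] using hreg' d
    rw [← hσ.2] at h
    refine Tri.blk ⟨h, ?_⟩ (by simp [incPc])
    have := hset d _ h
    simpa only [eff, exec, hσ.2] using this
  | read d a =>
    have h : inputAt x (c.reg a) ≤ B := by simpa [exec] using hreg' d
    rw [← hσ.2] at h
    refine Tri.blk ⟨h, ?_⟩ (by simp [incPc])
    have := hset d _ h
    simpa only [eff, exec, hσ.2] using this
  | load d a =>
    have h : c.reg (c.reg a) ≤ B := by simpa [exec] using hreg' d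
    have ha := hreg a
    have e2 : ∀ r, vaddr v r ≠ 2 := fun r => by simp only [vaddr]; omega
    have e3 : ∀ r, vaddr v r ≠ 3 := fun r => by simp only [vaddr]; omega
    -- Indirect addresses are known only at run time; two doublings and one addition translate them
    -- into the interleaved memory.
    have ea : c.reg a + c.reg a + (c.reg a + c.reg a) + (v + 64) = vaddr v (c.reg a) := by
      simp only [vaddr]; omega
    refine Tri.blk ?_ (by simp [incPc])
    simp only [List.cons_append, List.nil_append, BlkOk, Safe, eff, St.set_reg, hσ.2, if_true, e2, e3, if_false,
      ea, Nat.reduceEqDiff]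
    refine ⟨by simp only [vaddr] at ha; omega, by simp only [vaddr] at ha; omega,
      by simp only [vaddr] at ha; omega, ha, h, ?_⟩
    exact key ⟨c.pc, Function.update c.reg d _, c.buf, c.out⟩ _ rfl
      (((((hσ.set (by omega) (by omega)).set (by omega) (by omega)).set (by omega) (by omega)).set
        (by omega) (by omega)).set_vaddr)
      (hR _ _ _ _ ((((((Keeps.refl σ).set (by omega)).set (by omega)).set (by omega)).set
        (by omega)).set (Or.inr (Or.inr ⟨d, rfl⟩))) hRσ)
  | store a b =>
    have h : c.reg b ≤ B := by simpa [exec] using hreg' (c.reg a)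
    have ha := hreg a
    have e2 : ∀ r, vaddr v r ≠ 2 := fun r => by simp only [vaddr]; omega
    have e3 : ∀ r, vaddr v r ≠ 3 := fun r => by simp only [vaddr]; omega
    have ea : c.reg a + c.reg a + (c.reg a + c.reg a) + (v + 64) = vaddr v (c.reg a) := by
      simp only [vaddr]; omega
    refine Tri.blk ?_ (by simp [incPc])
    simp only [List.cons_append, List.nil_append, BlkOk, Safe, eff, St.set_reg, hσ.2, if_true, e2, e3, if_false,
      ea, Nat.reduceEqDiff]
    refine ⟨by simp only [vaddr] at ha; omega, by simp only [vaddr] at ha; omega,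
      by simp only [vaddr] at ha; omega, ha, h, ?_⟩
    exact key ⟨c.pc, Function.update c.reg (c.reg a) _, c.buf, c.out⟩ _ rfl
      (((((hσ.set (by omega) (by omega)).set (by omega) (by omega)).set (by omega) (by omega)).set
        (by omega) (by omega)).set_vaddr)
      (hR _ _ _ _ ((((((Keeps.refl σ).set (by omega)).set (by omega)).set (by omega)).set
        (by omega)).set (Or.inr (Or.inr ⟨_, rfl⟩))) hRσ)
  | jz a l =>
    by_cases h : c.reg a = 0
    · refine Tri.ite_zero (by rw [hσ.2, h]) (Tri.blk ⟨?_, ?_⟩ le_rfl) (by simp)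
      · simpa [exec, h, Safe] using hpc'
      · simp only [exec, h, if_true]
        exact ⟨hσ.set_pc, hR _ _ _ _ ((Keeps.refl σ).set (by omega)) hRσ⟩
    · refine Tri.ite_pos hB0 (by rwa [hσ.2]) (T₁ := 2) ((Tri.blk (key c σ rfl hσ hRσ) le_rfl).mono
        le_rfl fun σ' h' => ?_) (by omega)
      simp only [exec, h, if_false]
      exact ⟨h'.1.set (by omega) (by omega), hR _ _ _ _ ((Keeps.refl σ').set (by omega)) h'.2⟩
  | write a =>
    exact Tri.seq (hwr a rfl σ hσ hRσ) (fun σ' h' => Tri.blk (T := 2)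
      (key ⟨c.pc, c.reg, c.buf ++ [a], c.out⟩ σ' rfl h'.1 h'.2) le_rfl) (by omega)
  | emit =>
    exact Tri.seq (hem rfl σ hσ hRσ) (fun σ' h' => Tri.blk (T := 2)
      (key ⟨c.pc, c.reg, [], c.out ++ [c.buf]⟩ σ' rfl h'.1 h'.2) le_rfl) (by omega)

/-- Simulate the instruction with the index in register `4`. -/
def dispatch {s : ℕ} (v : ℕ) (wr : Fin s → Cmd s) (em : Cmd s) : List (Instr s) → Cmd s
  | [] => .blk []
  | I :: is => .ite 4 (simInstr v wr em I)
      (.seq (.blk [.const 5 1, .sub 4 4 5]) (dispatch v wr em is))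

/-- Simulate a step of `P` on the virtual machine `v`. -/
def simStep {s : ℕ} (v : ℕ) (wr : Fin s → Cmd s) (em : Cmd s) (P : Program s) : Cmd s :=
  .seq (.blk [.const 5 0, .add 4 (8 + v) 5]) (dispatch v wr em P)

/-- Register `4` holds a copy of the simulated program counter and is counted down along the
program, at five steps per instruction passed. Running off the end means that the simulated machine
has halted, and nothing is changed. -/
theorem dispatch_spec {Q : St s → Prop} {T : ℕ} (hQ : ∀ σ, Q σ → Q (σ.set 0 0))
    (hR : ∀ σ d k, d < 8 → R c.buf c.out σ → R c.buf c.out (σ.set d k))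
    (hv : v < 4) (hB : 1 ≤ B) {is : List (Instr s)} {j : ℕ} (hj : j ≤ B)
    (hI : ∀ I, is[j]? = some I → ∀ σ, SimRel v c σ → R c.buf c.out σ →
      Tri (· ≤ B) x (simInstr v wr em I) σ T Q)
    (hn : is[j]? = none → ∀ σ, SimRel v c σ → R c.buf c.out σ → Q σ)
    (h4 : σ.reg 4 = j) (hσ : SimRel v c σ) (hRσ : R c.buf c.out σ) :
    Tri (· ≤ B) x (dispatch v wr em is) σ (5 * is.length + T + 1) Q := by
  induction is generalizing σ j with
  | nil => exact Tri.blk (hn rfl σ hσ hRσ) (by simp)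
  | cons I is ih =>
    rw [List.length_cons]
    cases j with
    | zero => exact Tri.ite_zero h4 (hI I rfl σ hσ hRσ) (by omega)
    | succ j =>
      refine Tri.ite_pos (by omega) (by omega) (T₁ := 2 + (5 * is.length + T + 1)) (Tri.seq
        (Q := fun σ' => σ'.reg 4 = j ∧ SimRel v c σ' ∧ R c.buf c.out σ') (T₁ := 2)
        (Tri.blk ?_ le_rfl) (fun σ' h' => ?_) le_rfl) (by omega)
      · simp only [BlkOk, Safe, eff, St.set_reg, h4]
        refine ⟨hB, by simp; omega, by simp, ?_, ?_⟩
        · exact (hσ.set (by omega) (by omega)).set (by omega) (by omega)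
        · exact hR _ _ _ (by omega) (hR _ _ _ (by omega) hRσ)
      · exact (ih (by omega) (by simpa using hI) (by simpa using hn) h'.1 h'.2.1 h'.2.2).mono le_rfl hQ

theorem simStep_spec (hv : v < 4) (P : Program s)
    (hR : ∀ b o σ σ', Keeps v σ σ' → R b o σ → R b o σ')
    (hwr : ∀ a, P[c.pc]? = some (.write a) → ∀ σ, SimRel v c σ → R c.buf c.out σ →
      Tri (· ≤ B) x (wr a) σ W (fun σ' => SimRel v c σ' ∧ R (c.buf ++ [a]) c.out σ'))
    (hem : P[c.pc]? = some .emit → ∀ σ, SimRel v c σ → R c.buf c.out σ →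
      Tri (· ≤ B) x em σ W (fun σ' => SimRel v c σ' ∧ R [] (c.out ++ [c.buf]) σ'))
    (hpc : c.pc + 1 ≤ B) (hreg : ∀ r, vaddr v (c.reg r) ≤ B)
    (hpc' : (step P x c).pc ≤ B) (hreg' : ∀ r, (step P x c).reg r ≤ B)
    (hσ : SimRel v c σ) (hRσ : R c.buf c.out σ) :
    Tri (· ≤ B) x (simStep v wr em P) σ (5 * P.length + W + 10)
      (fun σ' => SimRel v (step P x c) σ' ∧ R (step P x c).buf (step P x c).out σ') := by
  refine Tri.seq (Q := fun σ' => σ'.reg 4 = c.pc ∧ SimRel v c σ' ∧ R c.buf c.out σ') (T₁ := 2)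
    (T₂ := 5 * P.length + (W + 7) + 1) (Tri.blk ?_ le_rfl) (fun σ' h' => ?_) (by omega)
  · have h8 : 8 + v ≠ 5 := by omega
    simp only [BlkOk, Safe, eff, St.set_reg, h8, if_false, if_true, hσ.1]
    refine ⟨by omega, by omega, by simp, ?_, ?_⟩
    · exact (hσ.set (by omega) (by omega)).set (by omega) (by omega)
    · exact hR _ _ _ _ (((Keeps.refl σ).set (by omega)).set (by omega)) hRσ
  · refine dispatch_spec (c := c) (R := R) ?_ (fun σ d k hd h => hR _ _ _ _ ((Keeps.refl σ).set (by omega)) h)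
      hv (by omega) (j := c.pc) (by omega) ?_ ?_ h'.1 h'.2.1 h'.2.2
    · exact fun σ h => ⟨h.1.set (by omega) (by omega),
        hR _ _ _ _ ((Keeps.refl σ).set (by omega)) h.2⟩
    · intro I hI σ h1 h2
      have e : step P x c = exec x c I := by simp [step, hI]
      rw [e] at hpc' hreg' ⊢
      exact simInstr_spec hv I hR (fun a ha => hwr a (ha ▸ hI)) (fun ha => hem (ha ▸ hI)) hpc hreg
        hpc' hreg' h1 h2
    · intro hn σ h1 h2
      have e : step P x c = c := by simp [step, hn]
      rw [e]
      exact ⟨h1, h2⟩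

/-- Simulate as many steps as register `16` says. -/
def simLoop {s : ℕ} (v : ℕ) (wr : Fin s → Cmd s) (em : Cmd s) (P : Program s) : Cmd s :=
  .loop 16 (.seq (.blk [.const 5 1, .sub 16 16 5]) (simStep v wr em P))

theorem Keeps.reg16 {v : ℕ} (hv : v < 4) {σ σ' : St s} (h : Keeps v σ σ') :
    σ'.reg 16 = σ.reg 16 :=
  h.2.2 16 (by omega) (by omega) (fun r => by simp only [vaddr]; omega)

/-- The output commands need to be correct only at the configurations met in the first `m` steps:
the queue fits below `B` only because its length is bounded by the number of simulated steps. They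
must also preserve the step counter in register `16`. -/
theorem simLoop_spec (hv : v < 4) (P : Program s) {m : ℕ}
    (hR : ∀ b o σ σ', Keeps v σ σ' → R b o σ → R b o σ')
    (hR16 : ∀ b o σ k, R b o σ → R b o (σ.set 16 k))
    (hwr : ∀ u < m, ∀ c', c' = (step P x)^[u] c → ∀ a, P[c'.pc]? = some (.write a) → ∀ σ,
      SimRel v c' σ → R c'.buf c'.out σ → Tri (· ≤ B) x (wr a) σ W
        (fun σ' => SimRel v c' σ' ∧ R (c'.buf ++ [a]) c'.out σ' ∧ σ'.reg 16 = σ.reg 16))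
    (hem : ∀ u < m, ∀ c', c' = (step P x)^[u] c → P[c'.pc]? = some .emit → ∀ σ,
      SimRel v c' σ → R c'.buf c'.out σ → Tri (· ≤ B) x em σ W
        (fun σ' => SimRel v c' σ' ∧ R [] (c'.out ++ [c'.buf]) σ' ∧ σ'.reg 16 = σ.reg 16))
    (hpc : ∀ u ≤ m, ((step P x)^[u] c).pc + 1 ≤ B)
    (hreg : ∀ u ≤ m, ∀ r, vaddr v (((step P x)^[u] c).reg r) ≤ B)
    (hσ : SimRel v c σ) (hRσ : R c.buf c.out σ) (h16 : σ.reg 16 = m) :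
    Tri (· ≤ B) x (simLoop v wr em P) σ (m * (5 * P.length + W + 15) + 1)
      (fun σ' => SimRel v ((step P x)^[m] c) σ' ∧
        R ((step P x)^[m] c).buf ((step P x)^[m] c).out σ') := by
  let C : ℕ → Cfg s := fun u => (step P x)^[u] c
  have hC : ∀ u, C (u + 1) = step P x (C u) := fun u => Function.iterate_succ_apply' _ _ _
  have h1B : 1 ≤ B := le_trans (by omega) (hpc 0 (Nat.zero_le _))
  refine (Tri.loop_count (Nat.zero_le _) (T₁ := 5 * P.length + W + 12) (m := m)
    (fun j σ' => SimRel v (C (m - j)) σ' ∧ R (C (m - j)).buf (C (m - j)).out σ' ∧ σ'.reg 16 = j)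
    (fun σ' h => h.2.2) (fun j σ' h => by rw [h.2.2]; omega) ?_ ?_ le_rfl (fun σ' h => ?_))
  · intro j hj σ' ⟨h1, h2, h3⟩
    obtain ⟨u, hu⟩ : ∃ u, u = m - (j + 1) := ⟨_, rfl⟩
    rw [← hu] at h1 h2
    have hu' : m - j = u + 1 := by omega
    rw [hu', hC]
    refine Tri.of_guard fun hg => ?_
    refine Tri.seq (Q := fun σ'' => SimRel v (C u) σ'' ∧ R (C u).buf (C u).out σ'' ∧
      σ''.reg 16 = j) (T₁ := 2) (T₂ := 5 * P.length + W + 10) (Tri.blk ?_ le_rfl)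
      (fun σ'' h'' => ?_) (by omega)
    · simp only [BlkOk, Safe, eff, St.set_reg, if_true, h3]
      have := hg 16
      refine ⟨h1B, ?_, ?_, ?_, by simp⟩
      · simp; omega
      · exact (h1.set (by omega) (by omega)).set (by omega) (by omega)
      · exact hR16 _ _ _ _ (hR _ _ _ _ ((Keeps.refl σ').set (by omega)) h2)
    -- The value of the step counter is made part of the relation, so that the simulation of one
    -- step carries it along.
    · have key := simStep_spec (x := x) (B := B) (W := W) (wr := wr) (em := em) (c := C u) (σ := σ'')
        (R := fun b o τ => R b o τ ∧ τ.reg 16 = j) hv P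
        (fun b o τ τ' hk hτ => ⟨hR _ _ _ _ hk hτ.1, by rw [hk.reg16 hv, hτ.2]⟩)
        (fun a ha τ k1 k2 => (hwr u (by omega) _ rfl a ha τ k1 k2.1).mono le_rfl
          fun τ' k => ⟨k.1, k.2.1, by rw [k.2.2, k2.2]⟩)
        (fun ha τ k1 k2 => (hem u (by omega) _ rfl ha τ k1 k2.1).mono le_rfl
          fun τ' k => ⟨k.1, k.2.1, by rw [k.2.2, k2.2]⟩)
        (hpc u (by omega)) (hreg u (by omega))
        (by rw [← hC]; exact le_trans (Nat.le_succ _) (hpc (u + 1) (by omega)))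
        (fun r => by
          rw [← hC]
          have := hreg (u + 1) (by omega) r
          simp only [vaddr] at this
          change ((step P x)^[u + 1] c).reg r ≤ B
          omega)
        h''.1 h''.2
      exact key.mono le_rfl fun τ k => ⟨k.1.set (by omega) (by omega),
        hR _ _ _ _ ((Keeps.refl τ).set (by omega)) k.2.1, by simp [St.set_reg, k.2.2]⟩
  · simpa [C] using ⟨hσ, hRσ, h16⟩
  · simpa [C] using ⟨h.1, h.2.1⟩

end Sim

end EnumFPT

/-! ### Partial recursive functions on the random access machine -/

namespace EnumFPT

/-- From `σ` the command `c` terminates in a state satisfying `Q`, on the empty input. -/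
def Ter {s : ℕ} (c : Cmd s) (σ : St s) (Q : St s → Prop) : Prop :=
  ∃ σ', Q σ' ∧ ∃ T, Tri (fun _ => True) [] c σ T (· = σ')

/-- `σ` and `σ'` agree on the positive registers below `r`. -/
def Low {s : ℕ} (r : ℕ) (σ σ' : St s) : Prop := ∀ a, 0 < a → a < r → σ'.reg a = σ.reg a

theorem Low.refl {s : ℕ} (r : ℕ) (σ : St s) : Low r σ σ := fun _ _ _ => rfl

theorem Low.trans {s : ℕ} {r r' : ℕ} {σ₁ σ₂ σ₃ : St s} (h : Low r σ₁ σ₂) (h' : Low r' σ₂ σ₃)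
    (hr : r ≤ r') : Low r σ₁ σ₃ :=
  fun a h1 h2 => (h' a h1 (h2.trans_le hr)).trans (h a h1 h2)

theorem Low.set {s : ℕ} {r : ℕ} {σ σ' : St s} (h : Low r σ σ') {d k : ℕ} (hd : d = 0 ∨ r ≤ d) :
    Low r σ (σ'.set d k) := by
  intro a h1 h2
  rw [St.set_reg, if_neg (by omega), h a h1 h2]

section

variable {s : ℕ} {c d : Cmd s} {σ : St s} {a r : ℕ} {Q R : St s → Prop}

theorem Ter.mono (h : Ter c σ Q) (hQ : ∀ σ', Q σ' → R σ') : Ter c σ R :=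
  h.imp fun _ h => ⟨hQ _ h.1, h.2⟩

theorem Ter.blk {is : List (Instr s)} (h : BlkOk (fun _ => True) [] is σ Q) :
    Ter (.blk is) σ Q := by
  suffices ∃ σ', Q σ' ∧ BlkOk (fun _ => True) [] is σ (· = σ') by
    obtain ⟨σ', h1, h2⟩ := this
    exact ⟨σ', h1, _, Tri.blk h2 le_rfl⟩
  induction is generalizing σ with
  | nil => exact ⟨σ, h, rfl⟩
  | cons I is ih =>
    obtain ⟨σ', h1, h2⟩ := ih h.2
    exact ⟨σ', h1, h.1, h2⟩

/-- `Ter` fixes the final state before any time bound is chosen. Hence the bound for the second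
command may depend on the intermediate state, and no uniform bound is needed. -/
theorem Ter.seq (h₁ : Ter c σ Q) (h₂ : ∀ σ', Q σ' → Ter d σ' R) : Ter (.seq c d) σ R := by
  obtain ⟨σ₁, hQ, T₁, h₁⟩ := h₁
  obtain ⟨σ₂, hR, T₂, h₂⟩ := h₂ σ₁ hQ
  exact ⟨σ₂, hR, _, h₁.seq (fun σ' h => h ▸ h₂) le_rfl⟩

theorem Ter.ite_zero (ha : σ.reg a = 0) (h : Ter c σ Q) : Ter (.ite a c d) σ Q := by
  obtain ⟨σ₁, hQ, T₁, h₁⟩ := h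
  exact ⟨σ₁, hQ, _, Tri.ite_zero ha h₁ le_rfl⟩

theorem Ter.ite_pos (ha : σ.reg a ≠ 0) (h : Ter d σ (fun σ' => Q (σ'.set 0 0))) :
    Ter (.ite a c d) σ Q := by
  obtain ⟨σ₁, hQ, T₁, h₁⟩ := h
  exact ⟨σ₁.set 0 0, hQ, _, Tri.ite_pos trivial ha (h₁.mono le_rfl fun _ h => by rw [h]) le_rfl⟩

theorem Ter.loop_zero (ha : σ.reg a = 0) (h : Q σ) : Ter (.loop a c) σ Q :=
  ⟨σ, h, _, Tri.loop_zero ha rfl le_rfl⟩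

theorem Ter.loop_pos (ha : σ.reg a ≠ 0)
    (h : Ter c σ (fun σ' => Ter (.loop a c) (σ'.set 0 0) Q)) : Ter (.loop a c) σ Q := by
  obtain ⟨σ₁, ⟨σ₂, hQ, T₂, h₂⟩, T₁, h₁⟩ := h
  exact ⟨σ₂, hQ, _, Tri.loop_pos trivial ha (h₁.mono le_rfl fun _ h => h ▸ h₂) le_rfl⟩

theorem Ter.loop_count (Inv : ℕ → St s → Prop)
    (h0 : ∀ σ, Inv 0 σ → σ.reg a = 0) (h1 : ∀ j σ, Inv (j + 1) σ → σ.reg a ≠ 0)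
    {m : ℕ} (h2 : ∀ j < m, ∀ σ, Inv (j + 1) σ → Ter c σ (fun σ' => Inv j (σ'.set 0 0)))
    (hσ : Inv m σ) (hQ : ∀ σ, Inv 0 σ → Q σ) : Ter (.loop a c) σ Q := by
  induction m generalizing σ with
  | zero => exact Ter.loop_zero (h0 σ hσ) (hQ _ hσ)
  | succ m ih =>
    exact Ter.loop_pos (h1 m σ hσ) ((h2 m (by omega) σ hσ).mono fun σ' h =>
      ih (fun j hj => h2 j (by omega)) h)

end

/-- Copy register `a` to register `d`. -/
def copy {s : ℕ} (d a : ℕ) : List (Instr s) := [.const 0 0, .add d a 0]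

theorem BlkOk.append {s : ℕ} {G : ℕ → Prop} {x : Word s} {is js : List (Instr s)} {σ : St s}
    {Q : St s → Prop} (h : BlkOk G x is σ (fun σ' => BlkOk G x js σ' Q)) :
    BlkOk G x (is ++ js) σ Q := by
  induction is generalizing σ with
  | nil => exact h
  | cons I is ih => exact ⟨h.1, ih h.2⟩

/-- Replace register `r` by its square plus registers `r + 1` and `r + 2`, using the registers
above. -/
def squareCmd {s : ℕ} (r : ℕ) : Cmd s :=
  .seq (.blk (copy (r + 3) r)) (.loop (r + 3) (.blk [.add (r + 1) (r + 1) r, .const (r + 4) 1,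
      .sub (r + 3) (r + 3) (r + 4)]))

/-- The machine cannot multiply; the square is added to register `r + 1` by repeated addition. -/
theorem squareCmd_spec {s : ℕ} {r : ℕ} (hr : 0 < r) (σ : St s) :
    Ter (squareCmd r) σ (fun σ' => σ'.reg (r + 1) = σ.reg (r + 1) + σ.reg r * σ.reg r ∧
      Low (r + 1) σ σ') := by
  refine Ter.seq (Q := fun σ' => σ'.reg (r + 3) = σ.reg r ∧ σ'.reg (r + 1) = σ.reg (r + 1) ∧
    Low (r + 1) σ σ') (Ter.blk ?_) ?_
  · simp [copy, BlkOk, Safe, eff, St.set_reg, hr.ne']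
    exact ((Low.refl _ σ).set (by omega)).set (by omega)
  · intro σ₁ ⟨h1, h2, h3⟩
    refine Ter.loop_count (fun j σ' => j ≤ σ.reg r ∧ σ'.reg (r + 3) = j ∧
      σ'.reg (r + 1) = σ.reg (r + 1) + (σ.reg r - j) * σ.reg r ∧ Low (r + 1) σ σ')
      (fun σ' h => h.2.1) (fun j σ' h => by omega) (m := σ.reg r) ?_ ⟨le_rfl, h1, by simpa using h2, h3⟩ ?_
    · intro j hj σ' ⟨k1, k2, k3, k4⟩
      refine Ter.blk ?_
      have hl := k4 r hr (by omega)
      simp [BlkOk, Safe, eff, St.set_reg, k2, k3, hl]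
      refine ⟨by omega, ?_, ?_⟩
      · have : σ.reg r - j = σ.reg r - (j + 1) + 1 := by omega
        rw [this]; ring
      · exact (((k4.set (by omega)).set (by omega)).set (by omega)).set (by omega)
    · intro σ' ⟨_, _, k3, k4⟩
      exact ⟨by simpa using k3, k4⟩

/-- Replace register `r` by the pair of registers `r` and `r + 1`. -/
def pairCmd {s : ℕ} (r : ℕ) : Cmd s :=
  .seq (.blk [.sub (r + 2) (r + 1) r])
    (.seq (.ite (r + 2) (.blk (copy (r + 3) r ++ [.add r r (r + 1)])) (.blk (copy (r + 3) (r + 1))))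
      (.seq (.blk [.const (r + 4) 0]) (.seq (squareCmd (r + 3)) (.blk [.add r r (r + 4)]))))

/-- `Nat.pair a b` is the square of the maximum, plus `a + b` if `b ≤ a` and plus `a` otherwise; the
truncated difference `b - a` decides the case. -/
theorem pairCmd_spec {s : ℕ} {r : ℕ} (hr : 0 < r) (σ : St s) :
    Ter (pairCmd r) σ (fun σ' => σ'.reg r = Nat.pair (σ.reg r) (σ.reg (r + 1)) ∧ Low r σ σ') := by
  refine Ter.seq (Q := fun σ' => σ'.reg (r + 2) = σ.reg (r + 1) - σ.reg r ∧ Low (r + 2) σ σ')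
    (Ter.blk ?_) fun σ₁ ⟨h1, h2⟩ => ?_
  · simp [BlkOk, Safe, eff, St.set_reg]
    exact (Low.refl _ σ).set (by omega)
  refine Ter.seq (Q := fun σ' => σ'.reg r + σ'.reg (r + 3) * σ'.reg (r + 3) =
    Nat.pair (σ.reg r) (σ.reg (r + 1)) ∧ Low r σ σ') ?_ fun σ₂ ⟨k1, k2⟩ => ?_
  · have e1 := h2 r hr (by omega)
    have e2 := h2 (r + 1) (by omega) (by omega)
    by_cases h : σ.reg (r + 1) ≤ σ.reg r
    · refine Ter.ite_zero (by omega) (Ter.blk ?_)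
      simp [copy, BlkOk, Safe, eff, St.set_reg, hr.ne', e1, e2]
      refine ⟨by rw [Nat.pair, if_neg (by omega)]; ring, ?_⟩
      exact ((((Low.refl _ σ).trans h2 (by omega)).set (by omega)).set (by omega)).set (by omega)
    · refine Ter.ite_pos (by omega) (Ter.blk ?_)
      simp [copy, BlkOk, Safe, eff, St.set_reg, hr.ne', e1, e2]
      refine ⟨by rw [Nat.pair, if_pos (by omega)]; ring, ?_⟩
      exact ((((Low.refl _ σ).trans h2 (by omega)).set (by omega)).set (by omega)).set (by omega)
  refine Ter.seq (Q := fun σ' => σ'.reg (r + 4) = 0 ∧ Low (r + 4) σ₂ σ') (Ter.blk ?_)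
    fun σ₃ ⟨l1, l2⟩ => ?_
  · simp [BlkOk, Safe, eff, St.set_reg]
    exact (Low.refl _ _).set (by omega)
  refine Ter.seq (squareCmd_spec (by omega) σ₃) fun σ₄ ⟨m1, m2⟩ => Ter.blk ?_
  simp only [BlkOk, Safe, eff, St.set_reg, true_and, if_true]
  have q1 := l2 r hr (by omega)
  have q2 := l2 (r + 3) (by omega) (by omega)
  have q3 := m2 r hr (by omega)
  rw [l1, q2] at m1
  refine ⟨by rw [q3, q1, m1, ← k1]; ring, ?_⟩
  exact ((k2.trans l2 (by omega)).trans m2 (by omega)).set (by omega)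

/-- Replace the pair in registers `r` and `r + 1` by the next one. -/
def nextPairCmd {s : ℕ} (r : ℕ) : Cmd s :=
  .seq (.blk [.const (r + 3) 1, .sub (r + 4) (r + 1) r, .sub (r + 5) r (r + 1)])
    (.ite (r + 4)
      (.seq (.blk [.add (r + 1) (r + 1) (r + 3)]) (.ite (r + 5) (.blk [.const r 0]) (.blk [])))
      (.seq (.blk [.add r r (r + 3), .sub (r + 4) (r + 1) r])
        (.ite (r + 4) (.blk [.const (r + 1) 0]) (.blk []))))

/-- `Nat.pair` runs through the shells of constant maximum `m` in the order `(0, m), …, (m - 1, m),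
(m, 0), …, (m, m)` and then goes on with `(0, m + 1)`. The inner conditionals treat the two corners.
-/
theorem nextPairCmd_spec {s : ℕ} {r : ℕ} (hr : 0 < r) (σ : St s) :
    Ter (nextPairCmd r) σ (fun σ' => Nat.pair (σ'.reg r) (σ'.reg (r + 1)) =
      Nat.pair (σ.reg r) (σ.reg (r + 1)) + 1 ∧ σ'.reg (r + 2) = σ.reg (r + 2) ∧ Low r σ σ') := by
  obtain ⟨u, hu⟩ : ∃ u, u = σ.reg r := ⟨_, rfl⟩
  obtain ⟨v, hv⟩ : ∃ v, v = σ.reg (r + 1) := ⟨_, rfl⟩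
  rw [← hu, ← hv]
  refine Ter.seq (Q := fun σ' => σ'.reg (r + 3) = 1 ∧ σ'.reg (r + 4) = v - u ∧
    σ'.reg (r + 5) = u - v ∧ Low (r + 3) σ σ') (Ter.blk ?_) fun σ₁ ⟨h1, h2, h3, h4⟩ => ?_
  · simp [BlkOk, Safe, eff, St.set_reg, ← hu, ← hv]
    exact (((Low.refl _ _).set (by omega)).set (by omega)).set (by omega)
  have e1 := h4 r hr (by omega)
  have e2 := h4 (r + 1) (by omega) (by omega)
  have e3 := h4 (r + 2) (by omega) (by omega)
  have hl : Low r σ σ₁ := (Low.refl _ _).trans h4 (by omega)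
  rcases lt_trichotomy u v with h | h | h
  · refine Ter.ite_pos (by omega) (Ter.seq (Q := fun σ' => σ'.reg r = u + 1 ∧ σ'.reg (r + 1) = v ∧
      σ'.reg (r + 2) = σ.reg (r + 2) ∧ σ'.reg (r + 4) = v - (u + 1) ∧ Low r σ σ') (Ter.blk ?_)
      fun σ₂ ⟨k1, k2, k3, k4, k5⟩ => ?_)
    · simp [BlkOk, Safe, eff, St.set_reg, h1, e1, e2, e3, ← hu, ← hv]
      exact (hl.set (by omega)).set (by omega)
    · by_cases h' : v = u + 1
      · refine Ter.ite_zero (by omega) (Ter.blk ?_)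
        simp [BlkOk, Safe, eff, St.set_reg, k1, k3, hr.ne', h']
        refine ⟨?_, (k5.set (by omega)).set (by omega)⟩
        simp [Nat.pair]; ring
      · refine Ter.ite_pos (by omega) (Ter.blk ?_)
        simp [BlkOk, St.set_reg, k1, k2, k3, hr.ne']
        refine ⟨?_, (k5.set (by omega)).set (by omega)⟩
        rw [Nat.pair, if_pos (by omega), Nat.pair, if_pos (by omega)]; ring
  · refine Ter.ite_zero (by omega) (Ter.seq (Q := fun σ' => σ'.reg r = u ∧ σ'.reg (r + 1) = v + 1 ∧
      σ'.reg (r + 2) = σ.reg (r + 2) ∧ σ'.reg (r + 5) = u - v ∧ Low r σ σ') (Ter.blk ?_)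
      fun σ₂ ⟨k1, k2, k3, k4, k5⟩ => ?_)
    · simp [BlkOk, Safe, eff, St.set_reg, h1, h3, e1, e2, e3, ← hu, ← hv]
      exact hl.set (by omega)
    · refine Ter.ite_zero (by omega) (Ter.blk ?_)
      simp [BlkOk, Safe, eff, St.set_reg, k2, k3, h]
      refine ⟨?_, k5.set (by omega)⟩
      simp [Nat.pair]; ring
  · refine Ter.ite_zero (by omega) (Ter.seq (Q := fun σ' => σ'.reg r = u ∧ σ'.reg (r + 1) = v + 1 ∧
      σ'.reg (r + 2) = σ.reg (r + 2) ∧ σ'.reg (r + 5) = u - v ∧ Low r σ σ') (Ter.blk ?_)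
      fun σ₂ ⟨k1, k2, k3, k4, k5⟩ => ?_)
    · simp [BlkOk, Safe, eff, St.set_reg, h1, h3, e1, e2, e3, ← hu, ← hv]
      exact hl.set (by omega)
    · refine Ter.ite_pos (by omega) (Ter.blk ?_)
      simp [BlkOk, St.set_reg, k1, k2, k3, hr.ne']
      refine ⟨?_, k5.set (by omega)⟩
      rw [Nat.pair, if_neg (by omega), Nat.pair, if_neg (by omega)]; ring

/-- Replace registers `r` and `r + 1` by the components of the pair in register `r`. -/
def unpairCmd {s : ℕ} (r : ℕ) : Cmd s :=
  .seq (.blk (copy (r + 2) r ++ [.const r 0, .const (r + 1) 0]))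
    (.loop (r + 2) (.seq (.blk [.const (r + 3) 1, .sub (r + 2) (r + 2) (r + 3)]) (nextPairCmd r)))

/-- No square root is extracted: starting from `(0, 0)`, the successor of a pair is taken as often
as the code says. Time is irrelevant here. -/
theorem unpairCmd_spec {s : ℕ} {r : ℕ} (hr : 0 < r) (σ : St s) :
    Ter (unpairCmd r) σ (fun σ' => σ'.reg r = (σ.reg r).unpair.1 ∧
      σ'.reg (r + 1) = (σ.reg r).unpair.2 ∧ Low r σ σ') := by
  refine Ter.seq (Q := fun σ' => σ'.reg (r + 2) = σ.reg r ∧ σ'.reg r = 0 ∧ σ'.reg (r + 1) = 0 ∧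
    Low r σ σ') (Ter.blk ?_) fun σ₁ ⟨h1, h2, h3, h4⟩ => ?_
  · simp [copy, BlkOk, Safe, eff, St.set_reg, hr.ne']
    exact ((((Low.refl _ _).set (by omega)).set (by omega)).set (by omega)).set (by omega)
  refine Ter.loop_count (fun j σ' => σ'.reg (r + 2) = j ∧
    Nat.pair (σ'.reg r) (σ'.reg (r + 1)) + j = σ.reg r ∧ Low r σ σ')
    (fun σ' h => h.1) (fun j σ' h => by omega) (m := σ.reg r) ?_ ⟨h1, by simp [h2, h3, Nat.pair], h4⟩ ?_
  · intro j hj σ' ⟨k1, k2, k3⟩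
    refine Ter.seq (Q := fun σ₂ => σ₂.reg (r + 2) = j ∧
      Nat.pair (σ₂.reg r) (σ₂.reg (r + 1)) + (j + 1) = σ.reg r ∧ Low r σ σ₂)
      (Ter.blk ?_) fun σ₂ ⟨l1, l2, l3⟩ => (nextPairCmd_spec hr σ₂).mono fun σ₃ ⟨m1, m2, m3⟩ => ?_
    · simp [BlkOk, Safe, eff, St.set_reg, k1, k2]
      exact (k3.set (by omega)).set (by omega)
    · simp [St.set_reg, hr.ne', m2, l1, m1]
      exact ⟨by omega, (l3.trans m3 le_rfl).set (by omega)⟩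
  · intro σ' ⟨_, k2, k3⟩
    rw [add_zero] at k2
    rw [← k2, Nat.unpair_pair]
    exact ⟨rfl, rfl, k3⟩

/-- Partial recursive functions are computed by structured programs. -/
theorem exists_cmd_of_partrec (s : ℕ) {f : ℕ →. ℕ} (hf : Nat.Partrec f) : ∀ r, 0 < r →
    ∃ c : Cmd s, ∀ σ, ∀ y ∈ f (σ.reg r), Ter c σ (fun σ' => σ'.reg r = y ∧ Low r σ σ') := by
  induction hf with
  | zero =>
    refine fun r hr => ⟨.blk [.const r 0], fun σ y hy => Ter.blk ?_⟩
    obtain rfl : y = 0 := by simpa [pure, PFun.pure] using hy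
    simp [BlkOk, Safe, eff, St.set_reg]
    exact (Low.refl _ _).set (by omega)
  | succ =>
    refine fun r hr => ⟨.blk [.const (r + 1) 1, .add r r (r + 1)], fun σ y hy => Ter.blk ?_⟩
    obtain rfl : y = σ.reg r + 1 := by simpa using hy
    simp [BlkOk, Safe, eff, St.set_reg]
    exact ((Low.refl _ _).set (by omega)).set (by omega)
  | left =>
    refine fun r hr => ⟨unpairCmd r, fun σ y hy => (unpairCmd_spec hr σ).mono fun σ' h => ?_⟩
    obtain rfl : y = (σ.reg r).unpair.1 := by simpa using hy
    exact ⟨h.1, h.2.2⟩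
  | right =>
    refine fun r hr => ⟨.seq (unpairCmd r) (.blk (copy r (r + 1))), fun σ y hy =>
      Ter.seq (unpairCmd_spec hr σ) fun σ' h => Ter.blk ?_⟩
    obtain rfl : y = (σ.reg r).unpair.2 := by simpa using hy
    simp [copy, BlkOk, Safe, eff, St.set_reg, h.2.1]
    exact (h.2.2.set (by omega)).set (by omega)
  | @pair f g _ _ hf hg =>
    intro r hr
    obtain ⟨cf, hf⟩ := hf (r + 1) (by omega)
    obtain ⟨cg, hg⟩ := hg (r + 2) (by omega)
    refine ⟨.seq (.blk (copy (r + 1) r)) (.seq cf (.seq (.blk (copy (r + 2) r)) (.seq cg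
      (.seq (.blk (copy r (r + 1) ++ copy (r + 1) (r + 2))) (pairCmd r))))), fun σ y hy => ?_⟩
    obtain ⟨u, hu, w, hw, rfl⟩ : ∃ u ∈ f (σ.reg r), ∃ w ∈ g (σ.reg r), Nat.pair u w = y := by
      simpa [Seq.seq] using hy
    refine Ter.seq (Q := fun σ' => σ'.reg (r + 1) = σ.reg r ∧ Low (r + 1) σ σ') (Ter.blk ?_)
      fun σ₁ ⟨h1, h2⟩ => Ter.seq (hf σ₁ u (by rwa [h1])) fun σ₂ ⟨h3, h4⟩ =>
      Ter.seq (Q := fun σ' => σ'.reg (r + 2) = σ.reg r ∧ σ'.reg (r + 1) = u ∧ Low (r + 1) σ σ')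
        (Ter.blk ?_) fun σ₃ ⟨h5, h6, h7⟩ => Ter.seq (hg σ₃ w (by rwa [h5])) fun σ₄ ⟨h8, h9⟩ =>
      Ter.seq (Q := fun σ' => σ'.reg r = u ∧ σ'.reg (r + 1) = w ∧ Low r σ σ') (Ter.blk ?_)
        fun σ₅ ⟨h10, h11, h12⟩ => (pairCmd_spec hr σ₅).mono fun σ₆ ⟨h13, h14⟩ => ?_
    · simp [copy, BlkOk, Safe, eff, St.set_reg, hr.ne']
      exact ((Low.refl _ _).set (by omega)).set (by omega)
    · have e := (h2.trans h4 le_rfl) r hr (by omega)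
      simp [copy, BlkOk, Safe, eff, St.set_reg, hr.ne', e, h3]
      exact ((h2.trans h4 le_rfl).set (by omega)).set (by omega)
    · have e := h9 (r + 1) (by omega) (by omega)
      simp [copy, BlkOk, Safe, eff, St.set_reg, hr.ne', e, h6, h8]
      exact (((((Low.refl r σ).trans (h7.trans h9 (by omega)) (by omega)).set (by omega)).set
        (by omega)).set (by omega)).set (by omega)
    · rw [h13, h10, h11]
      exact ⟨rfl, h12.trans h14 le_rfl⟩
  | @comp f g _ _ hf hg =>
    intro r hr
    obtain ⟨cf, hf⟩ := hf r hr
    obtain ⟨cg, hg⟩ := hg r hr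
    refine ⟨.seq cg cf, fun σ y hy => ?_⟩
    obtain ⟨u, hu, hy⟩ : ∃ u ∈ g (σ.reg r), y ∈ f u := Part.mem_bind_iff.1 hy
    exact Ter.seq (hg σ u hu) fun σ₁ ⟨h1, h2⟩ => (hf σ₁ y (by rwa [h1])).mono
      fun σ₂ ⟨h3, h4⟩ => ⟨h3, h2.trans h4 le_rfl⟩
  | @prec f g _ _ hf hg =>
    intro r hr
    obtain ⟨cf, hf⟩ := hf (r + 3) (by omega)
    obtain ⟨cg, hg⟩ := hg (r + 4) (by omega)
    -- Register `r` holds the parameter, `r + 1` the remaining rounds, `r + 2` the recursion index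
    -- and `r + 3` the current value; the argument of the step function is assembled from `r + 4`
    -- on.
    refine ⟨.seq (unpairCmd r) (.seq (.blk (.const (r + 2) 0 :: copy (r + 3) r)) (.seq cf (.seq
      (.loop (r + 1) (.seq (.blk ([.const (r + 4) 1, .sub (r + 1) (r + 1) (r + 4)] ++
        copy (r + 4) r ++ copy (r + 5) (r + 2) ++ copy (r + 6) (r + 3)))
        (.seq (pairCmd (r + 5)) (.seq (pairCmd (r + 4)) (.seq cg (.blk (copy (r + 3) (r + 4) ++
        [.const (r + 4) 1, .add (r + 2) (r + 2) (r + 4)])))))))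
      (.blk (copy r (r + 3)))))), fun σ y hy => ?_⟩
    obtain ⟨z, hz⟩ : ∃ z, z = (σ.reg r).unpair.1 := ⟨_, rfl⟩
    obtain ⟨n, hn⟩ : ∃ n, n = (σ.reg r).unpair.2 := ⟨_, rfl⟩
    let F : ℕ → Part ℕ := fun n => n.rec (f z) fun y IH => IH.bind fun i =>
      g (Nat.pair z (Nat.pair y i))
    have hF : ∀ m w, w ∈ F (m + 1) → ∃ i ∈ F m, w ∈ g (Nat.pair z (Nat.pair m i)) :=
      fun m w h => by simpa [F] using h
    have hy : y ∈ F n := by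
      simpa [Nat.unpaired, hz, hn, F] using hy
    -- Definedness propagates downwards: a value of the recursion at `n` presupposes values at all
    -- smaller indices, so every round of the loop terminates.
    have hdom : ∀ j ≤ n, ∃ i, i ∈ F (n - j) := by
      intro j
      induction j with
      | zero => exact fun _ => ⟨y, hy⟩
      | succ j ih =>
        intro hj
        obtain ⟨i, hi⟩ := ih (by omega)
        have : n - j = n - (j + 1) + 1 := by omega
        rw [this] at hi
        obtain ⟨i', h, _⟩ := hF _ _ hi
        exact ⟨i', h⟩
    refine Ter.seq (unpairCmd_spec hr σ) fun σ₁ ⟨h1, h2, h3⟩ =>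
      Ter.seq (Q := fun σ' => σ'.reg r = z ∧ σ'.reg (r + 1) = n ∧ σ'.reg (r + 2) = 0 ∧
        σ'.reg (r + 3) = z ∧ Low r σ σ') (Ter.blk ?_) fun σ₂ ⟨k1, k2, k3, k4, k5⟩ => ?_
    · simp [copy, BlkOk, Safe, eff, St.set_reg, hr.ne', h1, h2, ← hz, ← hn]
      exact ((h3.set (by omega)).set (by omega)).set (by omega)
    obtain ⟨i₀, hi₀⟩ := hdom n le_rfl
    rw [Nat.sub_self] at hi₀
    refine Ter.seq (hf σ₂ i₀ (by rwa [k4])) fun σ₃ ⟨l1, l2⟩ => Ter.seq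
      (Q := fun σ' => σ'.reg (r + 3) = y ∧ Low r σ σ')
      (Ter.loop_count (fun j σ' => j ≤ n ∧ σ'.reg r = z ∧ σ'.reg (r + 1) = j ∧
        σ'.reg (r + 2) = n - j ∧ σ'.reg (r + 3) ∈ F (n - j) ∧ Low r σ σ')
        (fun σ' h => h.2.2.1) (fun j σ' h => by omega) (m := n) ?_ ?_ ?_)
        (fun σ₄ ⟨m1, m2⟩ => Ter.blk ?_)
    · intro j hj σ₄ ⟨m1, m2, m3, m4, m5, m6⟩
      have hj' : n - j = n - (j + 1) + 1 := by omega
      obtain ⟨w, hw⟩ := hdom j (by omega)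
      obtain ⟨i, hi, hw'⟩ := hF (n - (j + 1)) w (hj' ▸ hw)
      obtain rfl : i = σ₄.reg (r + 3) := Part.mem_unique hi m5
      refine Ter.seq (Q := fun σ' => σ'.reg r = z ∧ σ'.reg (r + 1) = j ∧
        σ'.reg (r + 2) = n - (j + 1) ∧ σ'.reg (r + 4) = z ∧ σ'.reg (r + 5) = n - (j + 1) ∧
        σ'.reg (r + 6) = σ₄.reg (r + 3) ∧ Low r σ σ') (Ter.blk ?_)
        fun σ₅ ⟨a1, a2, a3, a4, a5, a6, a7⟩ =>
        Ter.seq (pairCmd_spec (by omega) σ₅) fun σ₆ ⟨b1, b2⟩ =>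
        Ter.seq (pairCmd_spec (by omega) σ₆) fun σ₇ ⟨c1, c2⟩ => Ter.seq (hg σ₇ w ?_)
        fun σ₈ ⟨d1, d2⟩ => Ter.blk ?_
      · simp [copy, BlkOk, Safe, eff, St.set_reg, hr.ne', m2, m3, m4]
        exact (((((((m6.set (by omega)).set (by omega)).set (by omega)).set (by omega)).set
          (by omega)).set (by omega)).set (by omega)).set (by omega)
      · rw [c1, b1, b2 (r + 4) (by omega) (by omega), a4, a5, a6]
        exact hw'
      · have hl : Low (r + 4) σ₅ σ₈ := ((Low.refl _ _).trans b2 (by omega)).trans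
          (c2.trans d2 le_rfl) le_rfl
        have e1 := hl r (by omega) (by omega)
        have e2 := hl (r + 1) (by omega) (by omega)
        have e3 := hl (r + 2) (by omega) (by omega)
        simp [copy, BlkOk, Safe, eff, St.set_reg, hr.ne', e1, e2, e3, a1, a2, a3, d1]
        refine ⟨by omega, by omega, hw, ?_⟩
        exact (((((a7.trans hl (by omega)).set (by omega)).set (by omega)).set (by omega)).set
          (by omega)).set (by omega)
    · refine ⟨le_rfl, ?_, ?_, ?_, ?_, k5.trans l2 (by omega)⟩
      · rw [l2 r (by omega) (by omega), k1]
      · rw [l2 (r + 1) (by omega) (by omega), k2]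
      · rw [l2 (r + 2) (by omega) (by omega), k3, Nat.sub_self]
      · rwa [l1, Nat.sub_self]
    · intro σ₄ ⟨_, _, _, _, m5, m6⟩
      exact ⟨Part.mem_unique m5 hy, m6⟩
    · simp [copy, BlkOk, Safe, eff, St.set_reg, m1]
      exact (m2.set (by omega)).set (by omega)
  | @rfind f _ hf =>
    intro r hr
    obtain ⟨cf, hf⟩ := hf (r + 2) (by omega)
    -- The test register `r + 2` starts with `1` to enter the loop. The candidate in `r + 1` has
    -- already been incremented when a zero is noticed, hence the final subtraction.
    refine ⟨.seq (.blk [.const (r + 1) 0, .const (r + 2) 1]) (.seq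
      (.loop (r + 2) (.seq (.blk (copy (r + 2) r ++ copy (r + 3) (r + 1)))
        (.seq (pairCmd (r + 2)) (.seq cf
          (.blk [.const (r + 3) 1, .add (r + 1) (r + 1) (r + 3)])))))
      (.blk [.const (r + 3) 1, .sub r (r + 1) (r + 3)])), fun σ y hy => ?_⟩
    obtain ⟨hy1, hy2⟩ := Nat.mem_rfind.1 hy
    have hval : ∀ j ≤ y, ∃ w ∈ f (Nat.pair (σ.reg r) j), (w = 0 ↔ j = y) := by
      intro j hj
      rcases hj.lt_or_eq with h | rfl
      · obtain ⟨w, hw, hw'⟩ : ∃ w ∈ f (Nat.pair (σ.reg r) j), w ≠ 0 := by simpa using hy2 h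
        exact ⟨w, hw, by simp [hw', h.ne]⟩
      · obtain ⟨w, hw, hw'⟩ : ∃ w ∈ f (Nat.pair (σ.reg r) j), w = 0 := by simpa using hy1
        exact ⟨w, hw, by simp [hw']⟩
    refine Ter.seq (Q := fun σ' => σ'.reg r = σ.reg r ∧ σ'.reg (r + 1) = 0 ∧ σ'.reg (r + 2) = 1 ∧
      Low r σ σ') (Ter.blk ?_) fun σ₁ ⟨h1, h2, h3, h4⟩ => Ter.seq
      (Q := fun σ' => σ'.reg (r + 1) = y + 1 ∧ Low r σ σ')
      (Ter.loop_count (fun j σ' => σ'.reg r = σ.reg r ∧ σ'.reg (r + 1) + j = y + 1 ∧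
        (σ'.reg (r + 2) = 0 ↔ j = 0) ∧ Low r σ σ') (fun σ' h => h.2.2.1.2 rfl)
        (fun j σ' h => by rw [Ne, h.2.2.1]; omega) (m := y + 1) ?_ ?_ ?_)
      fun σ₂ ⟨k1, k2⟩ => Ter.blk ?_
    · simp [BlkOk, Safe, eff, St.set_reg]
      exact ((Low.refl _ _).set (by omega)).set (by omega)
    · intro j hj σ₂ ⟨k1, k2, k3, k4⟩
      obtain ⟨w, hw, hw'⟩ := hval (σ₂.reg (r + 1)) (by omega)
      refine Ter.seq (Q := fun σ' => σ'.reg r = σ.reg r ∧ σ'.reg (r + 1) = σ₂.reg (r + 1) ∧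
        σ'.reg (r + 2) = σ.reg r ∧ σ'.reg (r + 3) = σ₂.reg (r + 1) ∧ Low r σ σ') (Ter.blk ?_)
        fun σ₃ ⟨l1, l2, l3, l4, l5⟩ => Ter.seq (pairCmd_spec (by omega) σ₃) fun σ₄ ⟨m1, m2⟩ =>
        Ter.seq (hf σ₄ w (by rwa [m1, l3, l4])) fun σ₅ ⟨n1, n2⟩ => Ter.blk ?_
      · simp [copy, BlkOk, Safe, eff, St.set_reg, hr.ne', k1]
        exact (((k4.set (by omega)).set (by omega)).set (by omega)).set (by omega)
      · have hl := m2.trans n2 le_rfl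
        have e1 := hl r hr (by omega)
        have e2 := hl (r + 1) (by omega) (by omega)
        simp [BlkOk, Safe, eff, St.set_reg, hr.ne', e1, e2, l1, l2, n1]
        refine ⟨by omega, by rw [hw']; omega, ?_⟩
        exact (((l5.trans hl (by omega)).set (by omega)).set (by omega)).set (by omega)
    · exact ⟨h1, by omega, by simp [h3], h4⟩
    · exact fun σ₂ h => ⟨h.2.1, h.2.2.2⟩
    · simp [BlkOk, Safe, eff, St.set_reg, k1]
      exact (k2.set (by omega)).set (by omega)

/-- A computable function `t` is computed by a machine that reads its argument from and leaves its
result in register `1`. -/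
theorem exists_program_of_computable (s : ℕ) {t : ℕ → ℕ} (ht : Computable t) :
    ∃ P : Program s, ∀ k, ∃ m, P.length ≤
        ((step P [])^[m] ⟨0, Function.update (fun _ => 0) 1 k, [], []⟩).pc ∧
      ((step P [])^[m] ⟨0, Function.update (fun _ => 0) 1 k, [], []⟩).reg 1 = t k := by
  have ht' : Nat.Partrec (fun n => Part.some (t n)) := Partrec.nat_iff.1 ht
  obtain ⟨c, hc⟩ := exists_cmd_of_partrec s ht' 1 one_pos
  refine ⟨c.code 0, fun k => ?_⟩
  obtain ⟨σ', h1, T, h2⟩ := hc ⟨Function.update (fun _ => 0) 1 k, [], []⟩ (t k) (by simp)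
  obtain ⟨m, _, σ'', h3, rfl⟩ := h2 (fun _ => trivial) (c.code 0) 0
    (fun i I h => by rwa [zero_add])
  refine ⟨m, ?_⟩
  have h4 := h3.1
  rw [zero_add] at h4
  change (step (c.code 0) [])^[m] ⟨0, _, [], []⟩ = _ at h4
  rw [h4]
  exact ⟨by rw [c.code_length]; rfl, h1.1⟩

end EnumFPT

/-! ### Computable bounds for halting times -/

namespace EnumFPT

/-- Replace the entry at `i`, extending the list by zeros if necessary. -/
def setEntry (l : List ℕ) (i v : ℕ) : List ℕ :=
  (List.range (max l.length (i + 1))).map fun j => if j = i then v else l.getD j 0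

/-- Missing entries read as `0`, the initial content of a register, so finite lists can represent
the infinite register file. -/
theorem setEntry_getD (l : List ℕ) (i v r : ℕ) :
    (setEntry l i v).getD r 0 = Function.update (fun r => l.getD r 0) i v r := by
  by_cases h : r < max l.length (i + 1)
  · simp [setEntry, List.getD_eq_getElem?_getD, h, Function.update_apply]
  · rw [List.getD_eq_default _ _ (by simp [setEntry]; omega), Function.update_of_ne (by omega),
      List.getD_eq_default _ _ (by omega)]

theorem primrec_setEntry {α : Type*} [Primcodable α] {f : α → List ℕ} {g h : α → ℕ}
    (hf : Primrec f) (hg : Primrec g) (hh : Primrec h) :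
    Primrec fun a => setEntry (f a) (g a) (h a) := by
  refine Primrec.list_map (Primrec.list_range.comp (Primrec.nat_max.comp
    (Primrec.list_length.comp hf) (Primrec.succ.comp hg))) ?_
  exact Primrec.ite (Primrec.eq.comp Primrec.snd (hg.comp Primrec.fst)) (hh.comp Primrec.fst)
    ((Primrec.list_getD 0).comp (hf.comp Primrec.fst) Primrec.snd)

/-- The effect of an instruction on the program counter and a list of register contents. -/
def listExec {s : ℕ} (x : Word s) (q : ℕ × List ℕ) : Instr s → ℕ × List ℕ
  | .const d k => (q.1 + 1, setEntry q.2 d k)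
  | .add d a b => (q.1 + 1, setEntry q.2 d (q.2.getD a 0 + q.2.getD b 0))
  | .sub d a b => (q.1 + 1, setEntry q.2 d (q.2.getD a 0 - q.2.getD b 0))
  | .half d a => (q.1 + 1, setEntry q.2 d (q.2.getD a 0 / 2))
  | .load d a => (q.1 + 1, setEntry q.2 d (q.2.getD (q.2.getD a 0) 0))
  | .store a b => (q.1 + 1, setEntry q.2 (q.2.getD a 0) (q.2.getD b 0))
  | .read d a => (q.1 + 1, setEntry q.2 d (inputAt x (q.2.getD a 0)))
  | .jz a l => (if q.2.getD a 0 = 0 then l else q.1 + 1, q.2)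
  | .write _ => (q.1 + 1, q.2)
  | .emit => (q.1 + 1, q.2)

/-- A step of the program `P` on the program counter and a list of register contents. -/
def listStep {s : ℕ} (P : Program s) (x : Word s) (q : ℕ × List ℕ) : ℕ × List ℕ :=
  (P[q.1]?).elim q (listExec x q)

/-- The pair `q` represents the program counter and the registers of `c`. -/
def Represents {s : ℕ} (q : ℕ × List ℕ) (c : Cfg s) : Prop :=
  q.1 = c.pc ∧ (fun r => q.2.getD r 0) = c.reg

theorem Represents.exec {s : ℕ} {q : ℕ × List ℕ} {c : Cfg s} (h : Represents q c) (x : Word s)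
    (I : Instr s) : Represents (listExec x q I) (exec x c I) := by
  obtain ⟨h1, h2⟩ := h
  have h3 : ∀ r, q.2.getD r 0 = c.reg r := fun r => congrFun h2 r
  cases I <;> refine ⟨by simp [listExec, EnumFPT.exec, h1, h3, -List.getD_eq_getElem?_getD], ?_⟩ <;> funext r <;>
    simp only [listExec, EnumFPT.exec, setEntry_getD, h3]

theorem Represents.step {s : ℕ} {q : ℕ × List ℕ} {c : Cfg s} (h : Represents q c)
    (P : Program s) (x : Word s) : Represents (listStep P x q) (step P x c) := by
  unfold listStep EnumFPT.step
  rw [h.1]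
  cases P[c.pc]? with
  | none => exact h
  | some I => exact h.exec x I

theorem Represents.iterate {s : ℕ} {q : ℕ × List ℕ} {c : Cfg s} (h : Represents q c)
    (P : Program s) (x : Word s) (m : ℕ) :
    Represents ((listStep P x)^[m] q) ((EnumFPT.step P x)^[m] c) := by
  induction m with
  | zero => exact h
  | succ m ih => simpa only [Function.iterate_succ_apply'] using ih.step P x

theorem primrec_inputAt {s : ℕ} {α : Type*} [Primcodable α] {f : α → Word s} {g : α → ℕ}
    (hf : Primrec f) (hg : Primrec g) : Primrec fun a => inputAt (f a) (g a) := by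
  have h : Primrec fun a => (((f a)[g a]?).map fun i => i.val + 1).getD 0 :=
    Primrec.option_getD.comp (Primrec.option_map (Primrec.list_getElem?.comp hf hg)
      (Primrec.succ.comp (Primrec.fin_val.comp Primrec.snd))) (Primrec.const 0)
  refine h.of_eq fun a => ?_
  unfold inputAt
  cases (f a)[g a]? <;> rfl

theorem primrec_listExec {s : ℕ} (I : Instr s) :
    Primrec fun p : Word s × ℕ × List ℕ => listExec p.1 p.2 I := by
  have hx : Primrec fun p : Word s × ℕ × List ℕ => p.1 := Primrec.fst
  have hpc : Primrec fun p : Word s × ℕ × List ℕ => p.2.1 + 1 :=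
    Primrec.succ.comp (Primrec.fst.comp Primrec.snd)
  have hl : Primrec fun p : Word s × ℕ × List ℕ => p.2.2 := Primrec.snd.comp Primrec.snd
  have hr : ∀ {g : Word s × ℕ × List ℕ → ℕ}, Primrec g →
      Primrec fun p : Word s × ℕ × List ℕ => p.2.2.getD (g p) 0 :=
    fun hg => (Primrec.list_getD 0).comp hl hg
  have hc : ∀ a, Primrec fun p : Word s × ℕ × List ℕ => p.2.2.getD a 0 :=
    fun a => hr (Primrec.const a)
  have hs : ∀ {g h : Word s × ℕ × List ℕ → ℕ}, Primrec g → Primrec h →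
      Primrec fun p => (p.2.1 + 1, setEntry p.2.2 (g p) (h p)) :=
    fun hg hh => hpc.pair (primrec_setEntry hl hg hh)
  cases I with
  | const d k => exact hs (Primrec.const d) (Primrec.const k)
  | add d a b => exact hs (Primrec.const d) (Primrec.nat_add.comp (hc a) (hc b))
  | sub d a b => exact hs (Primrec.const d) (Primrec.nat_sub.comp (hc a) (hc b))
  | half d a => exact hs (Primrec.const d) (Primrec.nat_div.comp (hc a) (Primrec.const 2))
  | load d a => exact hs (Primrec.const d) (hr (hc a))
  | store a b => exact hs (hc a) (hc b)
  | read d a => exact hs (Primrec.const d) (primrec_inputAt hx (hc a))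
  | jz a l =>
    exact (Primrec.ite (Primrec.eq.comp (hc a) (Primrec.const 0)) (Primrec.const l) hpc).pair hl
  | write a => exact hpc.pair hl
  | emit => exact hpc.pair hl

/-- The program is fixed, so an induction along it with a case distinction on the program counter
suffices; instructions need not be encoded as data. -/
theorem primrec_listStep {s : ℕ} (P : Program s) :
    Primrec₂ fun (x : Word s) (q : ℕ × List ℕ) => listStep P x q := by
  suffices ∀ is : List (Instr s), Primrec₂ fun (p : Word s × ℕ × List ℕ) (n : ℕ) =>
      (is[n]?).elim p.2 (listExec p.1 p.2) from
    (this P).comp Primrec.id (Primrec.fst.comp Primrec.snd)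
  intro is
  induction is with
  | nil => exact Primrec.snd.comp Primrec.fst
  | cons I is ih =>
    have h : Primrec fun q : (Word s × ℕ × List ℕ) × ℕ => (Nat.casesOn q.2 (listExec q.1.1 q.1.2 I)
        (fun n => (is[n]?).elim q.1.2 (listExec q.1.1 q.1.2)) : ℕ × List ℕ) :=
      Primrec.nat_casesOn (f := fun q : (Word s × ℕ × List ℕ) × ℕ => q.2)
        (g := fun q => listExec q.1.1 q.1.2 I)
        (h := fun q n => (is[n]?).elim q.1.2 (listExec q.1.1 q.1.2)) Primrec.snd
        ((primrec_listExec I).comp Primrec.fst)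
        (ih.comp (Primrec.fst.comp Primrec.fst) Primrec.snd)
    refine h.of_eq fun q => ?_
    rcases q with ⟨p, _ | n⟩ <;> rfl

theorem primrec_listIterate {s : ℕ} (P : Program s) {α : Type*} [Primcodable α] {f : α → Word s}
    {g : α → ℕ × List ℕ} {h : α → ℕ} (hf : Primrec f) (hg : Primrec g) (hh : Primrec h) :
    Primrec fun a => (listStep P (f a))^[h a] (g a) :=
  Primrec.nat_iterate hh hg ((primrec_listStep P).comp (hf.comp Primrec.fst) Primrec.snd)

/-- Unbounded search in a decidable relation is total if every search succeeds. -/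
theorem exists_computable_find {α : Type*} [Primcodable α] {p : α → ℕ → Prop} (hp : PrimrecRel p)
    (h : ∀ a, ∃ n, p a n) : ∃ g : α → ℕ, Computable g ∧ ∀ a, p a (g a) := by
  classical
  obtain ⟨_, hp'⟩ := hp
  have h0 : Computable₂ fun (a : α) n => decide (p a n) := by
    refine hp'.to_comp.of_eq fun q => ?_
    congr
  have h1 : Partrec fun a => Nat.rfind (fun n => decide (p a n) : ℕ → Bool) :=
    Partrec.rfind h0.partrec₂
  refine ⟨fun a => Nat.find (h a), h1.of_eq_tot fun a => ?_, fun a => Nat.find_spec (h a)⟩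
  refine Nat.mem_rfind.2 ⟨by simpa using Nat.find_spec (h a), fun hm => ?_⟩
  simpa using Nat.find_min (h a) hm

/-- The words of length at most `n`. -/
def wordsUpTo (s : ℕ) : ℕ → List (Word s)
  | 0 => [[]]
  | n + 1 => [] :: (wordsUpTo s n).flatMap fun w => (List.finRange s).map (· :: w)

theorem mem_wordsUpTo {s n : ℕ} {x : Word s} (h : x.length ≤ n) : x ∈ wordsUpTo s n := by
  induction n generalizing x with
  | zero => simp [wordsUpTo, List.length_eq_zero_iff.1 (Nat.le_zero.1 h)]
  | succ n ih =>
    cases x with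
    | nil => simp [wordsUpTo]
    | cons a x => simpa [wordsUpTo] using ih (by simpa using h)

theorem primrec_wordsUpTo (s : ℕ) : Primrec (wordsUpTo s) := by
  have h : Primrec fun n : ℕ => (Nat.rec [[]] (fun _ (W : List (Word s)) =>
      [] :: W.flatMap fun w => (List.finRange s).map (· :: w)) n : List (Word s)) := by
    refine Primrec.nat_rec₁ _ ?_
    refine Primrec.list_cons.comp (Primrec.const []) ?_
    refine Primrec.list_flatMap Primrec.snd ?_
    exact Primrec.list_map (Primrec.const _)
      (Primrec.list_cons.comp Primrec.snd (Primrec.snd.comp Primrec.fst))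
  refine h.of_eq fun n => ?_
  induction n with
  | zero => rfl
  | succ n ih => simp only [wordsUpTo, ← ih]

/-- A configuration with the argument `k` in register `1`. -/
def argCfg (s k : ℕ) : Cfg s := ⟨0, Function.update (fun _ => 0) 1 k, [], []⟩

/-- The halting time of a machine that halts for every argument is bounded by a computable
function. -/
theorem exists_computable_haltTime_arg {s : ℕ} (P : Program s)
    (hP : ∀ k, ∃ m, P.length ≤ ((step P [])^[m] (argCfg s k)).pc) :
    ∃ g : ℕ → ℕ, Computable g ∧ ∀ k, P.length ≤ ((step P [])^[g k] (argCfg s k)).pc := by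
  refine exists_computable_find
    (p := fun k m => P.length ≤ ((step P [])^[m] (argCfg s k)).pc) ?_ hP
  have h : PrimrecRel fun k m : ℕ => P.length ≤ ((listStep P [])^[m] (0, [0, k])).1 := by
    refine Primrec.nat_le.comp (Primrec.const _) (Primrec.fst.comp (primrec_listIterate P
      (Primrec.const []) ((Primrec.const 0).pair (Primrec.list_cons.comp (Primrec.const 0)
      (Primrec.list_cons.comp Primrec.fst (Primrec.const [])))) Primrec.snd))
  refine h.of_eq fun k m => ?_
  have : Represents (0, [0, k]) (argCfg s k) := by
    refine ⟨rfl, ?_⟩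
    funext r
    rcases r with _ | _ | r <;> simp [argCfg]
  rw [(this.iterate P [] m).1]

theorem iterate_step_of_halted {s : ℕ} {P : Program s} {x : Word s} {c : Cfg s} {m m' : ℕ}
    (h : P.length ≤ ((step P x)^[m] c).pc) (hm : m ≤ m') :
    (step P x)^[m'] c = (step P x)^[m] c := by
  obtain ⟨d, rfl⟩ := Nat.exists_eq_add_of_le hm
  have e : step P x ((step P x)^[m] c) = (step P x)^[m] c := by
    rw [step, List.getElem?_eq_none h]
  rw [add_comm, Function.iterate_add_apply]
  exact Function.iterate_fixed e d

theorem HaltedAt.run_eq {s : ℕ} {P : Program s} {x : Word s} {m m' : ℕ} (h : HaltedAt P x m)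
    (hm : m ≤ m') : run P x m' = run P x m := iterate_step_of_halted h hm

theorem HaltedAt.mono {s : ℕ} {P : Program s} {x : Word s} {m m' : ℕ} (h : HaltedAt P x m)
    (hm : m ≤ m') : HaltedAt P x m' := by
  rw [HaltedAt, h.run_eq hm]; exact h

/-- The halting time of a machine that halts on every input is bounded by a computable function of
the input length. -/
theorem exists_computable_haltTime {s : ℕ} (P : Program s) (hP : ∀ x, ∃ m, HaltedAt P x m) :
    ∃ g : ℕ → ℕ, Computable g ∧ ∀ n x, x.length ≤ n → HaltedAt P x (g n) := by
  have hrep : ∀ x m, HaltedAt P x m ↔ P.length ≤ ((listStep P x)^[m] (0, [])).1 := by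
    intro x m
    have : Represents (0, []) (initCfg s) := ⟨rfl, by funext r; simp [initCfg]⟩
    rw [(this.iterate P x m).1]
    rfl
  have hR : PrimrecRel fun (x : Word s) m => HaltedAt P x m := by
    have h : PrimrecRel fun (x : Word s) (m : ℕ) => P.length ≤ ((listStep P x)^[m] (0, [])).1 :=
      Primrec.nat_le.comp (Primrec.const _) (Primrec.fst.comp (primrec_listIterate P
        Primrec.fst (Primrec.const _) Primrec.snd))
    exact h.of_eq fun x m => (hrep x m).symm
  -- Only finitely many inputs have length at most `n` and halting persists, so the search for a
  -- common halting time succeeds.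
  obtain ⟨g, hg, hg'⟩ := exists_computable_find (p := fun n m => ∀ x ∈ wordsUpTo s n, HaltedAt P x m)
    (hR.forall_mem_list.comp ((primrec_wordsUpTo s).comp Primrec.fst) Primrec.snd) (by
      intro n
      generalize wordsUpTo s n = W
      induction W with
      | nil => exact ⟨0, by simp⟩
      | cons w W ih =>
        obtain ⟨m, hm⟩ := ih
        obtain ⟨m', hm'⟩ := hP w
        refine ⟨max m m', fun x hx => ?_⟩
        rcases List.mem_cons.1 hx with rfl | hx
        · exact hm'.mono (le_max_right _ _)
        · exact (hm x hx).mono (le_max_left _ _))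
  exact ⟨g, hg, fun n x hx => hg' n x (mem_wordsUpTo hx)⟩

end EnumFPT

/-! ### Arithmetic commands and the output queue -/

namespace EnumFPT

/-- `σ` and `σ'` agree outside the registers in `S`. -/
def Fix {s : ℕ} (S : ℕ → Prop) (σ σ' : St s) : Prop :=
  σ'.buf = σ.buf ∧ σ'.out = σ.out ∧ ∀ a, ¬ S a → σ'.reg a = σ.reg a

section Fix

variable {s : ℕ} {S S' : ℕ → Prop} {σ σ₁ σ₂ σ₃ : St s}

theorem Fix.refl (S : ℕ → Prop) (σ : St s) : Fix S σ σ := ⟨rfl, rfl, fun _ _ => rfl⟩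

theorem Fix.trans (h : Fix S σ₁ σ₂) (h' : Fix S σ₂ σ₃) : Fix S σ₁ σ₃ :=
  ⟨h'.1.trans h.1, h'.2.1.trans h.2.1, fun a ha => (h'.2.2 a ha).trans (h.2.2 a ha)⟩

theorem Fix.mono (h : Fix S σ₁ σ₂) (hS : ∀ a, S a → S' a) : Fix S' σ₁ σ₂ :=
  ⟨h.1, h.2.1, fun a ha => h.2.2 a (fun h => ha (hS a h))⟩

theorem Fix.set (h : Fix S σ₁ σ₂) {d k : ℕ} (hd : S d) : Fix S σ₁ (σ₂.set d k) := by
  refine ⟨h.1, h.2.1, fun a ha => ?_⟩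
  rw [St.set_reg, if_neg (by rintro rfl; exact ha hd), h.2.2 a ha]

end Fix

/-- The scratch registers and the register `r`. -/
def Scratch (r a : ℕ) : Prop := a < 8 ∨ a = r

/-- The registers changed in a simulation on the virtual machine `v`. -/
def SimRegs (v a : ℕ) : Prop := a < 8 ∨ a = 16 ∨ a = 8 + v ∨ ∃ r, a = vaddr v r

theorem not_simRegs {v a : ℕ} (hv : v < 4) (ha : 8 ≤ a) (h16 : a ≠ 16) (h : a ≠ 8 + v)
    (ha' : a < 64) : ¬ SimRegs v a := by
  rintro (h | h | h | ⟨r, rfl⟩)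
  all_goals first | omega | (simp only [vaddr] at ha'; omega)

theorem not_simRegs_vaddr {v w r : ℕ} (hv : v < 4) (hw : w < 4) (h : v ≠ w) :
    ¬ SimRegs v (vaddr w r) := by
  rintro (h' | h' | h' | ⟨r', h'⟩) <;> simp only [vaddr] at h' <;> omega

/-- Put the length of the input plus `1` into register `20`. -/
def lenCmd {s : ℕ} : Cmd s :=
  .seq (.blk [.const 1 1, .read 2 20])
    (.seq (.loop 2 (.blk [.add 20 20 1, .read 2 20])) (.blk [.const 1 1, .add 20 20 1]))

theorem inputAt_le {s : ℕ} (x : Word s) (j : ℕ) : inputAt x j ≤ s := by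
  unfold inputAt
  split <;> omega

theorem inputAt_eq_zero {s : ℕ} (x : Word s) (j : ℕ) : inputAt x j = 0 ↔ x.length ≤ j := by
  unfold inputAt
  cases h : x[j]? with
  | none => simpa using h
  | some a => simpa using (List.getElem?_eq_some_iff.1 h).1

section Commands

variable {s : ℕ} {x : Word s} {B : ℕ}

/-- Letters read as positive numbers, so the first `0` marks the end of the input. The length plus
one is stored because powers are taken of a positive base. -/
theorem lenCmd_spec {σ : St s} (h20 : σ.reg 20 = 0) (hs : s ≤ B) (hx : x.length + 1 ≤ B) :
    Tri (· ≤ B) x lenCmd σ (5 * x.length + 5)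
      (fun σ' => σ'.reg 20 = x.length + 1 ∧ Fix (Scratch 20) σ σ') := by
  refine Tri.seq (Q := fun σ' => σ'.reg 1 = 1 ∧ σ'.reg 2 = inputAt x 0 ∧ σ'.reg 20 = 0 ∧
    Fix (Scratch 20) σ σ') (T₁ := 2) (T₂ := 5 * x.length + 3) (Tri.blk ?_ le_rfl)
    (fun σ₁ ⟨h1, h2, h3, h4⟩ => ?_) (by omega)
  · simp [BlkOk, Safe, eff, St.set_reg, h20]
    refine ⟨by omega, (inputAt_le x 0).trans hs, ?_⟩
    exact ((Fix.refl _ σ).set (Or.inl (by omega))).set (Or.inl (by omega))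
  refine Tri.seq (Q := fun σ' => σ'.reg 20 = x.length ∧ Fix (Scratch 20) σ σ')
    (T₁ := 5 * x.length + 1) (T₂ := 2) ?_ (fun σ₂ ⟨k1, k2⟩ => Tri.blk ?_ le_rfl) (by omega)
  · refine Tri.loop_count (Nat.zero_le _) (T₁ := 2) (m := x.length)
      (fun j σ' => σ'.reg 20 + j = x.length ∧ σ'.reg 1 = 1 ∧ σ'.reg 2 = inputAt x (σ'.reg 20) ∧
        Fix (Scratch 20) σ σ') ?_ ?_ ?_ ⟨by omega, h1, by rw [h2, h3], h4⟩ (by omega)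
      (fun σ' h => ⟨h.1, h.2.2.2⟩)
    · intro σ' h
      rw [h.2.2.1, inputAt_eq_zero]; omega
    · intro j σ' h
      rw [h.2.2.1, Ne, inputAt_eq_zero]; omega
    · intro j hj σ' ⟨l1, l2, l3, l4⟩
      refine Tri.blk ?_ le_rfl
      simp [BlkOk, Safe, eff, St.set_reg, l2]
      refine ⟨by omega, (inputAt_le x _).trans hs, by omega, ?_⟩
      exact ((l4.set (Or.inr rfl)).set (Or.inl (by omega))).set (Or.inl (by omega))
  · simp [BlkOk, Safe, eff, St.set_reg, k1]
    exact ⟨by omega, hx, (k2.set (Or.inl (by omega))).set (Or.inr rfl)⟩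

/-- Multiply register `r` by register `q`. -/
def mulCmd {s : ℕ} (r q : ℕ) : Cmd s :=
  .seq (.blk [.const 4 0, .const 5 0, .add 3 q 5])
    (.seq (.loop 3 (.blk [.add 4 4 r, .const 1 1, .sub 3 3 1])) (.blk [.const 5 0, .add r 4 5]))

theorem mulCmd_spec {σ : St s} {r q : ℕ} (hr : 8 ≤ r) (hq : 8 ≤ q) (hB : 1 ≤ B)
    (h : σ.reg r * σ.reg q ≤ B) :
    Tri (· ≤ B) x (mulCmd r q) σ (6 * σ.reg q + 6)
      (fun σ' => σ'.reg r = σ.reg r * σ.reg q ∧ Fix (Scratch r) σ σ') := by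
  refine Tri.of_guard fun hg => ?_
  have hgq := hg q
  have hr' : r ≠ 0 ∧ r ≠ 1 ∧ r ≠ 3 ∧ r ≠ 4 ∧ r ≠ 5 := by omega
  have hq' : q ≠ 4 ∧ q ≠ 5 := by omega
  refine Tri.seq (Q := fun σ' => σ'.reg 4 = 0 ∧ σ'.reg 3 = σ.reg q ∧ σ'.reg r = σ.reg r ∧
    Fix (Scratch r) σ σ') (T₁ := 3) (T₂ := 6 * σ.reg q + 3) (Tri.blk ?_ le_rfl)
    (fun σ₁ ⟨h1, h2, h3, h4⟩ => ?_) (by omega)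
  · simp [BlkOk, Safe, eff, St.set_reg, hr', hq']
    refine ⟨hgq, ?_⟩
    exact (((Fix.refl _ σ).set (Or.inl (by omega))).set (Or.inl (by omega))).set (Or.inl (by omega))
  refine Tri.seq (Q := fun σ' => σ'.reg 4 = σ.reg r * σ.reg q ∧ Fix (Scratch r) σ σ')
    (T₁ := 6 * σ.reg q + 1) (T₂ := 2) ?_ (fun σ₂ ⟨k1, k2⟩ => Tri.blk ?_ le_rfl) (by omega)
  · refine Tri.loop_count (Nat.zero_le _) (T₁ := 3) (m := σ.reg q)
      (fun j σ' => j ≤ σ.reg q ∧ σ'.reg 3 = j ∧ σ'.reg r = σ.reg r ∧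
        σ'.reg 4 = σ.reg r * (σ.reg q - j) ∧ Fix (Scratch r) σ σ') (fun σ' h => h.2.1)
      (fun j σ' h => by omega) ?_ ⟨le_rfl, h2, h3, by simpa using h1, h4⟩ (by omega)
      (fun σ' h => ⟨by simpa using h.2.2.2.1, h.2.2.2.2⟩)
    intro j hj σ' ⟨l0, l1, l2, l3, l4⟩
    have e : σ.reg r * (σ.reg q - (j + 1)) + σ.reg r = σ.reg r * (σ.reg q - j) := by
      have : σ.reg q - j = σ.reg q - (j + 1) + 1 := by omega
      rw [this]; ring
    have e' : σ.reg r * (σ.reg q - j) ≤ B :=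
      (Nat.mul_le_mul_left _ (Nat.sub_le _ _)).trans h
    refine Tri.blk ?_ le_rfl
    simp [BlkOk, Safe, eff, St.set_reg, hr', l1, l2, l3, e, e']
    refine ⟨hB, by omega, by omega, ?_⟩
    exact (((l4.set (Or.inl (by omega))).set (Or.inl (by omega))).set (Or.inl (by omega))).set
      (Or.inl (by omega))
  · simp [BlkOk, Safe, eff, St.set_reg, k1]
    exact ⟨h, (k2.set (Or.inl (by omega))).set (Or.inr rfl)⟩

/-- Multiply register `r` by the `d`-th power of register `q`. -/
def mulPowCmd {s : ℕ} (r q : ℕ) : ℕ → Cmd s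
  | 0 => .blk []
  | d + 1 => .seq (mulCmd r q) (mulPowCmd r q d)

/-- Since the base is positive, the intermediate products are at most the final one, and a bound on
the latter suffices. The time is linear in the base because each multiplication is repeated
addition. -/
theorem mulPowCmd_spec {σ : St s} {r q d : ℕ} (hr : 8 ≤ r) (hq : 8 ≤ q) (hrq : r ≠ q) (hB : 1 ≤ B)
    (hq1 : 1 ≤ σ.reg q) (h : σ.reg r * σ.reg q ^ d ≤ B) :
    Tri (· ≤ B) x (mulPowCmd r q d) σ (d * (6 * σ.reg q + 6))
      (fun σ' => σ'.reg r = σ.reg r * σ.reg q ^ d ∧ Fix (Scratch r) σ σ') := by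
  induction d generalizing σ with
  | zero => exact Tri.blk ⟨by simp, Fix.refl _ _⟩ (by simp)
  | succ d ih =>
    have h' : σ.reg r * σ.reg q ≤ B := by
      refine le_trans (Nat.mul_le_mul_left _ ?_) h
      exact Nat.le_self_pow (by omega) _
    refine Tri.seq (mulCmd_spec hr hq hB h') (T₂ := d * (6 * σ.reg q + 6)) (fun σ' ⟨h1, h2⟩ => ?_)
      (le_of_eq (by ring))
    have e : σ'.reg q = σ.reg q := h2.2.2 q (by rintro (h | h) <;> omega)
    have := ih (σ := σ') (by omega) (by rw [h1, e, mul_assoc, ← pow_succ']; exact h)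
    rw [e, h1, mul_assoc, ← pow_succ'] at this
    exact this.mono le_rfl fun σ'' h => ⟨h.1, h2.trans h.2⟩

theorem fix_of_keeps {v : ℕ} {σ σ' σ'' : St s} (h : Fix (SimRegs v) σ σ') (h' : Keeps v σ' σ'') :
    Fix (SimRegs v) σ σ'' := by
  refine h.trans ⟨h'.1, h'.2.1, fun a ha => h'.2.2 a ?_ ?_ ?_⟩
  · by_contra hc; exact ha (Or.inl (by omega))
  · exact fun hc => ha (Or.inr (Or.inr (Or.inl hc)))
  · exact fun r hc => ha (Or.inr (Or.inr (Or.inr ⟨r, hc⟩)))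

/-- Simulation without output. -/
theorem simLoop_drop_spec {v : ℕ} (hv : v < 4) (P : Program s) {m : ℕ} {c : Cfg s} {σ : St s}
    (hpc : ∀ u ≤ m, ((step P x)^[u] c).pc + 1 ≤ B)
    (hreg : ∀ u ≤ m, ∀ r, vaddr v (((step P x)^[u] c).reg r) ≤ B)
    (hσ : SimRel v c σ) (h16 : σ.reg 16 = m) :
    Tri (· ≤ B) x (simLoop v (fun _ => .blk []) (.blk []) P) σ (m * (5 * P.length + 15) + 1)
      (fun σ' => SimRel v ((step P x)^[m] c) σ' ∧ Fix (SimRegs v) σ σ') :=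
  simLoop_spec (W := 0) (R := fun _ _ τ => Fix (SimRegs v) σ τ) hv P
    (fun _ _ _ _ h h' => fix_of_keeps h' h) (fun _ _ _ _ h => h.set (Or.inr (Or.inl rfl)))
    (fun _ _ _ _ _ _ _ h1 h2 => Tri.blk ⟨h1, h2, rfl⟩ le_rfl)
    (fun _ _ _ _ _ _ h1 h2 => Tri.blk ⟨h1, h2, rfl⟩ le_rfl) hpc hreg hσ (Fix.refl _ _) h16

/-- The content of the queue that stores the words `o` and the letters `b` of an unfinished word. -/
def queueCode (o : List (Word s)) (b : Word s) : List ℕ :=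
  o.flatMap (fun w => w.map (fun a => a.val + 1) ++ [0]) ++ b.map (fun a => a.val + 1)

/-- Letters are coded by positive numbers and `0` terminates a word, so each output instruction
appends exactly one symbol. -/
theorem queueCode_write (o : List (Word s)) (b : Word s) (a : Fin s) :
    queueCode o (b ++ [a]) = queueCode o b ++ [a.val + 1] := by
  simp [queueCode]

theorem queueCode_emit (o : List (Word s)) (b : Word s) :
    queueCode (o ++ [b]) [] = queueCode o b ++ [0] := by
  simp [queueCode]

/-- In the state `σ` the queue holds `o` and `b`, and the first `j` words have been output;
`S` and `i` are the contents of the registers for the step budget and the phase. -/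
def QueueInv (S i j : ℕ) (b : Word s) (o : List (Word s)) (σ : St s) : Prop :=
  σ.reg 25 = (queueCode o b).length ∧ (∀ q, σ.reg (vaddr 3 q) = (queueCode o b).getD q 0) ∧
    σ.reg 26 = (queueCode (o.take j) []).length ∧ σ.reg 24 + j = o.length ∧ σ.out = o.take j ∧
    σ.buf = [] ∧ σ.reg 21 = 1 ∧ σ.reg 22 = S ∧ σ.reg 23 = i ∧ σ.reg 27 = 0

/-- Besides the output, the invariant concerns only memory `3`, which holds the queue, and the
registers `21` to `27`: loop flag, step budget, phase, number of complete words waiting, write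
position, read position and mode. -/
theorem QueueInv.congr {S i j : ℕ} {b : Word s} {o : List (Word s)} {σ σ' : St s} {A : ℕ → Prop}
    (h : QueueInv S i j b o σ) (h' : Fix A σ σ') (hA : ∀ a, 21 ≤ a → a < 28 → ¬ A a)
    (hA' : ∀ q, ¬ A (vaddr 3 q)) : QueueInv S i j b o σ' := by
  obtain ⟨h1, h2, h3, h4, h5, h6, h7, h8, h9, h10⟩ := h
  refine ⟨?_, fun q => ?_, ?_, ?_, ?_, ?_, ?_, ?_, ?_, ?_⟩
  · rw [h'.2.2 25 (hA _ (by omega) (by omega)), h1]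
  · rw [h'.2.2 _ (hA' _), h2]
  · rw [h'.2.2 26 (hA _ (by omega) (by omega)), h3]
  · rw [h'.2.2 24 (hA _ (by omega) (by omega)), h4]
  · rw [h'.2.1, h5]
  · rw [h'.1, h6]
  · rw [h'.2.2 21 (hA _ (by omega) (by omega)), h7]
  · rw [h'.2.2 22 (hA _ (by omega) (by omega)), h8]
  · rw [h'.2.2 23 (hA _ (by omega) (by omega)), h9]
  · rw [h'.2.2 27 (hA _ (by omega) (by omega)), h10]

/-- Append `k` to the queue. -/
def pushCode {s : ℕ} (k : ℕ) : List (Instr s) :=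
  [.const 1 k, .add 2 25 25, .add 2 2 2, .const 3 67, .add 2 2 3, .store 2 1, .const 1 1,
    .add 25 25 1]

/-- The state after appending `k` to a queue of length `l`. -/
theorem pushCode_ok {k l : ℕ} {σ : St s} {Q : St s → Prop} (hl : σ.reg 25 = l) (hk : k ≤ B)
    (hB : vaddr 3 l ≤ B)
    (hQ : ∀ σ', σ'.buf = σ.buf → σ'.out = σ.out → (∀ a, 8 ≤ a → σ'.reg a =
      if a = 25 then l + 1 else if a = vaddr 3 l then k else σ.reg a) → Q σ') :
    BlkOk (· ≤ B) x (pushCode k) σ Q := by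
  have e : l + l + (l + l) + 67 = vaddr 3 l := by simp only [vaddr]; omega
  have hn : ∀ a, a < 64 → a ≠ vaddr 3 l := fun a ha => by simp only [vaddr]; omega
  simp only [pushCode, BlkOk, Safe, eff, St.set_reg, hl, e, hn 25 (by omega), if_true, if_false,
    Nat.reduceEqDiff]
  have hB' := hB
  simp only [vaddr] at hB'
  refine ⟨hk, by omega, by omega, by omega, hB, hk, by omega, by omega, hQ _ rfl rfl fun a ha => ?_⟩
  have h1 : a ≠ 1 := by omega
  have h2 : a ≠ 2 := by omega
  have h3 : a ≠ 3 := by omega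
  simp only [St.set_reg, h1, h2, h3, if_false]

/-- The command that stores a letter of the simulated machine. -/
def queueWrite (a : Fin s) : Cmd s := .blk (pushCode (a.val + 1))

/-- The command that stores an end of word of the simulated machine. -/
def queueEmit {s : ℕ} : Cmd s := .blk (pushCode 0 ++ [.const 1 1, .add 24 24 1])

theorem simRel_two_of_push {k l : ℕ} {c : Cfg s} {σ σ' : St s} (h : SimRel 2 c σ)
    (h' : ∀ a, 8 ≤ a → a ≠ 24 → σ'.reg a =
      if a = 25 then l + 1 else if a = vaddr 3 l then k else σ.reg a) : SimRel 2 c σ' := by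
  refine ⟨?_, fun r => ?_⟩
  · rw [h' _ (by omega) (by omega), if_neg (by omega), if_neg (by simp only [vaddr]; omega), h.1]
  · rw [h' _ (by simp only [vaddr]; omega) (by simp only [vaddr]; omega),
      if_neg (by simp only [vaddr]; omega), if_neg (by simp only [vaddr]; omega), h.2]

theorem getD_append_singleton (L : List ℕ) (k q : ℕ) :
    (L ++ [k]).getD q 0 = if q = L.length then k else L.getD q 0 := by
  rcases lt_trichotomy q L.length with h | h | h
  · rw [if_neg h.ne, List.getD_append _ _ _ _ h]
  · subst h; simp
  · rw [if_neg h.ne', List.getD_eq_default _ _ (by simp; omega), List.getD_eq_default _ _ h.le]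

theorem queueWrite_spec {S i j : ℕ} {c : Cfg s} {σ : St s} {a : Fin s}
    (hB : vaddr 3 (queueCode c.out c.buf).length ≤ B) (hs : s ≤ B)
    (h : SimRel 2 c σ) (hσ : QueueInv S i j c.buf c.out σ) :
    Tri (· ≤ B) x (queueWrite a) σ 10 (fun σ' => SimRel 2 c σ' ∧
      QueueInv S i j (c.buf ++ [a]) c.out σ' ∧ σ'.reg 16 = σ.reg 16) := by
  obtain ⟨h1, h2, h3, h4, h5, h6, h7, h8, h9, h10⟩ := hσ
  refine Tri.blk (pushCode_ok h1 (by omega) hB fun σ' k1 k2 k3 => ?_) (by simp [pushCode])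
  have hn : ∀ a, a < 64 → a ≠ vaddr 3 (queueCode c.out c.buf).length :=
    fun a ha => by simp only [vaddr]; omega
  have key : ∀ a, 8 ≤ a → a < 64 → a ≠ 25 → σ'.reg a = σ.reg a := fun a ha ha' h => by
    rw [k3 a ha, if_neg h, if_neg (hn a ha')]
  refine ⟨simRel_two_of_push h fun a ha _ => k3 a ha, ⟨?_, fun q => ?_, ?_, ?_, ?_, ?_, ?_, ?_, ?_,
    ?_⟩, key _ (by omega) (by omega) (by omega)⟩
  · rw [k3 _ (by omega), if_pos rfl, queueCode_write]; simp
  · rw [k3 _ (by simp only [vaddr]; omega), if_neg (by simp only [vaddr]; omega), queueCode_write,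
      getD_append_singleton, h2]
    simp only [vaddr_inj]
  · rw [key _ (by omega) (by omega) (by omega), h3]
  · rw [key _ (by omega) (by omega) (by omega), h4]
  · rw [k2, h5]
  · rw [k1, h6]
  · rw [key _ (by omega) (by omega) (by omega), h7]
  · rw [key _ (by omega) (by omega) (by omega), h8]
  · rw [key _ (by omega) (by omega) (by omega), h9]
  · rw [key _ (by omega) (by omega) (by omega), h10]

theorem length_le_queueCode (o : List (Word s)) (b : Word s) :
    o.length ≤ (queueCode o b).length := by
  induction o with
  | nil => simp
  | cons w o ih =>
    simp only [queueCode, List.flatMap_cons, List.length_append, List.length_cons] at ih ⊢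
    simp at ih ⊢
    omega

theorem queueEmit_spec {S i j : ℕ} {c : Cfg s} {σ : St s}
    (hB : vaddr 3 (queueCode c.out c.buf).length ≤ B)
    (h : SimRel 2 c σ) (hσ : QueueInv S i j c.buf c.out σ) :
    Tri (· ≤ B) x queueEmit σ 10 (fun σ' => SimRel 2 c σ' ∧
      QueueInv S i j [] (c.out ++ [c.buf]) σ' ∧ σ'.reg 16 = σ.reg 16) := by
  obtain ⟨h1, h2, h3, h4, h5, h6, h7, h8, h9, h10⟩ := hσ
  have hlen := length_le_queueCode c.out c.buf
  refine Tri.blk (BlkOk.append (pushCode_ok h1 (by omega) hB fun σ₁ k1 k2 k3 => ?_))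
    (by simp [pushCode])
  have hn : ∀ a, a < 64 → a ≠ vaddr 3 (queueCode c.out c.buf).length :=
    fun a ha => by simp only [vaddr]; omega
  have key : ∀ a, 8 ≤ a → a < 64 → a ≠ 25 → σ₁.reg a = σ.reg a := fun a ha ha' h => by
    rw [k3 a ha, if_neg h, if_neg (hn a ha')]
  have hl : (queueCode c.out c.buf).length + 1 ≤ B := by
    simp only [vaddr] at hB; omega
  have e24 := key 24 (by omega) (by omega) (by omega)
  have k3' : ∀ a, 8 ≤ a → a ≠ 24 → ((σ₁.set 1 1).set 24 (σ₁.reg 24 + 1)).reg a = σ₁.reg a := by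
    intro a h h'
    rw [St.set_reg, if_neg h', St.set_reg, if_neg (by omega)]
  simp only [BlkOk, Safe, eff, St.set_reg, if_true, if_false, Nat.reduceEqDiff]
  refine ⟨by omega, by omega, simRel_two_of_push h fun a ha h24 => (k3' a ha h24).trans (k3 a ha),
    ⟨?_, fun q => ?_, ?_, ?_, ?_, ?_, ?_, ?_, ?_, ?_⟩, ?_⟩
  · rw [k3' _ (by omega) (by omega), k3 _ (by omega), if_pos rfl, queueCode_emit]; simp
  · rw [k3' _ (by simp only [vaddr]; omega) (by simp only [vaddr]; omega),
      k3 _ (by simp only [vaddr]; omega), if_neg (by simp only [vaddr]; omega), queueCode_emit,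
      getD_append_singleton, h2]
    simp only [vaddr_inj]
  · rw [k3' _ (by omega) (by omega), key _ (by omega) (by omega) (by omega), h3,
      List.take_append_of_le_length (by omega)]
  · simp [St.set_reg, e24]; omega
  · rw [List.take_append_of_le_length (by omega), ← h5]; exact k2
  · rw [← h6]; exact k1
  · rw [k3' _ (by omega) (by omega), key _ (by omega) (by omega) (by omega), h7]
  · rw [k3' _ (by omega) (by omega), key _ (by omega) (by omega) (by omega), h8]
  · rw [k3' _ (by omega) (by omega), key _ (by omega) (by omega) (by omega), h9]
  · rw [k3' _ (by omega) (by omega), key _ (by omega) (by omega) (by omega), h10]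
  · simp [key 16 (by omega) (by omega) (by omega)]

end Commands

end EnumFPT

/-! ### Output of a queued word and the phases -/

namespace EnumFPT

section Output

variable {s : ℕ} {x : Word s} {B : ℕ}

/-- Write the letter whose code is in register `17`. -/
def writeSym {s : ℕ} : List (Fin s) → Cmd s
  | [] => .blk []
  | a :: as => .seq (.blk [.const 1 1, .sub 17 17 1]) (.ite 17 (.blk [.write a]) (writeSym as))

/-- A `write` instruction carries its letter as a constant, so the code `i + 1` is turned into the
letter at position `i` by counting down along the alphabet. -/
theorem writeSym_spec {L : List (Fin s)} {i : ℕ} {a : Fin s} {σ : St s} (hB : 1 ≤ B)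
    (ha : L[i]? = some a) (hσ : σ.reg 17 = i + 1) :
    Tri (· ≤ B) x (writeSym L) σ (5 * L.length) (fun σ' => σ'.buf = σ.buf ++ [a] ∧
      σ'.out = σ.out ∧ ∀ r, ¬ Scratch 17 r → σ'.reg r = σ.reg r) := by
  induction L generalizing i σ with
  | nil => simp at ha
  | cons b L ih =>
    refine Tri.of_guard fun hg => ?_
    have hg17 := hg 17
    rw [List.length_cons]
    refine Tri.seq (Q := fun σ' => σ'.reg 17 = i ∧ Fix (Scratch 17) σ σ') (T₁ := 2)
      (T₂ := 5 * L.length + 3) (Tri.blk ?_ le_rfl) (fun σ₁ ⟨h1, h2⟩ => ?_) (by omega)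
    · simp [BlkOk, Safe, eff, St.set_reg, hσ]
      exact ⟨by omega, by omega, ((Fix.refl _ σ).set (Or.inl (by omega))).set (Or.inr rfl)⟩
    cases i with
    | zero =>
      obtain rfl : b = a := by simpa using ha
      refine Tri.ite_zero h1 (T₁ := 1) (Tri.blk ⟨trivial, ?_⟩ le_rfl) (by omega)
      exact ⟨by simp [eff, h2.1], h2.2.1, fun r hr => h2.2.2 r hr⟩
    | succ i =>
      refine Tri.ite_pos (by omega) (by omega) ((ih (by simpa using ha) h1).mono le_rfl
        fun σ' h => ⟨?_, ?_, fun r hr => ?_⟩) (by omega)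
      · rw [St.set_buf, h.1, h2.1]
      · rw [St.set_out, h.2.1, h2.2.1]
      · rw [St.set_reg, if_neg (fun e => hr (Or.inl (by omega))), h.2.2 r hr, h2.2.2 r hr]

/-- Load the next symbol of the queue into register `17`. -/
def loadSym {s : ℕ} : List (Instr s) :=
  [.add 2 26 26, .add 2 2 2, .const 1 67, .add 2 2 1, .load 17 2, .const 1 1, .add 26 26 1]

/-- The registers changed when a word is output. -/
def OutRegs (a : ℕ) : Prop := a < 8 ∨ a = 17 ∨ a = 26

theorem not_outRegs_vaddr (q v : ℕ) : ¬ OutRegs (vaddr v q) := by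
  rintro (h | h | h) <;> simp only [vaddr] at h <;> omega

theorem loadSym_ok {σ : St s} {p : ℕ} {Q : St s → Prop} (hp : σ.reg 26 = p)
    (hB : vaddr 3 p ≤ B) (hg : ∀ r, σ.reg r ≤ B)
    (hQ : ∀ σ', Fix OutRegs σ σ' → σ'.reg 26 = p + 1 → σ'.reg 17 = σ.reg (vaddr 3 p) → Q σ') :
    BlkOk (· ≤ B) x loadSym σ Q := by
  have e : p + p + (p + p) + 67 = vaddr 3 p := by simp only [vaddr]; omega
  have hn : ∀ a, a < 64 → vaddr 3 p ≠ a := fun a ha => by simp only [vaddr]; omega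
  simp only [loadSym, BlkOk, Safe, eff, St.set_reg, hp, e, hn 1 (by omega), hn 2 (by omega),
    if_true, if_false, Nat.reduceEqDiff]
  have hB' := hB
  simp only [vaddr] at hB'
  refine ⟨by omega, by omega, by omega, hB, hg _, by omega, by omega, hQ _ ?_ ?_ ?_⟩
  · refine (((((((Fix.refl _ σ).set ?_).set ?_).set ?_).set ?_).set ?_).set ?_).set ?_ <;>
      simp [OutRegs]
  · simp [St.set_reg]
  · simp [St.set_reg]

/-- Output the next word of the queue. -/
def outWord {s : ℕ} : Cmd s :=
  .seq (.blk loadSym) (.seq (.loop 17 (.seq (writeSym (List.finRange s)) (.blk loadSym)))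
    (.blk [.emit]))

/-- The loop reads one symbol ahead: register `17` holds the symbol just before the read position.
It stops at the terminator, which is thereby consumed as well. -/
theorem outWord_spec {σ : St s} {p : ℕ} {w : Word s} (hp : σ.reg 26 = p)
    (hB : vaddr 3 (p + w.length) ≤ B) (hw : ∀ i (h : i < w.length),
      σ.reg (vaddr 3 (p + i)) = w[i].val + 1) (hw' : σ.reg (vaddr 3 (p + w.length)) = 0)
    (hbuf : σ.buf = []) :
    Tri (· ≤ B) x outWord σ (w.length * (5 * s + 10) + 9) (fun σ' => σ'.buf = [] ∧
      σ'.out = σ.out ++ [w] ∧ σ'.reg 26 = p + w.length + 1 ∧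
      ∀ a, ¬ OutRegs a → σ'.reg a = σ.reg a) := by
  have hB' := hB
  simp only [vaddr] at hB'
  refine Tri.of_guard fun hg => Tri.seq (Q := fun σ' => σ'.reg 26 = p + 1 ∧
    σ'.reg 17 = σ.reg (vaddr 3 p) ∧ Fix OutRegs σ σ') (T₁ := 7)
    (T₂ := w.length * (5 * s + 10) + 2) (Tri.blk (loadSym_ok hp (by simp only [vaddr]; omega) hg
      fun σ' h1 h2 h3 => ⟨h2, h3, h1⟩) le_rfl) (fun σ₁ ⟨h1, h2, h3⟩ => ?_) (by omega)
  refine Tri.seq (Q := fun σ' => σ'.buf = w ∧ σ'.out = σ.out ∧ σ'.reg 26 = p + w.length + 1 ∧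
      ∀ a, ¬ OutRegs a → σ'.reg a = σ.reg a) (T₁ := w.length * (5 * s + 10) + 1) (T₂ := 1) ?_
    (fun σ₂ ⟨k1, k2, k3, k4⟩ => Tri.blk ⟨trivial, ?_⟩ le_rfl) (by omega)
  · refine Tri.loop_count (Nat.zero_le _) (T₁ := 5 * s + 7) (m := w.length)
      (fun j σ' => j ≤ w.length ∧ σ'.reg 26 = p + (w.length - j) + 1 ∧
        σ'.reg 17 = σ.reg (vaddr 3 (p + (w.length - j))) ∧ σ'.buf = w.take (w.length - j) ∧
        σ'.out = σ.out ∧ ∀ a, ¬ OutRegs a → σ'.reg a = σ.reg a) ?_ ?_ ?_ ?_ le_rfl ?_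
    · intro σ' h
      rw [h.2.2.1, Nat.sub_zero, hw']
    · intro j σ' h
      rw [h.2.2.1, hw _ (by omega)]; omega
    · intro j hj σ' ⟨_, k1, k2, k3, k4, k5⟩
      obtain ⟨i, hi⟩ : ∃ i, i = w.length - (j + 1) := ⟨_, rfl⟩
      have hi' : w.length - j = i + 1 := by omega
      have hil : i < w.length := by omega
      rw [← hi] at k1 k2 k3
      rw [hw i hil] at k2
      refine Tri.seq (T₁ := 5 * s) (T₂ := 7) ((writeSym_spec (by omega) (a := w[i]) (by simp)
        k2).mono (by simp) fun _ h => h) (fun σ₂ ⟨l1, l2, l3⟩ => Tri.of_guard fun hg' => Tri.blk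
        (loadSym_ok (p := p + i + 1) ?_ ?_ hg' fun σ₃ m1 m2 m3 => ?_) le_rfl) (by omega)
      · rw [l3 26 (by simp [Scratch]), k1]
      · simp only [vaddr]; omega
      · rw [hi']
        refine ⟨by omega, ?_, ?_, ?_, ?_, fun a ha => ?_⟩
        · rw [St.set_reg, if_neg (by omega), m2]; omega
        · have hv : ∀ q, ¬ Scratch 17 (vaddr 3 q) := fun q h =>
            not_outRegs_vaddr q 3 (h.imp_right Or.inl)
          rw [St.set_reg, if_neg (by omega), m3, l3 _ (hv _), k5 _ (not_outRegs_vaddr _ _)]; rfl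
        · rw [St.set_buf, m1.1, l1, k3, List.take_append_getElem]
        · rw [St.set_out, m1.2.1, l2, k4]
        · rw [St.set_reg, if_neg (fun e => ha (Or.inl (by omega))), m1.2.2 a ha,
            l3 a (fun h => ha (h.imp_right Or.inl)), k5 a ha]
    · simp [h1, h2, h3.1, hbuf, h3.2.1]
      exact h3.2.2
    · intro σ' ⟨_, k1, k2, k3, k4, k5⟩
      exact ⟨by simpa using k3, k4, by simpa using k1, k5⟩
  · exact ⟨rfl, by simp [eff, k1, k2], k3, k4⟩

theorem queueCode_split {o : List (Word s)} {b : Word s} {j : ℕ} (hj : j < o.length) :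
    ∃ L, queueCode o b = queueCode (o.take j) [] ++ (o[j].map (fun a => a.val + 1) ++ 0 :: L) := by
  have e : o = o.take j ++ o[j] :: o.drop (j + 1) := by simp
  have h : ∀ (o₁ o₂ : List (Word s)) w, queueCode (o₁ ++ w :: o₂) b =
      queueCode o₁ [] ++ (w.map (fun a => a.val + 1) ++ 0 :: queueCode o₂ b) := by
    simp [queueCode]
  exact ⟨queueCode (o.drop (j + 1)) b, (congrArg (queueCode · b) e).trans (h _ _ _)⟩

/-- The place of the word number `j` depends only on the words before it, so the read position stays
valid while `P` appends further symbols. -/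
theorem queueCode_getD {o : List (Word s)} {b : Word s} {j : ℕ} (hj : j < o.length) :
    (∀ i (h : i < o[j].length), (queueCode o b).getD ((queueCode (o.take j) []).length + i) 0 =
      o[j][i].val + 1) ∧
    (queueCode o b).getD ((queueCode (o.take j) []).length + o[j].length) 0 = 0 ∧
    (queueCode (o.take j) []).length + o[j].length ≤ (queueCode o b).length ∧
    (queueCode (o.take (j + 1)) []).length = (queueCode (o.take j) []).length + o[j].length + 1 := by
  obtain ⟨L, hL⟩ := queueCode_split (b := b) hj
  refine ⟨fun i h => ?_, ?_, ?_, ?_⟩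
  · rw [hL, List.getD_append_right _ _ _ _ (by omega), Nat.add_sub_cancel_left,
      List.getD_append _ _ _ _ (by simpa using h)]
    simp [h]
  · rw [hL, List.getD_append_right _ _ _ _ (by omega), Nat.add_sub_cancel_left,
      List.getD_append_right _ _ _ _ (by simp)]
    simp
  · rw [hL]; simp
  · rw [← List.take_append_getElem hj, queueCode_emit]
    simp [queueCode]; omega

/-- A step appends at most one symbol. This bounds the queue addresses by the number of simulated
steps. -/
theorem queueCode_run_length (P : Program s) (x : Word s) (m : ℕ) :
    (queueCode (run P x m).out (run P x m).buf).length ≤ m := by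
  induction m with
  | zero => simp [run, initCfg, queueCode]
  | succ m ih =>
    have e : run P x (m + 1) = step P x (run P x m) := Function.iterate_succ_apply' _ _ _
    rw [e, step]
    cases P[(run P x m).pc]? with
    | none => exact ih.trans (Nat.le_succ _)
    | some I =>
      cases I
      case write a => simp only [exec, queueCode_write, List.length_append, List.length_singleton]; omega
      case emit => simp only [exec, queueCode_emit, List.length_append, List.length_singleton]; omega
      all_goals exact ih.trans (Nat.le_succ _)

/-- One phase: simulate `P` for a number of steps and output the next word of the queue. -/
def phaseCmd (b : ℕ) (P : Program s) : Cmd s :=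
  .seq (.blk [.const 1 1, .add 23 23 1, .const 1 0, .add 16 22 1])
    (.seq (mulPowCmd 16 23 b) (.seq (simLoop 2 queueWrite queueEmit P)
      (.ite 24 (.blk [.const 21 0]) (.seq (.blk [.const 1 1, .sub 24 24 1]) outWord))))

/-- The state before the phase `j + 1`, when `m` steps of `P` have been simulated. -/
def RoundInv (P : Program s) (x : Word s) (S j m : ℕ) (σ : St s) : Prop :=
  SimRel 2 (run P x m) σ ∧ QueueInv S j j (run P x m).buf (run P x m).out σ

theorem run_add (P : Program s) (x : Word s) (m u : ℕ) :
    (step P x)^[u] (run P x m) = run P x (m + u) := by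
  rw [run, run, add_comm, Function.iterate_add_apply]

/-- Either a complete word is waiting after the simulation and is released, or all words found so
far have been released, and register `21` is cleared to leave the main loop. The halting of `P` is
never tested here. The assignment `σ'.set 0 0` anticipates the jump back to the loop head. -/
theorem phaseCmd_spec {P : Program s} {b S j m m' : ℕ} {σ : St s} (hs : s ≤ B) (hj : j + 1 ≤ B)
    (hm' : m' = m + S * (j + 1) ^ b) (hfuel : S * (j + 1) ^ b ≤ B) (hq : vaddr 3 m' ≤ B)
    (hpc : ∀ u, (run P x u).pc + 1 ≤ B) (hreg : ∀ u r, vaddr 2 ((run P x u).reg r) ≤ B)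
    (hσ : RoundInv P x S j m σ) {W : ℕ}
    (hW : ∀ w ∈ (run P x m').out, w.length ≤ W) :
    Tri (· ≤ B) x (phaseCmd b P) σ
      (b * (6 * (j + 1) + 6) + S * (j + 1) ^ b * (5 * P.length + 25) + W * (5 * s + 10) + 19)
      (fun σ' => (j < (run P x m').out.length → RoundInv P x S (j + 1) m' (σ'.set 0 0)) ∧
        ((run P x m').out.length ≤ j → (σ'.set 0 0).reg 21 = 0 ∧ σ'.out = (run P x m').out)) := by
  have hB : 1 ≤ B := by omega
  refine Tri.of_guard fun hg => ?_
  have hSB : S ≤ B := by have := hg 22; simpa [hσ.2.2.2.2.2.2.2.2.1] using this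
  have hqB : m' + 67 ≤ B := by simp only [vaddr] at hq; omega
  refine Tri.seq (Q := fun σ' => σ'.reg 23 = j + 1 ∧ σ'.reg 16 = S ∧ SimRel 2 (run P x m) σ' ∧
    QueueInv S (j + 1) j (run P x m).buf (run P x m).out σ') (T₁ := 4) (Tri.blk ?_ le_rfl)
    (fun σ₁ ⟨h1, h2, h3, h4⟩ => Tri.seq
    (Q := fun σ' => σ'.reg 16 = S * (j + 1) ^ b ∧ SimRel 2 (run P x m) σ' ∧
      QueueInv S (j + 1) j (run P x m).buf (run P x m).out σ')
    (T₁ := b * (6 * (j + 1) + 6))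
    (T₂ := S * (j + 1) ^ b * (5 * P.length + 25) + W * (5 * s + 10) + 15)
    ?_ (fun σ₂ ⟨k1, k2, k3⟩ => Tri.seq (T₁ := S * (j + 1) ^ b * (5 * P.length + 25) + 1)
    (T₂ := W * (5 * s + 10) + 14)
    (Q := fun σ' => SimRel 2 (run P x m') σ' ∧
      QueueInv S (j + 1) j (run P x m').buf (run P x m').out σ')
    ?_ (fun σ₃ ⟨l1, l2⟩ => ?_) (by omega)) le_rfl) (by omega)
  · obtain ⟨hs1, q1, q2, q3, q4, q5, q6, q7, q8, q9, q10⟩ := hσ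
    simp only [BlkOk, Safe, eff, St.set_reg, q9, q8, if_true, if_false, Nat.reduceEqDiff,
      Nat.add_zero]
    refine ⟨hB, hj, Nat.zero_le _, hSB, trivial, trivial, ?_, ?_⟩
    · exact (((hs1.set (by omega) (by omega)).set (by omega) (by omega)).set (by omega)
        (by omega)).set (by omega) (by omega)
    · refine ⟨?_, fun q => ?_, ?_, ?_, q5, q6, ?_, ?_, ?_, ?_⟩
      · simp [St.set_reg, q1]
      · have hn : ∀ a, a < 64 → vaddr 3 q ≠ a := fun a ha => by simp only [vaddr]; omega
        simp only [St.set_reg, hn 1 (by omega), hn 23 (by omega), hn 16 (by omega), if_false, q2]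
      · simp [St.set_reg, q3]
      · simp [St.set_reg, q4]
      · simp [St.set_reg, q7]
      · simp [St.set_reg, q8]
      · simp [St.set_reg]
      · simp [St.set_reg, q10]
  · have := mulPowCmd_spec (x := x) (B := B) (σ := σ₁) (r := 16) (q := 23) (d := b) (by omega) (by omega) (by omega) hB
      (by omega) (by rw [h1, h2]; exact hfuel)
    rw [h1, h2] at this
    refine this.mono le_rfl fun σ' ⟨e1, e2⟩ => ⟨e1, ?_, ?_⟩
    · refine ⟨by rw [e2.2.2 _ (by rintro (h | h) <;> omega), h3.1], fun r => ?_⟩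
      rw [e2.2.2 _ (by rintro (h | h) <;> simp only [vaddr] at h <;> omega), h3.2]
    · exact h4.congr e2 (fun a _ _ h => by rcases h with h | h <;> omega)
        (fun q h => by rcases h with h | h <;> simp only [vaddr] at h <;> omega)
  · have hK : ∀ u < S * (j + 1) ^ b,
        vaddr 3 (queueCode (run P x (m + u)).out (run P x (m + u)).buf).length ≤ B := by
      intro u hu
      refine le_trans ?_ hq
      have := queueCode_run_length P x (m + u)
      simp only [vaddr]; omega
    have := simLoop_spec (x := x) (B := B) (W := 10) (v := 2) (wr := queueWrite) (em := queueEmit)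
      (c := run P x m) (σ := σ₂) (m := S * (j + 1) ^ b)
      (R := fun b o τ => QueueInv S (j + 1) j b o τ) (by omega) P
      (fun b o τ τ' h h' => h'.congr (fix_of_keeps (Fix.refl _ _) h)
        (fun a ha ha' => not_simRegs (by omega) (by omega) (by omega) (by omega) (by omega))
        (fun q => not_simRegs_vaddr (by omega) (by omega) (by omega)))
      (fun b o τ k h => h.congr ((Fix.refl (· = 16) τ).set rfl) (fun a ha ha' => by omega)
        (fun q => by simp only [vaddr]; omega))
      (fun u hu c' hc a _ τ h h' => by
        rw [run_add] at hc
        subst hc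
        exact queueWrite_spec (hK u hu) hs h h')
      (fun u hu c' hc _ τ h h' => by
        rw [run_add] at hc
        subst hc
        exact queueEmit_spec (hK u hu) h h')
      (fun u _ => by rw [run_add]; exact hpc _) (fun u _ r => by rw [run_add]; exact hreg _ r)
      k2 k3 k1
    rw [run_add, ← hm'] at this
    exact this.mono (by rw [add_assoc]) fun _ h => h
  · have q24 := l2.2.2.2.1
    by_cases hlen : j < (run P x m').out.length
    · obtain ⟨g1, g2, g3, g4⟩ := queueCode_getD (b := (run P x m').buf) hlen
      have hwl : (run P x m').out[j].length ≤ W := hW _ (List.getElem_mem hlen)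
      have hwl' := Nat.mul_le_mul_right (5 * s + 10) hwl
      obtain ⟨q1, q2, q3, q4, q5, q6, q7, q8, q9, q10⟩ := l2
      refine Tri.ite_pos (Nat.zero_le _) (by omega)
        (T₁ := 2 + ((run P x m').out[j].length * (5 * s + 10) + 9)) (Tri.seq
        (Q := fun σ' => σ'.reg 24 + (j + 1) = (run P x m').out.length ∧ Fix (Scratch 24) σ₃ σ')
        (T₁ := 2) (Tri.blk ?_ le_rfl) (fun σ₄ ⟨a1, a2⟩ =>
        (outWord_spec (p := (queueCode ((run P x m').out.take j) []).length)
        (w := (run P x m').out[j]) ?_ ?_ ?_ ?_ ?_).mono le_rfl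
        fun σ₅ ⟨b1, b2, b3, b4⟩ => ⟨fun _ => ?_, fun hh => by omega⟩) le_rfl) (by omega)
      · simp only [BlkOk, Safe, eff, St.set_reg, if_true, if_false, Nat.reduceEqDiff]
        have := length_le_queueCode (run P x m').out (run P x m').buf
        have := queueCode_run_length P x m'
        exact ⟨hB, by omega, by omega, ((Fix.refl _ σ₃).set (Or.inl (by omega))).set (Or.inr rfl)⟩
      · rw [a2.2.2 26 (by simp [Scratch]), q3]
      · refine le_trans ?_ hq
        have := queueCode_run_length P x m'
        simp only [vaddr]; omega
      · intro i h
        rw [a2.2.2 _ (by simp only [Scratch, vaddr]; omega), q2, g1 i h]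
      · rw [a2.2.2 _ (by simp only [Scratch, vaddr]; omega), q2, g2]
      · rw [a2.1, q6]
      · have key : ∀ a, 8 ≤ a → a ≠ 17 → a ≠ 24 → a ≠ 26 →
            ((σ₅.set 0 0).set 0 0).reg a = σ₃.reg a := by
          intro a h8 h17 h24 h26
          rw [St.set_reg, if_neg (by omega), St.set_reg, if_neg (by omega),
            b4 a (by simp only [OutRegs]; omega), a2.2.2 a (by simp only [Scratch]; omega)]
        refine ⟨⟨?_, fun r => ?_⟩, ?_, fun q => ?_, ?_, ?_, ?_, b1, ?_, ?_, ?_, ?_⟩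
        · rw [key _ (by omega) (by omega) (by omega) (by omega), l1.1]
        · rw [key _ (by simp only [vaddr]; omega) (by simp only [vaddr]; omega)
            (by simp only [vaddr]; omega) (by simp only [vaddr]; omega), l1.2]
        · rw [key _ (by omega) (by omega) (by omega) (by omega), q1]
        · rw [key _ (by simp only [vaddr]; omega) (by simp only [vaddr]; omega)
            (by simp only [vaddr]; omega) (by simp only [vaddr]; omega), q2]
        · rw [St.set_reg, if_neg (by omega), St.set_reg, if_neg (by omega), b3, g4]
        · rw [St.set_reg, if_neg (by omega), St.set_reg, if_neg (by omega),
            b4 24 (by simp [OutRegs]), a1]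
        · rw [St.set_out, St.set_out, b2, a2.2.1, q5, List.take_append_getElem]
        · rw [key _ (by omega) (by omega) (by omega) (by omega), q7]
        · rw [key _ (by omega) (by omega) (by omega) (by omega), q8]
        · rw [key _ (by omega) (by omega) (by omega) (by omega), q9]
        · rw [key _ (by omega) (by omega) (by omega) (by omega), q10]
    · refine Tri.ite_zero (by omega) (T₁ := 1) (Tri.blk ⟨Nat.zero_le _, fun h => absurd h hlen,
        fun _ => ⟨by simp [eff, St.set_reg], ?_⟩⟩ le_rfl) (by omega)
      have q5 := l2.2.2.2.2.1
      rw [List.take_of_length_le (by omega)] at q5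
      exact q5

end Output

end EnumFPT

/-! ### Direct simulation and initialisation -/

namespace EnumFPT

section Main

variable {s : ℕ} {x : Word s} {B : ℕ}

/-- Register `17` becomes zero if and only if the machine `P`, simulated on the virtual machine `2`,
has halted. -/
def haltTest (P : Program s) : List (Instr s) := [.const 1 P.length, .sub 17 1 10]

/-- Simulate `P` until it halts. -/
def directCmd (P : Program s) : Cmd s :=
  .seq (.blk (haltTest P)) (.seq (.loop 17 (.seq
    (simStep 2 (fun a => .blk [.write a]) (.blk [.emit]) P) (.blk (haltTest P)))) (.blk [.const 21 0]))

theorem haltTest_ok {P : Program s} {σ : St s} {Q : St s → Prop} {c : Cfg s} (hP : P.length ≤ B)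
    (hσ : SimRel 2 c σ) (hQ : ∀ σ', SimRel 2 c σ' → σ'.buf = σ.buf → σ'.out = σ.out →
      σ'.reg 17 = P.length - c.pc → Q σ') : BlkOk (· ≤ B) x (haltTest P) σ Q := by
  have e := hσ.1
  norm_num at e
  simp only [haltTest, BlkOk, Safe, eff, St.set_reg, if_true, if_false, Nat.reduceEqDiff, e]
  exact ⟨hP, by omega, hQ _ ((hσ.set (by omega) (by omega)).set (by omega) (by omega)) rfl rfl
    (by simp [St.set_reg])⟩

theorem directCmd_spec {P : Program s} {h : ℕ} {σ : St s} (hP : P.length ≤ B)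
    (hpc : ∀ u, (run P x u).pc + 1 ≤ B) (hreg : ∀ u r, vaddr 2 ((run P x u).reg r) ≤ B)
    (hσ : SimRel 2 (initCfg s) σ) (hbuf : σ.buf = []) (hout : σ.out = []) (hh : HaltedAt P x h) :
    Tri (· ≤ B) x (directCmd P) σ (h * (5 * P.length + 16) + 4)
      (fun σ' => σ'.out = (run P x h).out ∧ σ'.reg 21 = 0) := by
  classical
  have hex : ∃ m, HaltedAt P x m := ⟨h, hh⟩
  -- The loop makes exactly as many rounds as the least halting time: the halt test must fail in all
  -- rounds before.
  obtain ⟨g, hg⟩ : ∃ g, g = Nat.find hex := ⟨_, rfl⟩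
  have hg1 : HaltedAt P x g := hg ▸ Nat.find_spec hex
  have hg2 : ∀ u < g, ¬ HaltedAt P x u := fun u hu => Nat.find_min hex (hg ▸ hu)
  have hgh : g ≤ h := hg ▸ Nat.find_min' hex hh
  rw [hg1.run_eq hgh]
  have hT := Nat.mul_le_mul_right (5 * P.length + 16) hgh
  refine Tri.seq (T₁ := 2) (T₂ := g * (5 * P.length + 16) + 2)
    (Q := fun σ' => SimRel 2 (run P x 0) σ' ∧ σ'.buf = (run P x 0).buf ∧
      σ'.out = (run P x 0).out ∧ σ'.reg 17 = P.length - (run P x 0).pc)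
    (Tri.blk (haltTest_ok hP hσ fun σ' h1 h2 h3 h4 => ⟨h1, h2.trans hbuf, h3.trans hout, h4⟩)
    le_rfl) (fun σ₁ h₁ => Tri.seq (T₁ := g * (5 * P.length + 16) + 1) (T₂ := 1)
    (Q := fun σ' => σ'.out = (run P x g).out) ?_
    (fun σ₂ h => Tri.blk ⟨Nat.zero_le _, h, by simp [eff, St.set_reg]⟩ le_rfl) (by omega)) (by omega)
  refine Tri.loop_count (Nat.zero_le _) (T₁ := 5 * P.length + 13) (m := g)
    (fun j σ' => j ≤ g ∧ SimRel 2 (run P x (g - j)) σ' ∧ σ'.buf = (run P x (g - j)).buf ∧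
      σ'.out = (run P x (g - j)).out ∧ σ'.reg 17 = P.length - (run P x (g - j)).pc)
    (fun σ' h => ?_) (fun j σ' h => ?_) ?_ ?_ le_rfl (fun σ' h => h.2.2.2.1)
  · rw [h.2.2.2.2]
    exact Nat.sub_eq_zero_of_le hg1
  · have := hg2 (g - (j + 1)) (by omega)
    rw [HaltedAt] at this
    omega
  · intro j hj σ' ⟨_, k1, k2, k3, _⟩
    have hu : g - j = g - (j + 1) + 1 := by omega
    have e : run P x (g - j) = step P x (run P x (g - (j + 1))) := by
      rw [hu]; exact Function.iterate_succ_apply' _ _ _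
    have := simStep_spec (x := x) (B := B) (W := 1) (v := 2) (wr := fun a => .blk [.write a])
      (em := .blk [.emit]) (c := run P x (g - (j + 1))) (σ := σ')
      (R := fun b o τ => τ.buf = b ∧ τ.out = o) (by omega) P
      (fun b o τ τ' h h' => ⟨h.1.trans h'.1, h.2.1.trans h'.2⟩)
      (fun a _ τ h h' => Tri.blk ⟨trivial, h, by simp [eff, h'.1], by simp [eff, h'.2]⟩ le_rfl)
      (fun _ τ h h' => Tri.blk ⟨trivial, h, by simp [eff], by simp [eff, h'.1, h'.2]⟩ le_rfl)
      (hpc _) (hreg _) (by rw [← e]; exact le_trans (Nat.le_succ _) (hpc _))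
      (fun r => by
        rw [← e]
        have := hreg (g - j) r
        simp only [vaddr] at this
        omega) k1 ⟨k2, k3⟩
    rw [← e] at this
    refine Tri.seq this (T₂ := 2) (fun σ₂ ⟨l1, l2, l3⟩ => Tri.blk (haltTest_ok hP l1
      fun σ₃ m1 m2 m3 m4 => ⟨by omega, m1.set (by omega) (by omega), m2.trans l2, m3.trans l3, ?_⟩)
      le_rfl) (by omega)
    rw [St.set_reg, if_neg (by omega), m4]
  · rw [Nat.sub_self]
    exact ⟨le_rfl, h₁⟩

/-- The program `M` for the empty input: it never reads a letter. -/
def noRead (M : Program s) : Program s :=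
  M.map fun I => match I with
    | .read d _ => .const d 0
    | I => I

/-- `M` is specified on the empty input, where every read yields `0`, but the simulating machine has
input `x`. -/
theorem step_noRead (M : Program s) (x : Word s) : step (noRead M) x = step M [] := by
  funext c
  simp only [step, noRead, List.getElem?_map]
  cases M[c.pc]? with
  | none => rfl
  | some I => cases I <;> rfl

/-- The initialisation: run `K` on the input and then `M`, for a bounded number of steps, on the
result; compute the step budget. -/
def initCmd (K M : Program s) (C d A : ℕ) : Cmd s :=
  .seq lenCmd (.seq (.blk [.const 16 C]) (.seq (mulPowCmd 16 20 d)
    (.seq (simLoop 0 (fun _ => .blk []) (.blk []) K)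
    (.seq (.blk [.const 1 0, .add (vaddr 1 1) (vaddr 0 0) 1, .const 1 1, .sub 16 20 1])
    (.seq (simLoop 1 (fun _ => .blk []) (.blk []) (noRead M))
    (.seq (.blk [.const 1 M.length, .sub 27 1 9, .const 1 0, .add 22 (vaddr 1 1) 1, .const 28 A,
      .const 21 1])
    (.seq (mulPowCmd 22 20 d) (mulCmd 22 28))))))))

/-- The registers changed by the initialisation. -/
def InitRegs (a : ℕ) : Prop :=
  (a < 23 ∧ a ≠ 10) ∨ a = 27 ∨ a = 28 ∨ ∃ r, a = vaddr 0 r ∨ a = vaddr 1 r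

/-- The state with all registers zero. -/
def zeroSt (s : ℕ) : St s := ⟨fun _ => 0, [], []⟩

/-- `K` gets enough steps to finish, whereas `M` is cut off after `n` steps, so the time does not
depend on `t`. Register `27` is zero exactly if `M` has halted; only then is the budget in register
`22` meaningful. Memories `2` and `3` and the program counter in register `10` remain zero, ready
for `P` and the queue. -/
theorem initCmd_spec {K M : Program s} {C d A k n : ℕ} (hn : n = x.length) (hs : s ≤ B)
    (hx : n + 1 ≤ B) (hC : C * (n + 1) ^ d ≤ B)
    (hKpc : ∀ u ≤ C * (n + 1) ^ d, (run K x u).pc + 1 ≤ B)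
    (hKreg : ∀ u ≤ C * (n + 1) ^ d, ∀ r, vaddr 0 ((run K x u).reg r) ≤ B)
    (hk : (run K x (C * (n + 1) ^ d)).reg 0 = k)
    (hMpc : ∀ u ≤ n, ((step M [])^[u] (argCfg s k)).pc + 1 ≤ B)
    (hMreg : ∀ u ≤ n, ∀ r, vaddr 1 (((step M [])^[u] (argCfg s k)).reg r) ≤ B)
    (hM : M.length ≤ B) (hA : A ≤ B)
    (hS : ((step M [])^[n] (argCfg s k)).reg 1 * (n + 1) ^ d ≤ B)
    (hS' : ((step M [])^[n] (argCfg s k)).reg 1 * (n + 1) ^ d * A ≤ B) :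
    Tri (· ≤ B) x (initCmd K M C d A) (zeroSt s)
      (2 * (d * (6 * (n + 1) + 6)) + C * (n + 1) ^ d * (5 * K.length + 15) +
        n * (5 * M.length + 20) + 6 * A + 24)
      (fun σ' => Fix InitRegs (zeroSt s) σ' ∧ σ'.reg 21 = 1 ∧
        σ'.reg 27 = M.length - ((step M [])^[n] (argCfg s k)).pc ∧
        σ'.reg 22 = ((step M [])^[n] (argCfg s k)).reg 1 * (n + 1) ^ d * A) := by
  have hB : 1 ≤ B := by omega
  have hCB : C ≤ B := le_trans (Nat.le_mul_of_pos_right _ (by positivity)) hC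
  have hkB : vaddr 0 k ≤ B := by rw [← hk]; exact hKreg _ le_rfl 0
  have hkB' : k ≤ B := by simp only [vaddr] at hkB; omega
  have hE : ∀ {σ : St s} {a : ℕ}, Fix (fun a => a < 8 ∨ a = 16 ∨ a = 20) (zeroSt s) σ →
      8 ≤ a → a ≠ 16 → a ≠ 20 → σ.reg a = 0 := fun h h1 h2 h3 => h.2.2 _ (by omega)
  refine Tri.seq (Q := fun σ' => σ'.reg 20 = n + 1 ∧
      Fix (fun a => a < 8 ∨ a = 16 ∨ a = 20) (zeroSt s) σ') (T₁ := 5 * n + 5)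
    (T₂ := 2 * (d * (6 * (n + 1) + 6)) + C * (n + 1) ^ d * (5 * K.length + 15) +
      n * (5 * M.length + 15) + 6 * A + 19) ?_ (fun σ₁ ⟨a1, a2⟩ => ?_) (by linarith)
  · subst hn
    exact (lenCmd_spec rfl hs hx).mono le_rfl fun σ' h =>
      ⟨h.1, h.2.mono fun a ha => ha.imp_right Or.inr⟩
  refine Tri.seq (Q := fun σ' => σ'.reg 16 = C ∧ σ'.reg 20 = n + 1 ∧
      Fix (fun a => a < 8 ∨ a = 16 ∨ a = 20) (zeroSt s) σ') (T₁ := 1)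
    (T₂ := 2 * (d * (6 * (n + 1) + 6)) + C * (n + 1) ^ d * (5 * K.length + 15) +
        n * (5 * M.length + 15) + 6 * A + 18)
    (Tri.blk ⟨hCB, by simp [eff, St.set_reg], by simp [eff, St.set_reg, a1],
      a2.set (by simp)⟩ le_rfl) (fun σ₂ ⟨b1, b2, b3⟩ => ?_) (by omega)
  refine Tri.seq (Q := fun σ' => σ'.reg 16 = C * (n + 1) ^ d ∧ σ'.reg 20 = n + 1 ∧
      Fix (fun a => a < 8 ∨ a = 16 ∨ a = 20) (zeroSt s) σ') (T₁ := d * (6 * (n + 1) + 6))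
    (T₂ := d * (6 * (n + 1) + 6) + C * (n + 1) ^ d * (5 * K.length + 15) +
        n * (5 * M.length + 15) + 6 * A + 18) ?_ (fun σ₃ ⟨c1, c2, c3⟩ => ?_) (by omega)
  · have hmul := mulPowCmd_spec (x := x) (B := B) (σ := σ₂) (r := 16) (q := 20) (d := d) (by omega)
      (by omega) (by omega) hB (by omega) (by rw [b1, b2]; exact hC)
    rw [b1, b2] at hmul
    exact hmul.mono le_rfl fun σ' h => ⟨h.1, by rw [h.2.2.2 20 (by simp [Scratch]), b2],
      b3.trans (h.2.mono fun a ha => ha.imp_right Or.inl)⟩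
  have hK : SimRel 0 (initCfg s) σ₃ := ⟨hE c3 (by omega) (by omega) (by omega), fun r =>
    hE c3 (by simp only [vaddr]; omega) (by simp only [vaddr]; omega)
      (by simp only [vaddr]; omega)⟩
  refine Tri.seq (Q := fun σ' => SimRel 0 (run K x (C * (n + 1) ^ d)) σ' ∧ σ'.reg 20 = n + 1 ∧
      Fix (fun a => a < 9 ∨ a = 16 ∨ a = 20 ∨ ∃ r, a = vaddr 0 r) (zeroSt s) σ')
    (T₁ := C * (n + 1) ^ d * (5 * K.length + 15) + 1)
    (T₂ := d * (6 * (n + 1) + 6) + n * (5 * M.length + 15) + 6 * A + 17)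
    ((simLoop_drop_spec (by omega) K hKpc hKreg hK c1).mono le_rfl fun σ' h => ⟨h.1, ?_, ?_⟩)
    (fun σ₄ ⟨d1, d2, d3⟩ => ?_) (by omega)
  · rw [h.2.2.2 20 (not_simRegs (by omega) (by omega) (by omega) (by omega) (by omega)), c2]
  · refine (c3.mono fun a ha => ?_).trans (h.2.mono fun a ha => ?_)
    · omega
    · rcases ha with ha | ha | ha | ha
      · exact Or.inl (by omega)
      · exact Or.inr (Or.inl ha)
      · exact Or.inl (by omega)
      · exact Or.inr (Or.inr (Or.inr ha))
  have hd3 : Fix InitRegs (zeroSt s) σ₄ := d3.mono fun a ha => by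
    rcases ha with ha | ha | ha | ⟨r, ha⟩
    · exact Or.inl (by omega)
    · exact Or.inl (by omega)
    · exact Or.inl (by omega)
    · exact Or.inr (Or.inr (Or.inr ⟨r, Or.inl ha⟩))
  have hI : ∀ a, a < 23 → a ≠ 10 → InitRegs a := fun a h h' => Or.inl ⟨h, h'⟩
  have hd4 : ∀ a, 9 ≤ a → a ≠ 16 → a ≠ 20 → (∀ r, a ≠ vaddr 0 r) → σ₄.reg a = 0 := by
    refine fun a h1 h2 h3 h4 => d3.2.2 a ?_
    rintro (h | h | h | ⟨r, h⟩)
    · omega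
    · exact h2 h
    · exact h3 h
    · exact h4 r h
  refine Tri.seq (Q := fun σ' => σ'.reg 16 = n ∧ σ'.reg 20 = n + 1 ∧ SimRel 1 (argCfg s k) σ' ∧
      Fix InitRegs (zeroSt s) σ') (T₁ := 4)
    (T₂ := d * (6 * (n + 1) + 6) + n * (5 * M.length + 15) + 6 * A + 13) (Tri.blk ?_ le_rfl)
    (fun σ₅ ⟨e1, e2, e3, e4⟩ => ?_) (by omega)
  · have h1 : vaddr 1 1 = 69 := rfl
    have h0 : vaddr 0 0 = 64 := rfl
    have hk' : σ₄.reg 64 = k := by rw [← h0, d1.2, hk]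
    simp only [BlkOk, Safe, eff, St.set_reg, h1, h0, hk', d2, if_true, if_false, Nat.reduceEqDiff,
      Nat.add_zero, Nat.add_sub_cancel]
    refine ⟨Nat.zero_le _, hkB', hB, by omega, trivial, trivial, ⟨?_, fun r => ?_⟩, ?_⟩
    · simp only [St.set_reg, Nat.reduceAdd, Nat.reduceEqDiff, if_false, OfNat.ofNat_ne_one]
      exact hd4 9 (by omega) (by omega) (by omega) (fun r => by simp only [vaddr]; omega)
    · have hn : ∀ a, a < 64 → vaddr 1 r ≠ a := fun a ha => by simp only [vaddr]; omega
      have h69 : vaddr 1 r = 69 ↔ r = 1 := by simp only [vaddr]; omega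
      simp only [St.set_reg, hn 1 (by omega), hn 16 (by omega), if_false, h69, argCfg,
        Function.update_apply]
      rw [hd4 (vaddr 1 r) (by simp only [vaddr]; omega) (by simp only [vaddr]; omega)
        (by simp only [vaddr]; omega) (fun r' => by simp only [vaddr]; omega)]
    · exact (((hd3.set (hI _ (by omega) (by omega))).set
        (Or.inr (Or.inr (Or.inr ⟨1, Or.inr rfl⟩)))).set (hI _ (by omega) (by omega))).set
        (hI _ (by omega) (by omega))
  have hstep : ∀ u, (step (noRead M) x)^[u] (argCfg s k) = (step M [])^[u] (argCfg s k) := by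
    intro u; rw [step_noRead]
  have hMsim := simLoop_drop_spec (x := x) (B := B) (v := 1) (by omega) (noRead M) (m := n)
    (fun u hu => by rw [hstep]; exact hMpc u hu) (fun u hu => by rw [hstep]; exact hMreg u hu) e3 e1
  rw [hstep, show (noRead M).length = M.length from List.length_map _] at hMsim
  refine Tri.seq hMsim (T₂ := d * (6 * (n + 1) + 6) + 6 * A + 12) (fun σ₆ ⟨f1, f2⟩ => ?_) (by omega)
  have f3 : σ₆.reg 20 = n + 1 := by
    rw [f2.2.2 20 (not_simRegs (by omega) (by omega) (by omega) (by omega) (by omega)), e2]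
  have f4 : Fix InitRegs (zeroSt s) σ₆ := e4.trans (f2.mono fun a ha => by
    rcases ha with ha | ha | ha | ⟨r, ha⟩
    · exact Or.inl (by omega)
    · exact Or.inl (by omega)
    · exact Or.inl (by omega)
    · exact Or.inr (Or.inr (Or.inr ⟨r, Or.inr ha⟩)))
  obtain ⟨τ, hτ⟩ : ∃ τ, τ = ((step M [])^[n] (argCfg s k)).reg 1 := ⟨_, rfl⟩
  have hτB : τ ≤ B := by
    have := hMreg n le_rfl 1
    rw [← hτ] at this
    simp only [vaddr] at this
    omega
  rw [← hτ] at hS hS' ⊢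
  refine Tri.seq (Q := fun σ' => σ'.reg 22 = τ ∧ σ'.reg 28 = A ∧ σ'.reg 20 = n + 1 ∧
      σ'.reg 21 = 1 ∧ σ'.reg 27 = M.length - ((step M [])^[n] (argCfg s k)).pc ∧
      Fix InitRegs (zeroSt s) σ') (T₁ := 6)
    (T₂ := d * (6 * (n + 1) + 6) + 6 * A + 6) (Tri.blk ?_ le_rfl)
    (fun σ₇ ⟨g1, g2, g3, g4, g5, g6⟩ => ?_) (by omega)
  · have h1 : vaddr 1 1 = 69 := rfl
    have h69 : σ₆.reg 69 = τ := by rw [← h1, f1.2, hτ]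
    have h9 := f1.1
    norm_num at h9
    simp only [BlkOk, Safe, eff, St.set_reg, h1, h9, h69, f3, if_true, if_false, Nat.reduceEqDiff,
      OfNat.ofNat_ne_one, Nat.add_zero]
    refine ⟨hM, by omega, Nat.zero_le _, hτB, hA, hB, trivial, trivial, trivial, trivial, trivial,
      ?_⟩
    exact (((((f4.set (hI _ (by omega) (by omega))).set (Or.inr (Or.inl rfl))).set
      (hI _ (by omega) (by omega))).set (hI _ (by omega) (by omega))).set
      (Or.inr (Or.inr (Or.inl rfl)))).set (hI _ (by omega) (by omega))
  have hI22 : ∀ a, Scratch 22 a → InitRegs a := fun a h => hI a (by rcases h with h | h <;> omega)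
    (by rcases h with h | h <;> omega)
  have hmul := mulPowCmd_spec (x := x) (B := B) (σ := σ₇) (r := 22) (q := 20) (d := d) (by omega)
    (by omega) (by omega) hB (by omega) (by rw [g1, g3]; exact hS)
  rw [g1, g3] at hmul
  refine Tri.seq hmul (T₂ := 6 * A + 6) (fun σ₈ ⟨k1, k2⟩ => ?_) (by omega)
  have k28 : σ₈.reg 28 = A := by rw [k2.2.2 28 (by simp [Scratch]), g2]
  have hmul' := mulCmd_spec (x := x) (B := B) (σ := σ₈) (r := 22) (q := 28) (by omega)
    (by omega) hB (by rw [k1, k28]; exact hS')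
  rw [k1, k28] at hmul'
  refine hmul'.mono le_rfl fun σ₉ ⟨l1, l2⟩ => ⟨(g6.trans (k2.mono hI22)).trans (l2.mono hI22), ?_,
    ?_, l1⟩
  · rw [l2.2.2 21 (by simp [Scratch]), k2.2.2 21 (by simp [Scratch]), g4]
  · rw [l2.2.2 27 (by simp [Scratch]), k2.2.2 27 (by simp [Scratch]), g5]

end Main

end EnumFPT

/-! ### The main machine -/

namespace EnumFPT

/-- The body of the main loop: a phase, or the direct simulation if register `27` is not zero. -/
def bodyCmd {s : ℕ} (P : Program s) (b : ℕ) : Cmd s := .ite 27 (phaseCmd b P) (directCmd P)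

/-- The machine that outputs the words of `P` with small delay. -/
def mainCmd {s : ℕ} (K M P : Program s) (C d A b : ℕ) : Cmd s :=
  .seq (initCmd K M C d A) (.loop 21 (bodyCmd P b))

/-- The program of the machine `mainCmd`. -/
def mainProgram {s : ℕ} (K M P : Program s) (C d A b : ℕ) : Program s :=
  (mainCmd K M P C d A b).code 0

/-- The step budget of the main machine. -/
def budget {s : ℕ} (M : Program s) (d A k n : ℕ) : ℕ :=
  ((step M [])^[n] (argCfg s k)).reg 1 * (n + 1) ^ d * A

/-- The number of steps of `P` simulated in the first `j` phases. -/
def phaseSum (S b j : ℕ) : ℕ := ∑ i ∈ Finset.range j, S * (i + 1) ^ b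

theorem phaseSum_succ (S b j : ℕ) : phaseSum S b (j + 1) = phaseSum S b j + S * (j + 1) ^ b :=
  Finset.sum_range_succ _ _

theorem phaseSum_le (S b j : ℕ) : phaseSum S b j ≤ j * (S * j ^ b) := by
  refine (Finset.sum_le_card_nsmul _ _ (S * j ^ b) fun i hi => ?_).trans (by simp)
  have : i + 1 ≤ j := Finset.mem_range.1 hi
  gcongr

theorem phaseSum_mono (S b : ℕ) : Monotone (phaseSum S b) :=
  monotone_nat_of_le_succ fun j => by rw [phaseSum_succ]; omega

/-- All values that occur in the computation of the main machine on `x` are at most `B`, where `k`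
is the parameter of `x` and `N` the number of solutions. -/
structure Fits {s : ℕ} (K M P : Program s) (C d A b : ℕ) (x : Word s) (k N B : ℕ) : Prop where
  alphabet : s ≤ B
  input : x.length + 1 ≤ B
  fuel : C * (x.length + 1) ^ d ≤ B
  pc_K : ∀ u, (run K x u).pc + 1 ≤ B
  reg_K : ∀ u ≤ C * (x.length + 1) ^ d, ∀ r, vaddr 0 ((run K x u).reg r) ≤ B
  param : (run K x (C * (x.length + 1) ^ d)).reg 0 = k
  pc_M : ∀ u, ((step M [])^[u] (argCfg s k)).pc + 1 ≤ B
  reg_M : ∀ u ≤ x.length, ∀ r, vaddr 1 (((step M [])^[u] (argCfg s k)).reg r) ≤ B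
  length_M : M.length ≤ B
  factor : A ≤ B
  factor' : ((step M [])^[x.length] (argCfg s k)).reg 1 * (x.length + 1) ^ d ≤ B
  budget_le : budget M d A k x.length ≤ B
  length_P : P.length ≤ B
  pc_P : ∀ u, (run P x u).pc + 1 ≤ B
  reg_P : ∀ u r, vaddr 2 ((run P x u).reg r) ≤ B
  phases : N + 1 ≤ B
  phase : budget M d A k x.length * (N + 1) ^ b ≤ B
  queue : vaddr 3 ((N + 1) * (budget M d A k x.length * (N + 1) ^ b)) ≤ B

/-- A bound on the time of the initialisation. -/
def initTime {s : ℕ} (K M : Program s) (C d A n : ℕ) : ℕ :=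
  2 * (d * (6 * (n + 1) + 6)) + C * (n + 1) ^ d * (5 * K.length + 15) +
        n * (5 * M.length + 20) + 6 * A + 24

/-- A bound on the time of a phase. -/
def phaseTime {s : ℕ} (P : Program s) (b S W j : ℕ) : ℕ :=
  b * (6 * (j + 1) + 6) + S * (j + 1) ^ b * (5 * P.length + 25) + W * (5 * s + 10) + 24

section Run

variable {s : ℕ} {K M P : Program s} {C d A b k N B : ℕ} {x : Word s}

/-- The main machine reaches the head of its loop. -/
theorem Fits.init (F : Fits K M P C d A b x k N B) : ∃ t ≤ initTime K M C d A x.length, ∃ σ,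
    Reach (· ≤ B) (mainProgram K M P C d A b) x (initCfg s) (σ.at (initCmd K M C d A).size) t ∧
    Fix InitRegs (zeroSt s) σ ∧ σ.reg 21 = 1 ∧
    σ.reg 27 = M.length - ((step M [])^[x.length] (argCfg s k)).pc ∧
    σ.reg 22 = budget M d A k x.length := by
  obtain ⟨t, ht, σ, h1, h2⟩ := initCmd_spec (B := B) rfl F.alphabet F.input F.fuel
    (fun u _ => F.pc_K u) F.reg_K F.param (fun u _ => F.pc_M u) F.reg_M F.length_M F.factor
    F.factor' F.budget_le (fun _ => Nat.zero_le _) (mainProgram K M P C d A b) 0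
    (CodeAt.left (bs := Cmd.code (.loop 21 (bodyCmd P b)) (0 + (initCmd K M C d A).size))
      fun i I h => by rw [zero_add]; exact h)
  rw [zero_add] at h1
  exact ⟨t, ht, σ, h1, h2⟩

theorem codeAt_loop : CodeAt (mainProgram K M P C d A b) (initCmd K M C d A).size
    (Cmd.code (.loop 21 (bodyCmd P b)) (initCmd K M C d A).size) := by
  have h : CodeAt (mainProgram K M P C d A b) 0 ((initCmd K M C d A).code 0 ++
      Cmd.code (.loop 21 (bodyCmd P b)) (0 + (initCmd K M C d A).size)) :=
    fun i I h => by rw [zero_add]; exact h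
  have := h.right
  rwa [Cmd.code_length, zero_add] at this

theorem mainProgram_length : (mainProgram K M P C d A b).length =
    (initCmd K M C d A).size + Cmd.size (.loop 21 (bodyCmd P b)) :=
  Cmd.code_length _ _

/-- The main machine halts at the head of its loop if register `21` is zero. -/
theorem reach_exit {σ : St s} {t : ℕ}
    (h : Reach (· ≤ B) (mainProgram K M P C d A b) x (initCfg s)
      (σ.at (initCmd K M C d A).size) t) (h21 : σ.reg 21 = 0) :
    ∃ t' ≤ t + 1, HaltedAt (mainProgram K M P C d A b) x t' ∧
      (run (mainProgram K M P C d A b) x t').out = σ.out ∧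
      ∀ u ≤ t', ∀ r, (run (mainProgram K M P C d A b) x u).reg r ≤ B := by
  obtain ⟨u, hu, σ', h1, rfl⟩ := Tri.loop_zero (G := (· ≤ B)) (x := x) (c := bodyCmd P b)
    (Q := (· = σ)) h21 rfl le_rfl h.last _ _ (codeAt_loop (K := K) (M := M) (C := C) (d := d) (A := A))
  have h2 := h.trans h1
  have e : run (mainProgram K M P C d A b) x (t + u) = _ := h2.1
  refine ⟨t + u, by omega, ?_, by rw [e]; rfl, h2.2⟩
  rw [HaltedAt, e, mainProgram_length]
  exact le_rfl

/-- If `M` does not halt in time, the main machine simulates `P`. -/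
theorem Fits.direct (F : Fits K M P C d A b x k N B)
    (hM : ((step M [])^[x.length] (argCfg s k)).pc < M.length) {h : ℕ} (hh : HaltedAt P x h) :
    ∃ t ≤ initTime K M C d A x.length + h * (5 * P.length + 16) + 11,
      HaltedAt (mainProgram K M P C d A b) x t ∧
      (run (mainProgram K M P C d A b) x t).out = (run P x h).out ∧
      ∀ u ≤ t, ∀ r, (run (mainProgram K M P C d A b) x u).reg r ≤ B := by
  obtain ⟨t, ht, σ, h1, h2, h3, h4, h5⟩ := F.init
  have hz : ∀ a, ¬ InitRegs a → σ.reg a = 0 := fun a ha => h2.2.2 a ha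
  have hsim : SimRel 2 (initCfg s) σ := ⟨hz _ (by simp [InitRegs, vaddr]), fun r =>
    hz _ (by simp only [InitRegs, vaddr]; rintro (h | h | h | ⟨r', h⟩) <;> omega)⟩
  have hd := directCmd_spec (x := x) F.length_P F.pc_P F.reg_P hsim h2.1 h2.2.1 hh
  have hb : Tri (· ≤ B) x (bodyCmd P b) σ (h * (5 * P.length + 16) + 4 + 3)
      (fun σ' => σ'.out = (run P x h).out ∧ σ'.reg 21 = 0) :=
    Tri.ite_pos (Nat.zero_le _) (by omega) (hd.mono le_rfl fun σ' h' =>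
      ⟨h'.1, by rw [St.set_reg, if_neg (by omega), h'.2]⟩) le_rfl
  obtain ⟨u, hu, σ', h6, h7, h8⟩ := reach_round (G := (· ≤ B)) (a := 21) (Nat.zero_le _)
    (by omega) hb h1.last (codeAt_loop (K := K) (M := M) (C := C) (d := d) (A := A))
  obtain ⟨t', ht', h9, h10, h11⟩ := reach_exit (h1.trans h6)
    (by rw [St.set_reg, if_neg (by omega), h8])
  exact ⟨t', by omega, h9, h10.trans h7, h11⟩

/-- The main machine reaches the head of its loop after `j` phases and `t` steps. -/
def AtPhase (K M P : Program s) (C d A b : ℕ) (x : Word s) (k B j t : ℕ) : Prop :=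
  ∃ σ, Reach (· ≤ B) (mainProgram K M P C d A b) x (initCfg s)
      (σ.at (initCmd K M C d A).size) t ∧
    RoundInv P x (budget M d A k x.length) j (phaseSum (budget M d A k x.length) b j) σ

theorem Fits.atPhase_zero (F : Fits K M P C d A b x k N B)
    (hM : M.length ≤ ((step M [])^[x.length] (argCfg s k)).pc) :
    ∃ t ≤ initTime K M C d A x.length, AtPhase K M P C d A b x k B 0 t := by
  obtain ⟨t, ht, σ, h1, h2, h3, h4, h5⟩ := F.init
  have hz : ∀ a, ¬ InitRegs a → σ.reg a = 0 := fun a ha => h2.2.2 a ha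
  have hz' : ∀ a, 23 ≤ a → a < 27 → σ.reg a = 0 := fun a h h' => hz a (by
    simp only [InitRegs, vaddr]; rintro (h | h | h | ⟨r', h⟩) <;> omega)
  refine ⟨t, ht, σ, h1, ⟨hz _ (by simp [InitRegs, vaddr]), fun r =>
    hz _ (by simp only [InitRegs, vaddr]; rintro (h | h | h | ⟨r', h⟩) <;> omega)⟩, ?_, fun q => ?_,
    ?_, ?_, ?_, ?_, h3, h5, ?_, ?_⟩
  · rw [hz' _ (by omega) (by omega)]; rfl
  · rw [hz _ (by simp only [InitRegs, vaddr]; rintro (h | h | h | ⟨r', h⟩) <;> omega)]; rfl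
  · rw [hz' _ (by omega) (by omega)]; rfl
  · rw [hz' _ (by omega) (by omega)]; rfl
  · rw [h2.2.1]; rfl
  · rw [h2.1]; rfl
  · rw [hz' _ (by omega) (by omega)]
  · rw [h4]; omega

theorem AtPhase.length {j t : ℕ} (h : AtPhase K M P C d A b x k B j t) :
    (run (mainProgram K M P C d A b) x t).out.length = j := by
  obtain ⟨σ, h1, _, h2⟩ := h
  have e : run (mainProgram K M P C d A b) x t = _ := h1.1
  have h3 := h2.2.2.2.1
  rw [e]
  change σ.out.length = j
  rw [h2.2.2.2.2.1, List.length_take]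
  omega

/-- A round of the main loop. -/
theorem Fits.round (F : Fits K M P C d A b x k N B) {j t W : ℕ} (hj : j ≤ N)
    (hW : ∀ m, ∀ w ∈ (run P x m).out, w.length ≤ W) (h : AtPhase K M P C d A b x k B j t) :
    ∃ t', t ≤ t' ∧ t' ≤ t + phaseTime P b (budget M d A k x.length) W j ∧
      (j < (run P x (phaseSum (budget M d A k x.length) b (j + 1))).out.length →
        AtPhase K M P C d A b x k B (j + 1) t') ∧
      ((run P x (phaseSum (budget M d A k x.length) b (j + 1))).out.length ≤ j →
        HaltedAt (mainProgram K M P C d A b) x t' ∧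
        (run (mainProgram K M P C d A b) x t').out =
          (run P x (phaseSum (budget M d A k x.length) b (j + 1))).out ∧
        ∀ u ≤ t', ∀ r, (run (mainProgram K M P C d A b) x u).reg r ≤ B) := by
  obtain ⟨σ, h1, h2⟩ := h
  obtain ⟨S, hS⟩ : ∃ S, S = budget M d A k x.length := ⟨_, rfl⟩
  have hfuel := F.phase
  have hqueue := F.queue
  have hphases := F.phases
  rw [← hS] at h2 hfuel hqueue ⊢
  have hpow : S * (j + 1) ^ b ≤ S * (N + 1) ^ b := by gcongr
  have hsum : phaseSum S b (j + 1) ≤ (N + 1) * (S * (N + 1) ^ b) :=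
    (phaseSum_mono S b (by omega)).trans (phaseSum_le S b (N + 1))
  have hphase := phaseCmd_spec (x := x) (W := W) F.alphabet (by omega) (phaseSum_succ S b j)
    (hpow.trans hfuel) (le_trans (by simp only [vaddr]; omega) hqueue) F.pc_P F.reg_P h2
    (hW _)
  have hb := Tri.ite_zero (a := 27) (d := directCmd P) h2.2.2.2.2.2.2.2.2.2.2 hphase le_rfl
  obtain ⟨u, hu, σ', h6, h7, h8⟩ := reach_round (G := (· ≤ B)) (a := 21)
    (c := bodyCmd P b) (Nat.zero_le _) (by rw [h2.2.2.2.2.2.2.2.1]; omega) hb h1.last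
    (codeAt_loop (K := K) (M := M) (C := C) (d := d) (A := A))
  have h9 := h1.trans h6
  by_cases hlen : j < (run P x (phaseSum S b (j + 1))).out.length
  · refine ⟨t + u, by omega, by rw [phaseTime]; omega, fun _ => ⟨_, h9, ?_⟩, fun hh => by omega⟩
    rw [← hS]
    exact h7 hlen
  · obtain ⟨h10, h11⟩ := h8 (by omega)
    obtain ⟨t', ht', h12, h13, h14⟩ := reach_exit h9 h10
    -- The exit lemma gives no lower bound on its halting time; as halted configurations persist,
    -- the maximum does as well.
    refine ⟨max t t', le_max_left _ _, ?_, fun hh => absurd hh hlen, fun _ => ?_⟩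
    · rw [phaseTime]; omega
    · have e := h12.run_eq (le_max_right t t')
      refine ⟨h12.mono (le_max_right t t'), by rw [e, h13]; exact h11, fun v hv r => ?_⟩
      rcases le_total v t' with hv' | hv'
      · exact h14 v hv' r
      · rw [h12.run_eq hv']; exact h14 t' le_rfl r

/-- If `M` halts in time, the main machine outputs the words of `P` in phases. -/
theorem Fits.phased (F : Fits K M P C d A b x k N B)
    (hM : M.length ≤ ((step M [])^[x.length] (argCfg s k)).pc) {W : ℕ}
    (hW : ∀ m, ∀ w ∈ (run P x m).out, w.length ≤ W) (hN : ∀ m, (run P x m).out.length ≤ N)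
    (hcount : ∀ j < N,
      j < (run P x (phaseSum (budget M d A k x.length) b (j + 1))).out.length) :
    ∃ (τ : ℕ → ℕ) (t : ℕ), τ 0 ≤ initTime K M C d A x.length ∧
      (∀ j ≤ N, (run (mainProgram K M P C d A b) x (τ j)).out.length = j) ∧
      (∀ j < N, τ (j + 1) ≤ τ j + phaseTime P b (budget M d A k x.length) W j) ∧
      t ≤ τ N + phaseTime P b (budget M d A k x.length) W N ∧
      HaltedAt (mainProgram K M P C d A b) x t ∧
      (run (mainProgram K M P C d A b) x t).out =
        (run P x (phaseSum (budget M d A k x.length) b (N + 1))).out ∧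
      ∀ u ≤ t, ∀ r, (run (mainProgram K M P C d A b) x u).reg r ≤ B := by
  obtain ⟨t₀, ht₀, h0⟩ := F.atPhase_zero hM
  -- The hypotheses stand inside the existential, so that choice yields a total function and the
  -- phase times can be defined by recursion.
  have hstep : ∀ j t, ∃ t', j < N → AtPhase K M P C d A b x k B j t →
      t' ≤ t + phaseTime P b (budget M d A k x.length) W j ∧
      AtPhase K M P C d A b x k B (j + 1) t' := by
    intro j t
    by_cases h : j < N ∧ AtPhase K M P C d A b x k B j t
    · obtain ⟨t', _, h2, h3, _⟩ := F.round h.1.le hW h.2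
      exact ⟨t', fun _ _ => ⟨h2, h3 (hcount j h.1)⟩⟩
    · exact ⟨0, fun h1 h2 => absurd ⟨h1, h2⟩ h⟩
  choose f hf using hstep
  obtain ⟨τ, hτ0, hτ⟩ : ∃ τ : ℕ → ℕ, τ 0 = t₀ ∧ ∀ j, τ (j + 1) = f j (τ j) :=
    ⟨fun j => Nat.rec t₀ f j, rfl, fun _ => rfl⟩
  have hA : ∀ j ≤ N, AtPhase K M P C d A b x k B j (τ j) := by
    intro j
    induction j with
    | zero => exact fun _ => hτ0 ▸ h0
    | succ j ih =>
      intro hj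
      rw [hτ]
      exact (hf j (τ j) (by omega) (ih (by omega))).2
  -- After all `N` words one more phase is run; it finds the queue empty and ends the computation.
  obtain ⟨t, _, h2, _, h3⟩ := F.round le_rfl hW (hA N le_rfl)
  obtain ⟨h4, h5, h6⟩ := h3 (hN _)
  refine ⟨τ, t, by omega, fun j hj => (hA j hj).length, fun j hj => ?_, h2, h4, h5, h6⟩
  rw [hτ]
  exact (hf j (τ j) hj (hA j hj.le)).1

end Run

end EnumFPT

/-! ### Output times and delays -/

namespace EnumFPT

section Times

variable {s : ℕ} {P : Program s} {x : Word s} {E : PEP s}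

theorem run_out_prefix {m m' : ℕ} (h : m ≤ m') : (run P x m).out <+: (run P x m').out := by
  induction h with
  | refl => exact List.prefix_rfl
  | @step k _ ih =>
    refine ih.trans ?_
    have e : run P x (k + 1) = step P x (run P x k) := Function.iterate_succ_apply' _ _ _
    rw [Nat.succ_eq_add_one, e, step]
    cases P[(run P x k).pc]? with
    | none => exact List.prefix_rfl
    | some I => cases I <;> first | exact List.prefix_rfl | exact List.prefix_append _ _

theorem outTime_le {i m : ℕ} (h : i ≤ (run P x m).out.length) : outTime P x i ≤ m :=
  Nat.sInf_le h

theorem haltTime_le {m : ℕ} (h : HaltedAt P x m) : haltTime P x ≤ m := Nat.sInf_le h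

theorem outTime_zero : outTime P x 0 = 0 := Nat.le_zero.1 (outTime_le (Nat.zero_le _))

/-- Since `sInf ∅ = 0`, a bound on `outTime` says something only if the `i`-th output is ever made;
`m'` witnesses this. -/
theorem le_length_of_outTime_le {i m m' : ℕ} (h : i ≤ (run P x m').out.length)
    (hm : outTime P x i ≤ m) : i ≤ (run P x m).out.length := by
  have h1 : outTime P x i ∈ {m | i ≤ (run P x m).out.length} := Nat.sInf_mem ⟨m', h⟩
  exact le_trans h1 (run_out_prefix hm).length_le

theorem lt_outTime {i m m' : ℕ} (h : i ≤ (run P x m').out.length)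
    (hm : (run P x m).out.length < i) : m < outTime P x i := by
  by_contra hc
  have := le_length_of_outTime_le h (not_lt.1 hc)
  omega

theorem IsEnumAlg.exists_halt (h : IsEnumAlg E P) (x : Word s) :
    ∃ m, HaltedAt P x m ∧ (run P x m).out.Nodup ∧ (run P x m).out.toFinset = E.Sol x ∧
      (run P x m).out.length = (E.Sol x).card := by
  obtain ⟨m, h1, h2, h3⟩ := h.2 x
  exact ⟨m, h1, h2, h3, by rw [← h3, List.toFinset_card_of_nodup h2]⟩

theorem outTime_succ_le (E : PEP s) (P : Program s) (x : Word s) {i : ℕ}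
    (hi : i < (E.Sol x).card) : outTime P x (i + 1) ≤ outTime P x i + delay E P x i := by
  rw [delay, if_pos hi]; omega

/-- All delays are at most the time in which the machine halts. -/
theorem delay_le_of_halted {m i : ℕ} (hm : HaltedAt P x m)
    (hlen : (run P x m).out.length = (E.Sol x).card) : delay E P x i ≤ m := by
  rw [delay]
  split
  · have := outTime_le (P := P) (x := x) (i := i + 1) (m := m) (by omega)
    omega
  · have := haltTime_le hm
    omega

/-- If the `j`-th output has been made, but not the next one, at time `τ j`, then a delay is at
most the duration of two consecutive intervals. -/
theorem delay_le_of_times {τ T : ℕ → ℕ} {t i : ℕ}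
    (hτ : ∀ j ≤ (E.Sol x).card, (run P x (τ j)).out.length = j)
    (hT : ∀ j < (E.Sol x).card, τ (j + 1) ≤ τ j + T j)
    (ht : t ≤ τ (E.Sol x).card + T (E.Sol x).card) (hh : HaltedAt P x t)
    (hi : i ≤ (E.Sol x).card) : delay E P x i ≤ τ 0 + T i + T (i - 1) := by
  have h1 : delay E P x i ≤ τ i + T i - outTime P x i := by
    rw [delay]
    split
    · next h =>
      have := outTime_le (hτ (i + 1) h).ge
      have := hT i h
      omega
    · next h =>
      obtain rfl : i = (E.Sol x).card := by omega
      have := haltTime_le hh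
      omega
  -- The `i`-th output comes after `τ (i - 1)`, and the next event by `τ i + T i`, so two intervals
  -- suffice. For `i = 0` the initial time `τ 0` takes the place of the earlier interval.
  cases i with
  | zero => omega
  | succ i =>
    have h2 := lt_outTime (P := P) (x := x) (hτ (i + 1) hi).ge
      (by rw [hτ i (by omega)]; omega : (run P x (τ i)).out.length < i + 1)
    have h3 := hT i hi
    rw [Nat.add_sub_cancel]
    omega

end Times

/-! ### Growth of values and polynomial size -/

section Bounds

variable {s : ℕ}

/-- The jump targets of a program are bounded. -/
theorem exists_pc_le (P : Program s) : ∃ D, ∀ (x : Word s) (c : Cfg s), c.pc = 0 → ∀ u,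
    ((step P x)^[u] c).pc + 1 ≤ D := by
  have h1 : ∃ D, ∀ a l, Instr.jz a l ∈ P → l ≤ D := by
    induction P with
    | nil => exact ⟨0, by simp⟩
    | cons I P ih =>
      obtain ⟨D, hD⟩ := ih
      cases I
      case jz a l =>
        refine ⟨max D l, fun a' l' h => ?_⟩
        rcases List.mem_cons.1 h with h | h
        · cases h; exact le_max_right _ _
        · exact (hD a' l' h).trans (le_max_left _ _)
      all_goals
        refine ⟨D, fun a' l' h => ?_⟩
        rcases List.mem_cons.1 h with h | h
        · cases h
        · exact hD a' l' h
  obtain ⟨D, hD⟩ := h1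
  refine ⟨D + P.length + 1, fun x c hc u => ?_⟩
  induction u with
  | zero => simp [hc]
  | succ u ih =>
    rw [Function.iterate_succ_apply', step]
    generalize (step P x)^[u] c = c' at ih ⊢
    cases hI : P[c'.pc]? with
    | none => exact ih
    | some I =>
      have hlt := (List.getElem?_eq_some_iff.1 hI).1
      cases I
      case jz a l =>
        have := hD a l (List.mem_of_getElem? hI)
        simp only [exec]
        split <;> omega
      all_goals
        simp only [exec]
        omega

/-- In one step the register contents at most double, up to a constant. -/
theorem exists_reg_le (P : Program s) : ∃ D, ∀ (x : Word s) (c : Cfg s) (V : ℕ), D ≤ V →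
    (∀ r, c.reg r ≤ V) → ∀ u r, ((step P x)^[u] c).reg r ≤ 2 ^ u * V := by
  have h1 : ∃ D, ∀ d k, Instr.const d k ∈ P → k ≤ D := by
    induction P with
    | nil => exact ⟨0, by simp⟩
    | cons I P ih =>
      obtain ⟨D, hD⟩ := ih
      cases I
      case const a l =>
        refine ⟨max D l, fun a' l' h => ?_⟩
        rcases List.mem_cons.1 h with h | h
        · cases h; exact le_max_right _ _
        · exact (hD a' l' h).trans (le_max_left _ _)
      all_goals
        refine ⟨D, fun a' l' h => ?_⟩
        rcases List.mem_cons.1 h with h | h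
        · cases h
        · exact hD a' l' h
  obtain ⟨D, hD⟩ := h1
  -- Constants are bounded by `D` and symbols read from the input by `s`; every other new value is
  -- at most twice an old one.
  refine ⟨D + s, fun x c V hV hc u => ?_⟩
  induction u with
  | zero => simpa using hc
  | succ u ih =>
    have hle : V ≤ 2 ^ u * V := Nat.le_mul_of_pos_left _ (by positivity)
    intro r
    rw [Function.iterate_succ_apply', step, pow_succ, mul_comm (2 ^ u), mul_assoc]
    generalize (step P x)^[u] c = c' at ih ⊢
    generalize 2 ^ u * V = V' at ih hle ⊢
    cases hI : P[c'.pc]? with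
    | none => exact (ih r).trans (by omega)
    | some I =>
      have hmem := List.mem_of_getElem? hI
      have hr := ih r
      cases I <;> simp only [exec, Function.update_apply] <;> try split
      case const.isTrue => have := hD _ _ hmem; omega
      case add.isTrue a b _ => have := ih a; have := ih b; omega
      case sub.isTrue a b _ => have := ih a; omega
      case half.isTrue a _ => have := ih a; omega
      case load.isTrue a _ => have := ih (c'.reg a); omega
      case store.isTrue a b _ => have := ih b; omega
      case read.isTrue a _ => have := inputAt_le x (c'.reg a); omega
      all_goals omega

theorem exists_eval_le (p : Polynomial ℕ) : ∃ C d, ∀ n, p.eval n ≤ C * (n + 1) ^ d := by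
  induction p using Polynomial.induction_on' with
  | add p q hp hq =>
    obtain ⟨C, d, h⟩ := hp
    obtain ⟨C', d', h'⟩ := hq
    refine ⟨C + C', d + d', fun n => ?_⟩
    rw [Polynomial.eval_add, add_mul]
    refine add_le_add ((h n).trans (Nat.mul_le_mul_left _ ?_))
      ((h' n).trans (Nat.mul_le_mul_left _ ?_))
    · exact Nat.pow_le_pow_right (by omega) (by omega)
    · exact Nat.pow_le_pow_right (by omega) (by omega)
  | monomial d C =>
    refine ⟨C, d, fun n => ?_⟩
    rw [Polynomial.eval_monomial]
    exact Nat.mul_le_mul_left _ (Nat.pow_le_pow_left (by omega) _)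

/-- The binary size of `f` is bounded by a polynomial in the input length. -/
def PolySize (f : Word s → ℕ) : Prop :=
  ∃ q : Polynomial ℕ, ∀ x, f x ≤ 2 ^ q.eval x.length

theorem PolySize.mono {f g : Word s → ℕ} (hf : PolySize f) (h : ∀ x, g x ≤ f x) : PolySize g :=
  hf.imp fun _ hq x => (h x).trans (hq x)

theorem PolySize.two_pow (q : Polynomial ℕ) : PolySize fun x : Word s => 2 ^ q.eval x.length :=
  ⟨q, fun _ => le_rfl⟩

theorem PolySize.const (k : ℕ) : PolySize fun _ : Word s => k :=
  ⟨Polynomial.C k, fun _ => by simpa using Nat.lt_two_pow_self.le⟩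

theorem PolySize.length : PolySize fun x : Word s => x.length :=
  ⟨Polynomial.X, fun _ => by simpa using Nat.lt_two_pow_self.le⟩

theorem PolySize.mul {f g : Word s → ℕ} (hf : PolySize f) (hg : PolySize g) :
    PolySize fun x => f x * g x := by
  obtain ⟨p, hp⟩ := hf
  obtain ⟨q, hq⟩ := hg
  refine ⟨p + q, fun x => ?_⟩
  rw [Polynomial.eval_add, pow_add]
  exact Nat.mul_le_mul (hp x) (hq x)

theorem PolySize.add {f g : Word s → ℕ} (hf : PolySize f) (hg : PolySize g) :
    PolySize fun x => f x + g x := by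
  obtain ⟨p, hp⟩ := hf
  obtain ⟨q, hq⟩ := hg
  refine ⟨p + q + 1, fun x => ?_⟩
  have h1 := hp x
  have h2 := hq x
  have h3 : 2 ^ p.eval x.length ≤ 2 ^ (p.eval x.length + q.eval x.length) :=
    Nat.pow_le_pow_right (by omega) (by omega)
  have h4 : 2 ^ q.eval x.length ≤ 2 ^ (p.eval x.length + q.eval x.length) :=
    Nat.pow_le_pow_right (by omega) (by omega)
  rw [Polynomial.eval_add, Polynomial.eval_add, Polynomial.eval_one, pow_succ]
  change f x + g x ≤ _
  omega

theorem PolySize.pow {f : Word s → ℕ} (hf : PolySize f) (b : ℕ) : PolySize fun x => f x ^ b := by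
  induction b with
  | zero => simpa using PolySize.const 1
  | succ b ih => simpa only [pow_succ] using ih.mul hf

theorem PolySize.vaddr {f : Word s → ℕ} (hf : PolySize f) (v : ℕ) :
    PolySize fun x => vaddr v (f x) :=
  (((PolySize.const 4).mul hf).add (.const v)).add (.const 64)

theorem length_wordsUpTo_le (s n : ℕ) : (wordsUpTo s n).length ≤ (s + 1) ^ n := by
  induction n with
  | zero => simp [wordsUpTo]
  | succ n ih =>
    have h : 1 ≤ (s + 1) ^ n := Nat.one_le_pow _ _ (by omega)
    have e : (wordsUpTo s (n + 1)).length = (wordsUpTo s n).length * s + 1 := by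
      simp [wordsUpTo]
    rw [e, pow_succ]
    nlinarith

/-- There are at most `(s + 1) ^ p(n) ≤ 2 ^ (s * p(n))` words of length at most `p(n)`. So counters
of solutions and phases have polynomially many bits. -/
theorem PEP.polySize_card (E : PEP s) : PolySize fun x => (E.Sol x).card := by
  obtain ⟨p, hp⟩ := E.Sol_length
  refine (PolySize.two_pow (Polynomial.C s * p)).mono fun x => ?_
  have hsub : E.Sol x ⊆ (wordsUpTo s (p.eval x.length)).toFinset := fun y hy => by
    rw [List.mem_toFinset]
    exact mem_wordsUpTo (hp x ((E.Sol_nonempty_iff x).1 ⟨y, hy⟩) y hy)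
  refine (Finset.card_le_card hsub).trans ((List.toFinset_card_le _).trans
    ((length_wordsUpTo_le _ _).trans ?_))
  rw [Polynomial.eval_mul, Polynomial.eval_C, pow_mul]
  exact Nat.pow_le_pow_left Nat.lt_two_pow_self _

/-- Telescoping with `(j + 1) ^ (b + 1) - j ^ (b + 1) ≤ (b + 1) * (j + 1) ^ b`, the discrete form of
integrating a power. This is why the budget carries the factor `b + 1`. -/
theorem pow_succ_le_phaseSum (S b j : ℕ) : S * j ^ (b + 1) ≤ phaseSum (S * (b + 1)) b j := by
  have key : ∀ b, (j : ℕ) → (j + 1) ^ (b + 1) ≤ j ^ (b + 1) + (b + 1) * (j + 1) ^ b := by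
    intro b j
    induction b with
    | zero => simp
    | succ b ih =>
      have h : j ^ (b + 1) ≤ (j + 1) ^ (b + 1) := Nat.pow_le_pow_left (by omega) _
      calc (j + 1) ^ (b + 1 + 1) = (j + 1) ^ (b + 1) * (j + 1) := pow_succ _ _
        _ ≤ (j ^ (b + 1) + (b + 1) * (j + 1) ^ b) * (j + 1) := Nat.mul_le_mul_right _ ih
        _ = j ^ (b + 1 + 1) + j ^ (b + 1) + (b + 1) * (j + 1) ^ (b + 1) := by ring
        _ ≤ j ^ (b + 1 + 1) + (j + 1) ^ (b + 1) + (b + 1) * (j + 1) ^ (b + 1) := by omega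
        _ = j ^ (b + 1 + 1) + (b + 1 + 1) * (j + 1) ^ (b + 1) := by ring
  induction j with
  | zero => simp
  | succ j ih =>
    rw [phaseSum_succ]
    calc S * (j + 1) ^ (b + 1) ≤ S * (j ^ (b + 1) + (b + 1) * (j + 1) ^ b) :=
          Nat.mul_le_mul_left _ (key b j)
      _ = S * j ^ (b + 1) + S * (b + 1) * (j + 1) ^ b := by ring
      _ ≤ _ := Nat.add_le_add_right ih _

/-- The cost of computing the power is linear in `j`. It is absorbed by `(j + 1) ^ b` if `b` is
positive, and it vanishes for `b = 0`, so constant delay factors stay possible. -/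
theorem phaseTime_le (P : Program s) (b S W j : ℕ) : phaseTime P b S W j ≤
    (12 * b + S * (5 * P.length + 25) + W * (5 * s + 10) + 24) * (j + 1) ^ b := by
  have h1 : 1 ≤ (j + 1) ^ b := Nat.one_le_pow _ _ (by omega)
  have h2 : b * (6 * (j + 1) + 6) ≤ 12 * b * (j + 1) ^ b := by
    rcases Nat.eq_zero_or_pos b with rfl | hb
    · simp
    · have : j + 1 ≤ (j + 1) ^ b := Nat.le_self_pow (by omega) _
      calc b * (6 * (j + 1) + 6) ≤ b * (12 * (j + 1) ^ b) := Nat.mul_le_mul_left _ (by omega)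
        _ = _ := by ring
  have h3 : W * (5 * s + 10) + 24 ≤ (W * (5 * s + 10) + 24) * (j + 1) ^ b :=
    Nat.le_mul_of_pos_right _ h1
  have h4 : S * (j + 1) ^ b * (5 * P.length + 25) = S * (5 * P.length + 25) * (j + 1) ^ b := by
    ring
  rw [phaseTime, h4]
  calc _ ≤ 12 * b * (j + 1) ^ b + S * (5 * P.length + 25) * (j + 1) ^ b +
        (W * (5 * s + 10) + 24) * (j + 1) ^ b := by omega
    _ = _ := by ring

end Bounds

end EnumFPT

/-! ### The conversion theorem and the two equalities -/

namespace EnumFPT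

variable {s : ℕ}

/-- The values in the computation of the main machine have polynomial size. -/
theorem exists_fits (E : PEP s) {K M P : Program s} (C d A b : ℕ) (hP : PolyRestricted P)
    (hK : ∀ x, (run K x (C * (x.length + 1) ^ d)).reg 0 = E.κ x) :
    ∃ B : Word s → ℕ, PolySize B ∧
      ∀ x, Fits K M P C d A b x (E.κ x) (E.Sol x).card (B x) := by
  obtain ⟨pcK, hpcK⟩ := exists_pc_le K
  obtain ⟨pcM, hpcM⟩ := exists_pc_le M
  obtain ⟨pcP, hpcP⟩ := exists_pc_le P
  obtain ⟨DK, hDK⟩ := exists_reg_le K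
  obtain ⟨DM, hDM⟩ := exists_reg_le M
  obtain ⟨q, hq⟩ := hP
  let n : Word s → ℕ := fun x => x.length + 1
  -- `K` and `M` need not be polynomially restricted, but they run for polynomially many steps, each
  -- of which at most doubles the values. For `P`, which may run longer, the restriction is
  -- indispensable.
  let VK : Word s → ℕ := fun x => 2 ^ (C * n x ^ d) * DK
  let VM : Word s → ℕ := fun x => 2 ^ x.length * (DM + VK x)
  let VP : Word s → ℕ := fun x => 2 ^ q.eval x.length
  let N : Word s → ℕ := fun x => (E.Sol x).card + 1
  let S : Word s → ℕ := fun x => VM x * n x ^ d * A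
  let F : Word s → ℕ := fun x => S x * N x ^ b
  have hn : PolySize n := PolySize.length.add (.const 1)
  have hVK : PolySize VK := by
    refine PolySize.mul ?_ (.const DK)
    refine (PolySize.two_pow (Polynomial.C C * (Polynomial.X + 1) ^ d)).mono fun x => ?_
    simp [n]
  have hVM : PolySize VM := by
    refine PolySize.mul ?_ ((PolySize.const DM).add hVK)
    exact (PolySize.two_pow Polynomial.X).mono fun x => by simp
  have hVP : PolySize VP := PolySize.two_pow q
  have hN : PolySize N := E.polySize_card.add (.const 1)
  have hS : PolySize S := (hVM.mul (hn.pow d)).mul (.const A)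
  have hF : PolySize F := hS.mul (hN.pow b)
  refine ⟨fun x => s + n x + C * n x ^ d + pcK + pcM + pcP + vaddr 0 (VK x) + vaddr 1 (VM x) +
    vaddr 2 (VP x) + M.length + P.length + A + VM x * n x ^ d + S x + N x + F x +
    vaddr 3 (N x * F x), ?_, fun x => ?_⟩
  · exact (((((((((((((((((PolySize.const s).add hn).add ((PolySize.const C).mul (hn.pow d))).add
      (.const _)).add (.const _)).add (.const _)).add (hVK.vaddr 0)).add (hVM.vaddr 1)).add
      (hVP.vaddr 2)).add (.const _)).add (.const _)).add (.const _)).add (hVM.mul (hn.pow d))).add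
      hS).add hN).add hF).add ((hN.mul hF).vaddr 3))
  have hrK : ∀ u ≤ C * n x ^ d, ∀ r, (run K x u).reg r ≤ VK x := fun u hu r =>
    (hDK x (initCfg s) DK le_rfl (fun _ => Nat.zero_le _) u r).trans
      (Nat.mul_le_mul_right _ (Nat.pow_le_pow_right (by omega) hu))
  have hk : E.κ x ≤ VK x := by rw [← hK]; exact hrK _ le_rfl 0
  have hrM : ∀ u ≤ x.length, ∀ r, ((step M [])^[u] (argCfg s (E.κ x))).reg r ≤ VM x :=
    fun u hu r => (hDM [] (argCfg s (E.κ x)) (DM + VK x) (by omega) (fun r => by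
      simp only [argCfg, Function.update_apply]
      split <;> omega) u r).trans
      (Nat.mul_le_mul_right _ (Nat.pow_le_pow_right (by omega) hu))
  have hrP : ∀ u r, (run P x u).reg r ≤ VP x := fun u r => (Nat.size_le.1 (hq x u r)).le
  have hmono : ∀ v a b, a ≤ b → vaddr v a ≤ vaddr v b := fun v a b h => by
    simp only [vaddr]; omega
  have hbS' : ((step M [])^[x.length] (argCfg s (E.κ x))).reg 1 * n x ^ d ≤ VM x * n x ^ d :=
    Nat.mul_le_mul_right _ (hrM _ le_rfl 1)
  have hbS : budget M d A (E.κ x) x.length ≤ S x := Nat.mul_le_mul_right _ hbS'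
  have hbF : budget M d A (E.κ x) x.length * N x ^ b ≤ F x := Nat.mul_le_mul_right _ hbS
  have hbQ := hmono 3 _ _ (Nat.mul_le_mul_left (N x) hbF)
  beta_reduce
  constructor
  · omega
  · change n x ≤ _; omega
  · change C * n x ^ d ≤ _; omega
  · intro u
    have := hpcK x (initCfg s) rfl u
    change ((step K x)^[u] (initCfg s)).pc + 1 ≤ _
    omega
  · intro u hu r
    have := hmono 0 _ _ (hrK u hu r)
    omega
  · exact hK x
  · intro u
    have := hpcM [] (argCfg s (E.κ x)) rfl u
    omega
  · intro u hu r
    have := hmono 1 _ _ (hrM u hu r)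
    omega
  · omega
  · omega
  · exact hbS'.trans (by omega)
  · exact hbS.trans (by omega)
  · omega
  · intro u
    have := hpcP x (initCfg s) rfl u
    change ((step P x)^[u] (initCfg s)).pc + 1 ≤ _
    omega
  · intro u r
    have := hmono 2 _ _ (hrP u r)
    omega
  · change N x ≤ _; omega
  · exact hbF.trans (by omega)
  · exact hbQ.trans (by omega)

/-- An enumeration algorithm that makes `i` outputs in time `t(κ(x)) · i ^ (b + 1) · p(|x|)` can be
turned into one with delays at most `t'(κ(x)) · p'(|x|) · (i + 1) ^ b`. -/
theorem exists_enumAlg_of_outTime_le {E : PEP s} {P : Program s} (hP : IsEnumAlg E P) {b : ℕ}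
    {t : ℕ → ℕ} (ht : Computable t) {p : Polynomial ℕ}
    (hp : ∀ x, ∀ i ≤ (E.Sol x).card,
      outTime P x i ≤ t (E.κ x) * i ^ (b + 1) * p.eval x.length) :
    ∃ P' : Program s, IsEnumAlg E P' ∧ ∃ (t' : ℕ → ℕ) (p' : Polynomial ℕ), Computable t' ∧
      ∀ x, ∀ i ≤ (E.Sol x).card,
        delay E P' x i ≤ t' (E.κ x) * p'.eval x.length * (i + 1) ^ b := by
  obtain ⟨K, pK, hK⟩ := E.κ_polyTime
  -- One monomial bound serves both as step bound for `K` and as the polynomial factor of the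
  -- budget.
  obtain ⟨C, d, hC⟩ := exists_eval_le (pK + p)
  simp only [Polynomial.eval_add] at hC
  obtain ⟨M, hM⟩ := exists_program_of_computable s ht
  obtain ⟨T, hT, hTM⟩ := exists_computable_haltTime_arg M fun k => (hM k).imp fun _ h => h.1
  obtain ⟨H, hH, hHP⟩ := exists_computable_haltTime P fun x => (hP.exists_halt x).imp fun _ h => h.1
  obtain ⟨pS, hpS⟩ := E.Sol_length
  have hK' : ∀ x, (run K x (C * (x.length + 1) ^ d)).reg 0 = E.κ x := by
    intro x
    obtain ⟨m, h1, h2, h3⟩ := hK x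
    have := hC x.length
    rw [h2.run_eq (by omega), h3]
  obtain ⟨B, ⟨qB, hqB⟩, hB⟩ := exists_fits E (M := M) C d (C * (b + 1)) b hP.1 hK'
  let Pm := mainProgram K M P C d (C * (b + 1)) b
  let I : Polynomial ℕ := 2 * (Polynomial.C d * (6 * (Polynomial.X + 1) + 6)) +
    Polynomial.C C * (Polynomial.X + 1) ^ d * Polynomial.C (5 * K.length + 15) +
    Polynomial.X * Polynomial.C (5 * M.length + 20) + 6 * Polynomial.C (C * (b + 1)) + 24
  let J : Polynomial ℕ := Polynomial.C (12 * b) + (Polynomial.X + 1) ^ d *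
    Polynomial.C (C * (b + 1)) * Polynomial.C (5 * P.length + 25) +
    pS * Polynomial.C (5 * s + 10) + 24
  let p' : Polynomial ℕ := I + 2 * J + Polynomial.C (5 * P.length + 27)
  -- The summand `t k` pays for the phases and `H (T k)` for the direct simulation; the `1` lets the
  -- purely polynomial terms be multiplied by `t'`.
  let t' : ℕ → ℕ := fun k => t k + H (T k) + 1
  have ht' : Computable t' := Primrec.succ.to_comp.comp
    (Primrec.nat_add.to_comp.comp ht (hH.comp hT))
  have hI : ∀ n, initTime K M C d (C * (b + 1)) n = I.eval n := fun n => by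
    simp [I, initTime]
  have key : ∀ x, (∃ m, HaltedAt Pm x m ∧ (run Pm x m).out.Nodup ∧
      (run Pm x m).out.toFinset = E.Sol x ∧ ∀ u ≤ m, ∀ r, (run Pm x u).reg r ≤ B x) ∧
      ∀ i ≤ (E.Sol x).card, delay E Pm x i ≤ t' (E.κ x) * p'.eval x.length * (i + 1) ^ b := by
    intro x
    have F := hB x
    obtain ⟨h, hh, hnd, hfin, hcard⟩ := hP.exists_halt x
    have ht1 : 1 ≤ t' (E.κ x) := by simp [t']
    have hp' : p'.eval x.length = I.eval x.length + 2 * J.eval x.length + (5 * P.length + 27) := by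
      simp [p']
    rcases lt_or_ge ((step M [])^[x.length] (argCfg s (E.κ x))).pc M.length with hlt | hge
    -- `M` has not halted within `|x|` steps, so the input is short in terms of the parameter, and
    -- every delay may be as long as the whole run.
    · have hxT : x.length ≤ T (E.κ x) := by
        by_contra hc
        have := iterate_step_of_halted (hTM (E.κ x)) (not_le.1 hc).le
        rw [this] at hlt
        exact absurd (hTM (E.κ x)) (not_le.2 hlt)
      have hHx := hHP _ x hxT
      have hout : (run P x (H (T (E.κ x)))).out = (run P x h).out := by
        rcases le_total h (H (T (E.κ x))) with hle | hle
        · rw [hh.run_eq hle]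
        · rw [hHx.run_eq hle]
      obtain ⟨m, hm, h1, h2, h3⟩ := F.direct hlt hHx
      rw [hout] at h2
      refine ⟨⟨m, h1, by rwa [h2], by rw [h2, hfin], h3⟩, fun i hi => ?_⟩
      refine (delay_le_of_halted h1 (by rw [h2, hcard])).trans (hm.trans ?_)
      refine le_trans ?_ (Nat.le_mul_of_pos_right _ (by positivity))
      have hle : H (T (E.κ x)) * (5 * P.length + 16) ≤ t' (E.κ x) * (5 * P.length + 16) :=
        Nat.mul_le_mul_right _ (by simp only [t']; omega)
      have hle' : I.eval x.length + 11 ≤ t' (E.κ x) * (I.eval x.length + 11) :=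
        Nat.le_mul_of_pos_left _ ht1
      rw [hI, hp']
      calc I.eval x.length + H (T (E.κ x)) * (5 * P.length + 16) + 11
          ≤ t' (E.κ x) * (I.eval x.length + 11) + t' (E.κ x) * (5 * P.length + 16) := by omega
        _ = t' (E.κ x) * (I.eval x.length + (5 * P.length + 27)) := by ring
        _ ≤ _ := Nat.mul_le_mul_left _ (by omega)
    · have hτ : ((step M [])^[x.length] (argCfg s (E.κ x))).reg 1 = t (E.κ x) := by
        obtain ⟨m, h1, h2⟩ : ∃ m, M.length ≤ ((step M [])^[m] (argCfg s (E.κ x))).pc ∧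
            ((step M [])^[m] (argCfg s (E.κ x))).reg 1 = t (E.κ x) := hM (E.κ x)
        rw [← h2]
        rcases le_total m x.length with hle | hle
        · rw [iterate_step_of_halted h1 hle]
        · rw [iterate_step_of_halted hge hle]
      obtain ⟨S, hS⟩ : ∃ S, S = budget M d (C * (b + 1)) (E.κ x) x.length := ⟨_, rfl⟩
      have hS' : S = t (E.κ x) * (x.length + 1) ^ d * C * (b + 1) := by
        rw [hS, budget, hτ]; ring
      have hpre : ∀ m, (run P x m).out <+: (run P x h).out := by
        intro m
        rw [← hh.run_eq (le_max_right m h)]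
        exact run_out_prefix (le_max_left _ _)
      -- The first `j + 1` phases simulate at least the time in which `P` makes `j + 1` outputs, so
      -- a word is waiting in each of them.
      have hcount : ∀ j < (E.Sol x).card,
          j < (run P x (phaseSum S b (j + 1))).out.length := by
        intro j hj
        refine le_length_of_outTime_le (i := j + 1) (m' := h) (by omega) ((hp x _ hj).trans ?_)
        rw [hS']
        refine le_trans ?_ (pow_succ_le_phaseSum _ b (j + 1))
        have := hC x.length
        calc t (E.κ x) * (j + 1) ^ (b + 1) * p.eval x.length
            ≤ t (E.κ x) * (j + 1) ^ (b + 1) * (C * (x.length + 1) ^ d) :=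
              Nat.mul_le_mul_left _ (by omega)
          _ = _ := by ring
      have hlenle : ∀ m, (run P x m).out.length ≤ (E.Sol x).card := fun m => by
        rw [← hcard]; exact (hpre m).length_le
      have hW : ∀ m, ∀ w ∈ (run P x m).out, w.length ≤ pS.eval x.length := by
        intro m w hw
        have hw' : w ∈ E.Sol x := by
          rw [← hfin, List.mem_toFinset]
          exact (hpre m).subset hw
        exact hpS x ((E.Sol_nonempty_iff x).1 ⟨w, hw'⟩) w hw'
      obtain ⟨τ, m, h0, h1, h2, h3, h4, h5, h6⟩ := F.phased hge hW hlenle (by rwa [← hS])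
      rw [← hS] at h2 h3 h5
      -- A prefix of the final output with the full number of words is the final output, whether or
      -- not `P` has halted by then.
      have hout : (run P x (phaseSum S b ((E.Sol x).card + 1))).out = (run P x h).out := by
        refine (hpre _).eq_of_length (le_antisymm (hpre _).length_le ?_)
        rw [hcard]
        rcases Nat.eq_zero_or_pos (E.Sol x).card with h | h
        · omega
        · obtain ⟨N, hN⟩ : ∃ N, (E.Sol x).card = N + 1 := ⟨_, (Nat.succ_pred_eq_of_pos h).symm⟩
          have h7 := hcount N (by omega)
          have h8 := (run_out_prefix (P := P) (x := x) (phaseSum_mono S b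
            (show N + 1 ≤ (E.Sol x).card + 1 by omega))).length_le
          omega
      rw [hout] at h5
      refine ⟨⟨m, h4, by rwa [h5], by rw [h5, hfin], h6⟩, fun i hi => ?_⟩
      have hd : delay E Pm x i ≤ _ := delay_le_of_times (T := phaseTime P b S (pS.eval x.length)) h1 h2 h3 h4 hi
      have hph : ∀ j ≤ i, phaseTime P b S (pS.eval x.length) j ≤
          t' (E.κ x) * J.eval x.length * (i + 1) ^ b := by
        intro j hj
        refine (phaseTime_le P b S _ j).trans (Nat.mul_le_mul ?_
          (Nat.pow_le_pow_left (by omega) _))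
        have e : J.eval x.length = 12 * b + (x.length + 1) ^ d * (C * (b + 1)) *
            (5 * P.length + 25) + pS.eval x.length * (5 * s + 10) + 24 := by
          simp [J]
        have hS'' : S * (5 * P.length + 25) ≤ t' (E.κ x) * ((x.length + 1) ^ d * (C * (b + 1)) *
            (5 * P.length + 25)) := by
          rw [hS']
          calc _ = t (E.κ x) * ((x.length + 1) ^ d * (C * (b + 1)) * (5 * P.length + 25)) := by
                ring
            _ ≤ _ := Nat.mul_le_mul_right _ (by simp only [t']; omega)
        have hr : 12 * b + pS.eval x.length * (5 * s + 10) + 24 ≤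
            t' (E.κ x) * (12 * b + pS.eval x.length * (5 * s + 10) + 24) :=
          Nat.le_mul_of_pos_left _ ht1
        rw [e]
        calc _ ≤ t' (E.κ x) * ((x.length + 1) ^ d * (C * (b + 1)) * (5 * P.length + 25)) +
              t' (E.κ x) * (12 * b + pS.eval x.length * (5 * s + 10) + 24) := by omega
          _ = _ := by ring
      have hini : τ 0 ≤ t' (E.κ x) * I.eval x.length * (i + 1) ^ b := by
        rw [hI] at h0
        refine h0.trans ((Nat.le_mul_of_pos_left _ ht1).trans
          (Nat.le_mul_of_pos_right _ (by positivity)))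
      have hp1 := hph i le_rfl
      have hp2 := hph (i - 1) (by omega)
      rw [hp']
      calc delay E Pm x i ≤ t' (E.κ x) * I.eval x.length * (i + 1) ^ b +
            t' (E.κ x) * J.eval x.length * (i + 1) ^ b +
            t' (E.κ x) * J.eval x.length * (i + 1) ^ b := by omega
        _ = t' (E.κ x) * (I.eval x.length + 2 * J.eval x.length) * (i + 1) ^ b := by ring
        _ ≤ _ := Nat.mul_le_mul_right _ (Nat.mul_le_mul_left _ (by omega))
  -- Binary size at most `q` means a value strictly below `2 ^ q`, whereas `B x` may equal that
  -- power; hence one more bit.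
  refine ⟨Pm, ⟨⟨qB + 1, fun x m r => ?_⟩, fun x => ?_⟩, t', p', ht', fun x => (key x).2⟩
  · obtain ⟨m₀, h1, _, _, h2⟩ := (key x).1
    have h3 : (run Pm x m).reg r ≤ B x := by
      rcases le_total m m₀ with hle | hle
      · exact h2 m hle r
      · rw [h1.run_eq hle]; exact h2 m₀ le_rfl r
    rw [Nat.size_le, Polynomial.eval_add, Polynomial.eval_one, pow_succ]
    have := hqB x
    have : 0 < 2 ^ qB.eval x.length := by positivity
    omega
  · obtain ⟨m, h1, h2, h3, _⟩ := (key x).1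
    exact ⟨m, h1, h2, h3⟩

/-- A polynomial in two variables is bounded by a polynomial in the first one times a power of the
second one. -/
theorem exists_eval_le_mul_pow (p : MvPolynomial (Fin 2) ℕ) : ∃ (q : Polynomial ℕ) (a : ℕ),
    ∀ n i, MvPolynomial.eval ![n, i] p ≤ q.eval n * (i + 1) ^ a := by
  induction p using MvPolynomial.induction_on with
  | C c => exact ⟨Polynomial.C c, 0, fun n i => by simp⟩
  | add p p' hp hp' =>
    obtain ⟨q, a, h⟩ := hp
    obtain ⟨q', a', h'⟩ := hp'
    refine ⟨q + q', a + a', fun n i => ?_⟩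
    rw [map_add, Polynomial.eval_add, add_mul]
    exact add_le_add
      ((h n i).trans (Nat.mul_le_mul_left _ (Nat.pow_le_pow_right (by omega) (by omega))))
      ((h' n i).trans (Nat.mul_le_mul_left _ (Nat.pow_le_pow_right (by omega) (by omega))))
  | mul_X p j hp =>
    obtain ⟨q, a, h⟩ := hp
    fin_cases j
    · refine ⟨q * Polynomial.X, a, fun n i => ?_⟩
      have := Nat.mul_le_mul_right n (h n i)
      simp only [map_mul, MvPolynomial.eval_X, Polynomial.eval_mul, Polynomial.eval_X]
      calc _ ≤ q.eval n * (i + 1) ^ a * n := this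
        _ = _ := by ring
    · refine ⟨q, a + 1, fun n i => ?_⟩
      have := Nat.mul_le_mul (h n i) (Nat.le_succ i)
      simp only [map_mul, MvPolynomial.eval_X]
      calc _ ≤ q.eval n * (i + 1) ^ a * (i + 1) := this
        _ = _ := by ring

/-- The time of the `i`-th output is bounded by the sum of the delays before. -/
theorem outTime_le_mul {E : PEP s} {P : Program s} {x : Word s} {D i : ℕ}
    (hi : i ≤ (E.Sol x).card) (hD : ∀ j < i, delay E P x j ≤ D) : outTime P x i ≤ i * D := by
  induction i with
  | zero => simp [outTime_zero]
  | succ i ih =>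
    have h1 := ih (by omega) fun j hj => hD j (by omega)
    have h2 := outTime_succ_le E P x hi
    have h3 := hD i (by omega)
    rw [Nat.add_mul, one_mul]
    omega

/-- This is the conversion with `b = 0`, where all phases simulate equally many steps; conversely,
`i` delays are added. -/
theorem capIncFPTSlice_one_eq_delayFPT : CapIncFPTSlice s 1 = DelayFPT s := by
  ext E
  constructor
  · rintro ⟨P, hP, t, p, ht, hp⟩
    obtain ⟨P', hP', t', p', ht', hp'⟩ := exists_enumAlg_of_outTime_le (b := 0) hP ht hp
    exact ⟨P', hP', t', p', ht', fun x i hi => by simpa using hp' x i hi⟩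
  · rintro ⟨P, hP, t, p, ht, hp⟩
    refine ⟨P, hP, t, p, ht, fun x i hi => ?_⟩
    refine (outTime_le_mul hi fun j hj => hp x j (by omega)).trans (le_of_eq ?_)
    ring

theorem capIncFPT_eq_incFPT : CapIncFPT s = IncFPT s := by
  ext E
  rw [CapIncFPT, Set.mem_iUnion]
  constructor
  · rintro ⟨a, P, hP, t, p, ht, hp⟩
    -- Raising the exponent gives it the form `b + 1`. The case `i = 0`, where the larger power need
    -- not be larger, holds because the `0`-th output time is zero.
    have hp₁ : ∀ x, ∀ i ≤ (E.Sol x).card,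
        outTime P x i ≤ t (E.κ x) * i ^ (a + 1) * p.eval x.length := by
      intro x i hi
      rcases Nat.eq_zero_or_pos i with rfl | h
      · simp [outTime_zero]
      · exact (hp x i hi).trans (Nat.mul_le_mul_right _ (Nat.mul_le_mul_left _
          (Nat.pow_le_pow_right h (Nat.le_succ a))))
    obtain ⟨P', hP', t', p', ht', hp'⟩ := exists_enumAlg_of_outTime_le hP ht hp₁
    refine ⟨P', hP', t', p'.eval₂ MvPolynomial.C (MvPolynomial.X 0) * (MvPolynomial.X 1 + 1) ^ a,
      ht', fun x i hi => (hp' x i hi).trans (le_of_eq ?_)⟩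
    have e : MvPolynomial.eval ![x.length, i] (p'.eval₂ MvPolynomial.C (MvPolynomial.X 0)) =
        p'.eval x.length := by
      rw [Polynomial.hom_eval₂, MvPolynomial.eval_X, Polynomial.eval]
      congr 1
      ext; simp
    rw [map_mul, e]
    simp [mul_assoc]
  · rintro ⟨P, hP, t, p, ht, hp⟩
    obtain ⟨q, a, hq⟩ := exists_eval_le_mul_pow p
    -- Delays with index `j < i` have `j + 1 ≤ i`, so each is bounded with `i ^ a`; summing `i` of
    -- them raises the exponent by one.
    refine ⟨a + 1, P, hP, t, q, ht, fun x i hi => ?_⟩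
    refine (outTime_le_mul (D := t (E.κ x) * (q.eval x.length * i ^ a)) hi fun j hj => ?_).trans
      (le_of_eq (by ring))
    exact (hp x j (by omega)).trans (Nat.mul_le_mul_left _ ((hq _ _).trans
      (Nat.mul_le_mul_left _ (Nat.pow_le_pow_left (by omega) _))))

end EnumFPT

theorem mainTheorem7 (s : ℕ) :
    EnumFPT.CapIncFPTSlice s 1 = EnumFPT.DelayFPT s ∧
      EnumFPT.CapIncFPT s = EnumFPT.IncFPT s :=
  ⟨EnumFPT.capIncFPTSlice_one_eq_delayFPT, EnumFPT.capIncFPT_eq_incFPT⟩
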